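/- **Notation.** A partition is written $\Delta=1^{m_1(\Delta)}2^{m_2(\Delta)}\cdots$, with $|\Delta|=\sum_i i\,m_i(\Delta)$, $l(\Delta)=\sum_i m_i(\Delta)$, $\|\Delta\|=\prod_i i^{m_i(\Delta)}$; the sum of partitions adds the multiplicities $m_i$; $[\Delta,1^{n-|\Delta|}]$ is $\Delta$ with $n-|\Delta|$ rows of length $1$ added. Let $p=(p_1,p_2,\dots)$ be indeterminates, $p_\Delta=\prod_i p_i^{m_i(\Delta)}$, $\frac{\partial}{\partial p_\Delta}=\prod_i\big(\frac{\partial}{\partial p_i}\big)^{m_i(\Delta)}$. Let $z$ be an invertible parameter (an invertible element of a commutative $\mathbb C$-algebra $R$, e.g. a nonzero complex number, or the indeterminate in $\mathbb C[z,z^{-1}]$); "functions" of $p$ are formal power series in $p$ over $R$. *Structure constants.* A partial permutation is a pair $(E,f)$ of a finite set $E$ of positive integers and a permutation $f$ of $E$; the product is $(E_1,f_1)(E_2,f_2)=(E_1\cup E_2,f_1f_2)$. Let $\mathcal P_n$ be the semigroup of those with $E\subseteq\{1,\dots,n\}$, $\mathcal A_n\subseteq\mathbb C[\mathcal P_n]$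 the subalgebra of elements invariant under conjugation by the symmetric group $\mathcal S_n$, and $\mathcal A_\infty$ the projective limit of the algebras $\mathcal A_n$, filtered by $\deg(E,f)=|E|$ (sequences of bounded degree), along the maps that keep $(E,f)$ if $E\subseteq\{1,\dots,m\}$ and send it to $0$ otherwise. The elements $A_\Delta=\sum(E,f)$, over all $(E,f)$ with $f\in\mathcal S_E$ of cycle type $\Delta$ (fixed points in $E$ being rows of length $1$), form a basis of $\mathcal A_\infty$, and $\hat C_{\Delta_1\Delta_2}^{\Delta_3}$ are its structure constants: $A_{\Delta_1}A_{\Delta_2}=\sum_{\Delta_3}\hat C_{\Delta_1\Delta_2}^{\Delta_3}A_{\Delta_3}$ (a finite sum). *Characters.* For a partition (Young diagram) $\lambda$ let $\chi_\lambda$ and $\dim\lambda$ be the character and the dimension of the irreducible representation of $\mathcal S_{|\lambda|}$ corresponding to $\lambda$, and let $|C_{\Delta;n}|$ be the number of permutations in $\mathcal S_n$ of cycle type $[\Delta,1^{n-|\Delta|}]$. The normalized shifted characters are $$\varphi_\lambda(\Delta)=\binom{|\lambda|-|\Delta|+m_1(\Delta)}{m_1(\Delta)}\frac{1}{\dim\lambda}\,|C_{\Delta;|\lambda|}|\,\chi_\lambda([\Delta,1^{|\lambda|-|\Delta|}])\quad(|\Delta|\le|\lambda|),\qquad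 \varphi_\lambda(\Delta)=0\quad(|\Delta|>|\lambda|),$$ and the genus expanded Schur functions are $$S_\lambda\{p,z\}=\sum_{|\Gamma|=|\lambda|}z^{-|\Gamma|-l(\Gamma)}\,\frac{\dim\lambda}{|\lambda|!}\,\varphi_\lambda(\Gamma)\,p_\Gamma .$$ *Hurwitz numbers.* Let $CU_0^{h,n}(\Delta_1,\Delta_2,\Delta_3)$ be the connected shifted Hurwitz number: $\prod_{i=1}^3\binom{n-|\Delta_i|+m_1(\Delta_i)}{m_1(\Delta_i)}$ times the number, weighted by inverse orders of automorphism groups, of connected degree $n$ coverings of the sphere with ramification types $[\Delta_i,1^{n-|\Delta_i|}]$ at three given points. In terms of monodromy this weighted number is $\frac1{n!}$ times the number of triples in $\mathcal S_n$ of these cycle types, with product $1$ and generating a transitive subgroup. It is $0$ if $n=0$ or if some $|\Delta_i|>n$. The genus $h\ge0$ of the covering surface is determined by the Riemann–Hurwitz formula. *Operators.* For a partition $\Delta$, the shifted genus expanded cut-and-join operator is $$W(\Delta,z)=\sum\frac{z^{|\Delta|-l(\Delta)+l(\Gamma')-l(\Gamma)}}{|\mathrm{Aut}(\Gamma',\tilde\Delta,\Gamma)|}\Big(\prod_i\|\Gamma'_i\|\,\delta_{|\Gamma_i|,|\Gamma'_i|}\,CU_0^{h_i,|\Gamma'_i|}(\Gamma'_i,\Delta^i,\Gamma_i)\Big)\,p_\Gamma\frac{\partial}{\partial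 p_{\Gamma'}},$$ where the sum is over all finite families, up to reordering, of triples of partitions $(\Gamma'_i,\Delta^i,\Gamma_i)$ with $|\Delta^i|\ge1$ and $\sum_i\Delta^i=\Delta$; here $\Gamma'=\sum_i\Gamma'_i$, $\Gamma=\sum_i\Gamma_i$, and $|\mathrm{Aut}|$ is the number of permutations of the indices that preserve all the triples. **Theorem.** For all partitions $\Delta_1,\Delta_2$, as operators on functions of $p$, $$W(\Delta_1,z)\,W(\Delta_2,z)=\sum_{\Delta_3}z^{(|\Delta_1|-l(\Delta_1))+(|\Delta_2|-l(\Delta_2))-(|\Delta_3|-l(\Delta_3))}\,\hat C_{\Delta_1\Delta_2}^{\Delta_3}\,W(\Delta_3,z).$$ Moreover, for all partitions $\Delta$ and $\lambda$, $$W(\Delta,z)\,S_\lambda\{p,z\}=z^{|\Delta|-l(\Delta)}\,\varphi_\lambda(\Delta)\,S_\lambda\{p,z\}.$$ -/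

import Mathlib

open scoped Nat

noncomputable section

namespace CutJoin

/-! ### Partitions -/

/-- A partition of a nonnegative integer in multiplicity notation `1^{m₁} 2^{m₂} 3^{m₃} ⋯`:
`Δ i` is the number of rows of length `i`.  The sum of two partitions adds the multiplicities. -/
abbrev Part : Type := ℕ+ →₀ ℕ

/-- `|Δ| = ∑ i mᵢ(Δ)`. -/
def size (Δ : Part) : ℕ := Δ.sum fun i m => (i : ℕ) * m

/-- `l(Δ) = ∑ mᵢ(Δ)`, the number of rows. -/
def len (Δ : Part) : ℕ := Δ.sum fun _ m => m

/-- `‖Δ‖ = ∏ i ^ mᵢ(Δ)`. -/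
def rowProd (Δ : Part) : ℕ := Δ.prod fun i m => (i : ℕ) ^ m

/-- The shifting `[Δ, 1^{n-|Δ|}]` (meaningful for `|Δ| ≤ n`; otherwise it is `Δ` itself,
which is not a partition of `n`). -/
def shift (n : ℕ) (Δ : Part) : Part := Δ + Finsupp.single 1 (n - size Δ)

/-- The cycle type of a permutation of a finite set, as a partition; fixed points are cycles
of length `1`. -/
def cycType {α : Type*} [Fintype α] [DecidableEq α] (σ : Equiv.Perm α) : Part :=
  Multiset.toFinsupp (σ.partition.parts.map Nat.toPNat')

/-! ### Partial permutations -/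

/-- A partial permutation `(E, f)` of the set of positive integers: a finite set `E` and a
permutation `f` of `E`.  The permutation is extended to all positive integers by the identity
outside `E`. -/
@[ext]
structure PPerm where
  /-- the support `E` -/
  supp : Finset ℕ+
  /-- the permutation `f`, extended by the identity -/
  perm : Equiv.Perm ℕ+
  fix : ∀ i, i ∉ supp → perm i = i

namespace PPerm

lemma perm_mem_iff (x : PPerm) (i : ℕ+) : x.perm i ∈ x.supp ↔ i ∈ x.supp := by
  constructor
  · intro h
    by_contra hi
    rw [x.fix i hi] at h
    exact hi h
  · intro h
    by_contra hi
    have h2 := x.fix _ hi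
    have h3 := x.perm.injective h2
    rw [h3] at hi
    exact hi h

/-- The permutation `f` of the finite set `E`. -/
def restrict (x : PPerm) : Equiv.Perm x.supp := x.perm.subtypePerm fun i => x.perm_mem_iff i

/-- The cycle type of a partial permutation: the cycle type of `f` as a permutation of `E`. -/
def type (x : PPerm) : Part := cycType x.restrict

/-- The product `(E₁, f₁) (E₂, f₂) = (E₁ ∪ E₂, f₁ f₂)`, with unit `(∅, e)`. -/
instance : Monoid PPerm where
  mul x y := ⟨x.supp ∪ y.supp, x.perm * y.perm, fun i hi => by
    rw [Finset.mem_union, not_or] at hi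
    rw [Equiv.Perm.mul_apply, y.fix i hi.2, x.fix i hi.1]⟩
  one := ⟨∅, 1, fun _ _ => rfl⟩
  mul_assoc x y z := PPerm.ext (Finset.union_assoc _ _ _) (mul_assoc _ _ _)
  one_mul x := PPerm.ext (Finset.empty_union _) (one_mul _)
  mul_one x := PPerm.ext (Finset.union_empty _) (mul_one _)

lemma supp_mul (x y : PPerm) : (x * y).supp = x.supp ∪ y.supp := rfl

lemma perm_mul (x y : PPerm) : (x * y).perm = x.perm * y.perm := rfl

/-- `x ∈ 𝒫ₙ`: the support is contained in `{1, …, n}`. -/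
def IsIn (n : ℕ) (x : PPerm) : Prop := ∀ i ∈ x.supp, (i : ℕ) ≤ n

/-- The conjugation `(E, f) ↦ (vE, v f v⁻¹)`. -/
def conj (v : Equiv.Perm ℕ+) : PPerm →* PPerm where
  toFun x := ⟨x.supp.map v.toEmbedding, v * x.perm * v⁻¹, fun i hi => by
    have h : v⁻¹ i ∉ x.supp := fun h => hi <| by
      simpa using Finset.mem_map_of_mem v.toEmbedding h
    rw [Equiv.Perm.mul_apply, Equiv.Perm.mul_apply, x.fix _ h]
    simp⟩
  map_one' := PPerm.ext rfl (by
    change v * 1 * v⁻¹ = 1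
    simp)
  map_mul' x y := PPerm.ext (Finset.map_union _ _) (by
    change v * (x.perm * y.perm) * v⁻¹ = v * x.perm * v⁻¹ * (v * y.perm * v⁻¹)
    group)

end PPerm

/-- The multiplicative map underlying `θₘ`. -/
def thetaHom (m : ℕ) : PPerm →* MonoidAlgebra ℂ PPerm := by
  classical
  exact
  { toFun := fun x => if x.IsIn m then MonoidAlgebra.of ℂ PPerm x else 0
    map_one' := by
      rw [if_pos]
      · exact map_one _
      · intro i hi
        exact absurd hi (Finset.notMem_empty i)
    map_mul' := fun x y => by
      have h : (x * y).IsIn m ↔ x.IsIn m ∧ y.IsIn m := by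
        simp only [PPerm.IsIn, PPerm.supp_mul, Finset.mem_union]
        constructor
        · exact fun h => ⟨fun i hi => h i (Or.inl hi), fun i hi => h i (Or.inr hi)⟩
        · rintro ⟨h1, h2⟩ i (hi | hi)
          · exact h1 i hi
          · exact h2 i hi
      by_cases hx : x.IsIn m <;> by_cases hy : y.IsIn m <;> simp [h, hx, hy] }

/-- The truncation `θₘ`, which keeps `(E, f)` if `E ⊆ {1, …, m}` and sends it to `0` otherwise.
Its image is the semigroup algebra `ℬₘ = ℂ[𝒫ₘ]`. -/
def theta (m : ℕ) : MonoidAlgebra ℂ PPerm →ₐ[ℂ] MonoidAlgebra ℂ PPerm :=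
  MonoidAlgebra.lift ℂ (MonoidAlgebra ℂ PPerm) PPerm (thetaHom m)

/-- The projective limit `ℬ_∞` of the algebras `ℬₙ = ℂ[𝒫ₙ]` along the truncations: sequences
`aₙ ∈ ℬₙ` with `θₘ(aₙ) = aₘ` for `m ≤ n` (the case `m = n` says that `aₙ ∈ ℬₙ`). -/
def BInfty : Subalgebra ℂ (ℕ → MonoidAlgebra ℂ PPerm) where
  carrier := {a | ∀ m n, m ≤ n → theta m (a n) = a m}
  mul_mem' {a b} ha hb m n h := by simp [ha m n h, hb m n h]
  add_mem' {a b} ha hb m n h := by simp [ha m n h, hb m n h]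
  algebraMap_mem' r m n _ := (theta m).commutes r

/-- The algebra `𝒜_∞`, the projective limit of the algebras `𝒜ₙ` of `𝒮ₙ`-invariant elements of
`ℬₙ`, taken in the category of algebras filtered by the degree `deg (E, f) = |E|`: the elements
of `ℬ_∞` of bounded degree with `𝒮ₙ`-invariant `n`-th component for every `n`. -/
def AInfty : Subalgebra ℂ (ℕ → MonoidAlgebra ℂ PPerm) where
  carrier := {a | a ∈ BInfty ∧
    (∀ (n : ℕ) (v : Equiv.Perm ℕ+), (∀ i : ℕ+, n < (i : ℕ) → v i = i) →
      MonoidAlgebra.mapDomainAlgHom ℂ ℂ (PPerm.conj v) (a n) = a n) ∧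
    ∃ d : ℕ, ∀ n, ∀ x ∈ (a n).coeff.support, x.supp.card ≤ d}
  mul_mem' {a b} ha hb := by
    classical
    refine ⟨BInfty.mul_mem ha.1 hb.1, fun n v hv => ?_, ?_⟩
    · rw [Pi.mul_apply, map_mul, ha.2.1 n v hv, hb.2.1 n v hv]
    · obtain ⟨d, hd⟩ := ha.2.2
      obtain ⟨e, he⟩ := hb.2.2
      refine ⟨d + e, fun n x hx => ?_⟩
      obtain ⟨y, hy, w, hw, rfl⟩ := Finset.mem_mul.1
        (MonoidAlgebra.support_coeff_mul_subset (a n) (b n) hx)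
      exact (Finset.card_union_le _ _).trans (add_le_add (hd n y hy) (he n w hw))
  add_mem' {a b} ha hb := by
    classical
    refine ⟨BInfty.add_mem ha.1 hb.1, fun n v hv => ?_, ?_⟩
    · rw [Pi.add_apply, map_add, ha.2.1 n v hv, hb.2.1 n v hv]
    · obtain ⟨d, hd⟩ := ha.2.2
      obtain ⟨e, he⟩ := hb.2.2
      refine ⟨d + e, fun n x hx => ?_⟩
      rcases Finset.mem_union.1 (Finsupp.support_add hx) with h | h
      · exact (hd n x h).trans (Nat.le_add_right _ _)
      · exact (he n x h).trans (Nat.le_add_left _ _)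
  algebraMap_mem' r := by
    refine ⟨BInfty.algebraMap_mem r, fun n v hv => ?_, 0, fun n x hx => ?_⟩
    · rw [Pi.algebraMap_apply, AlgHom.commutes]
    · have h : x = 1 := by
        by_contra h
        rw [Finsupp.mem_support_iff] at hx
        apply hx
        rw [Pi.algebraMap_apply, MonoidAlgebra.coe_algebraMap]
        simp [MonoidAlgebra.coeff_single, Ne.symm h]
      rw [h]
      rfl

lemma size_single (i : ℕ+) (m : ℕ) : size (Finsupp.single i m) = i * m := by
  simp [size]

lemma size_add (Δ Γ : Part) : size (Δ + Γ) = size Δ + size Γ := by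
  classical
  exact Finsupp.sum_add_index' (by simp) (by intros; ring)

lemma mul_le_size (Δ : Part) (i : ℕ+) : i * Δ i ≤ size Δ := by
  classical
  by_cases h : i ∈ Δ.support
  · exact Finset.single_le_sum (f := fun j : ℕ+ => (j : ℕ) * Δ j) (fun _ _ => Nat.zero_le _) h
  · rw [Finsupp.notMem_support_iff.1 h]
    simp

/-- There are finitely many partitions of the integers up to `d`. -/
lemma finite_size_le (d : ℕ) : {Δ : Part | size Δ ≤ d}.Finite := by
  classical
  let b : Part := ∑ j ∈ Finset.range d, Finsupp.single j.succPNat d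
  refine (Set.finite_Icc 0 b).subset fun Δ hΔ => ⟨zero_le, fun i => ?_⟩
  have h := (mul_le_size Δ i).trans hΔ
  by_cases h0 : Δ i = 0
  · rw [h0]; exact Nat.zero_le _
  have h1 : Δ i ≤ d := (Nat.le_mul_of_pos_left _ i.pos).trans h
  have h2 : (i : ℕ) ≤ d := (Nat.le_mul_of_pos_right _ (Nat.pos_of_ne_zero h0)).trans h
  have h3 : i.natPred ∈ Finset.range d := by
    rw [Finset.mem_range]
    have := i.natPred_add_one
    omega
  have h4 : (Finsupp.single i d : Part) ≤ b := by
    have := Finset.single_le_sum (f := fun j : ℕ => (Finsupp.single j.succPNat d : Part))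
      (fun _ _ => zero_le) h3
    rwa [PNat.succPNat_natPred] at this
  calc Δ i ≤ d := h1
    _ = (Finsupp.single i d : Part) i := by simp
    _ ≤ b i := h4 i

lemma size_toFinsupp (s : Multiset ℕ+) :
    size (Multiset.toFinsupp s) = (s.map fun i : ℕ+ => (i : ℕ)).sum := by
  induction s using Multiset.induction_on with
  | empty => simp [size]
  | cons a s ih =>
    rw [← Multiset.singleton_add, map_add, size_add, ih]
    simp [size_single]

lemma map_coe_toPNat' {s : Multiset ℕ} (h : ∀ i ∈ s, 0 < i) :
    (s.map Nat.toPNat').map (fun i : ℕ+ => (i : ℕ)) = s := by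
  rw [Multiset.map_map]
  conv_rhs => rw [← Multiset.map_id s]
  refine Multiset.map_congr rfl fun i hi => ?_
  simpa using fun h0 : i = 0 => absurd (h i hi) (by omega)

lemma size_cycType {α : Type*} [Fintype α] [DecidableEq α] (σ : Equiv.Perm α) :
    size (cycType σ) = Fintype.card α := by
  rw [cycType, size_toFinsupp, map_coe_toPNat' fun i hi => σ.partition.parts_pos hi,
    σ.partition.parts_sum]

lemma size_type (x : PPerm) : size x.type = x.supp.card := by
  rw [PPerm.type, size_cycType, Fintype.card_coe]

lemma partition_parts_of_cycType {α β : Type*} [Fintype α] [DecidableEq α] [Fintype β]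
    [DecidableEq β] {σ : Equiv.Perm α} {τ : Equiv.Perm β} (h : cycType σ = cycType τ) :
    σ.partition.parts = τ.partition.parts := by
  have h1 := Multiset.toFinsupp.injective h
  rw [← map_coe_toPNat' fun i hi => σ.partition.parts_pos hi, h1,
    map_coe_toPNat' fun i hi => τ.partition.parts_pos hi]

/-- Permutations of finite sets with the same cycle type are related by a bijection. -/
lemma cycType_eq_iff {α β : Type*} [Fintype α] [DecidableEq α] [Fintype β]
    [DecidableEq β] (σ : Equiv.Perm α) (τ : Equiv.Perm β) :
    cycType σ = cycType τ ↔ ∃ e : α ≃ β, ∀ a, e (σ a) = τ (e a) := by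
  have key : ∀ e : α ≃ β, cycType (σ.extendDomain
      (e.trans (Equiv.subtypeUnivEquiv (p := fun _ : β => True) fun _ => trivial).symm)) =
      cycType σ := by
    intro e
    have hc := σ.cycleType_extendDomain
      (e.trans (Equiv.subtypeUnivEquiv (p := fun _ : β => True) fun _ => trivial).symm)
    rw [cycType, cycType, Equiv.Perm.parts_partition, Equiv.Perm.parts_partition, hc,
      ← Equiv.Perm.sum_cycleType, ← Equiv.Perm.sum_cycleType, hc, Fintype.card_congr e]
  have app : ∀ (e : α ≃ β) a, (σ.extendDomain
      (e.trans (Equiv.subtypeUnivEquiv (p := fun _ : β => True) fun _ => trivial).symm)) (e a)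
      = e (σ a) := fun e a => σ.extendDomain_apply_image
      (e.trans (Equiv.subtypeUnivEquiv (p := fun _ : β => True) fun _ => trivial).symm) a
  constructor
  · intro h
    have hcard : Fintype.card α = Fintype.card β := by
      rw [← size_cycType σ, h, size_cycType]
    have e := Fintype.equivOfCardEq hcard
    have h2 := partition_parts_of_cycType ((key e).trans h)
    have h3 := Equiv.Perm.partition_eq_of_isConj.2 (Nat.Partition.ext h2)
    obtain ⟨c, hc⟩ := isConj_iff.1 h3
    refine ⟨e.trans c, fun a => ?_⟩
    rw [Equiv.trans_apply, Equiv.trans_apply, ← app e a, ← hc]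
    simp
  · rintro ⟨e, he⟩
    rw [← key e]
    congr 1
    ext b
    obtain ⟨a, rfl⟩ := e.surjective b
    rw [app, he]

/-- Partial permutations with supports in `{1, …, n}` and the same cycle type are conjugate
under `𝒮ₙ`. -/
lemma exists_conj {n : ℕ} {x y : PPerm} (hx : x.IsIn n) (hy : y.IsIn n) (h : x.type = y.type) :
    ∃ v : Equiv.Perm ℕ+, (∀ i : ℕ+, n < (i : ℕ) → v i = i) ∧ PPerm.conj v x = y := by
  classical
  obtain ⟨e, he⟩ := (cycType_eq_iff _ _).1 h
  let I : Type := {i : ℕ+ // i ∈ Finset.univ.image fun j : Fin n => (j : ℕ).succPNat}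
  have hI : ∀ i : ℕ+, (i : ℕ) ≤ n → i ∈ Finset.univ.image fun j : Fin n => (j : ℕ).succPNat := by
    intro i hi
    refine Finset.mem_image.2 ⟨⟨i.natPred, ?_⟩, Finset.mem_univ _, ?_⟩
    · have := i.natPred_add_one
      omega
    · simp
  have hI' : ∀ i : ℕ+, (i ∈ Finset.univ.image fun j : Fin n => (j : ℕ).succPNat) →
      (i : ℕ) ≤ n := by
    intro i hi
    obtain ⟨j, -, rfl⟩ := Finset.mem_image.1 hi
    simp
  have : Finite I := inferInstanceAs (Finite {i : ℕ+ // i ∈ _})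
  let e' : {i : I // i.1 ∈ x.supp} ≃ {i : I // i.1 ∈ y.supp} :=
    { toFun := fun i => ⟨⟨(e ⟨i.1.1, i.2⟩).1, hI _ (hy _ (e ⟨i.1.1, i.2⟩).2)⟩, (e ⟨i.1.1, i.2⟩).2⟩
      invFun := fun i => ⟨⟨(e.symm ⟨i.1.1, i.2⟩).1, hI _ (hx _ (e.symm ⟨i.1.1, i.2⟩).2)⟩,
        (e.symm ⟨i.1.1, i.2⟩).2⟩
      left_inv := fun i => by simp
      right_inv := fun i => by simp }
  let v : Equiv.Perm ℕ+ := Equiv.Perm.ofSubtype e'.extendSubtype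
  have hv : ∀ i : x.supp, v i.1 = (e i).1 := by
    intro i
    have h1 : v i.1 = (e'.extendSubtype ⟨i.1, hI _ (hx _ i.2)⟩ : I).1 :=
      Equiv.Perm.ofSubtype_apply_of_mem _ (hI _ (hx _ i.2))
    rw [h1, Equiv.extendSubtype_apply_of_mem e' ⟨i.1, hI _ (hx _ i.2)⟩ i.2]
    rfl
  refine ⟨v, fun i hi => Equiv.Perm.ofSubtype_apply_of_not_mem _ fun h => ?_, ?_⟩
  · exact absurd (hI' i h) (not_le.2 hi)
  have hs : (PPerm.conj v x).supp = y.supp := by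
    ext j
    change j ∈ x.supp.map v.toEmbedding ↔ _
    rw [Finset.mem_map]
    constructor
    · rintro ⟨i, hi, rfl⟩
      have := hv ⟨i, hi⟩
      simp only [Equiv.coe_toEmbedding]
      rw [this]
      exact (e ⟨i, hi⟩).2
    · intro hj
      refine ⟨(e.symm ⟨j, hj⟩).1, (e.symm ⟨j, hj⟩).2, ?_⟩
      simp [hv]
  refine PPerm.ext hs (Equiv.ext fun j => ?_)
  by_cases hj : j ∈ y.supp
  · change v (x.perm (v⁻¹ j)) = y.perm j
    have h1 : v⁻¹ j = (e.symm ⟨j, hj⟩).1 := by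
      rw [Equiv.Perm.inv_eq_iff_eq, hv]
      simp
    have h2 : x.perm (e.symm ⟨j, hj⟩).1 = (x.restrict (e.symm ⟨j, hj⟩)).1 := rfl
    rw [h1, h2, hv, he]
    simp [PPerm.restrict]
  · rw [y.fix j hj, (PPerm.conj v x).fix j (by rwa [hs])]

lemma type_conj (v : Equiv.Perm ℕ+) (x : PPerm) : (PPerm.conj v x).type = x.type := by
  classical
  symm
  refine (cycType_eq_iff _ _).2 ⟨⟨fun i => ⟨v i.1, Finset.mem_map_of_mem _ i.2⟩,
    fun j => ⟨v⁻¹ j.1, ?_⟩, fun i => by simp, fun j => by simp⟩, fun i => ?_⟩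
  · obtain ⟨i, hi, h⟩ := Finset.mem_map.1 j.2
    rw [← h]
    simpa using hi
  · apply Subtype.ext
    change v (x.perm i.1) = v (x.perm (v⁻¹ (v i.1)))
    simp

/-- Every partition is the cycle type of a partial permutation of `{1, …, |Δ|}`. -/
lemma exists_type (Δ : Part) : ∃ x : PPerm, x.IsIn (size Δ) ∧ x.type = Δ := by
  classical
  let E : Finset ℕ+ := (Finset.range (size Δ)).image Nat.succPNat
  have hE : E.card = size Δ := by
    rw [Finset.card_image_of_injective _ Nat.succPNat_injective, Finset.card_range]
  let s : Multiset ℕ := (Finsupp.toMultiset Δ).map fun i : ℕ+ => (i : ℕ)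
  have hs : s.sum = size Δ := by
    rw [← size_toFinsupp, Finsupp.toMultiset_toFinsupp]
  have hpos : ∀ i ∈ s, 0 < i := by
    intro i hi
    obtain ⟨j, -, rfl⟩ := Multiset.mem_map.1 hi
    exact j.pos
  have hsplit : s.filter (2 ≤ ·) + Multiset.replicate (s.count 1) 1 = s := by
    conv_rhs => rw [← Multiset.filter_add_not (2 ≤ ·) s]
    congr 1
    rw [← Multiset.filter_eq']
    refine Multiset.filter_congr fun i hi => ?_
    have := hpos i hi
    omega
  have hsum : (s.filter (2 ≤ ·)).sum + s.count 1 = size Δ := by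
    rw [← hs]
    conv_rhs => rw [← hsplit]
    simp
  obtain ⟨g, hg⟩ := (Equiv.Perm.exists_with_cycleType_iff (α := E)
    (m := s.filter (2 ≤ ·))).2 ⟨by rw [Fintype.card_coe, hE]; omega, fun a ha =>
      (Multiset.mem_filter.1 ha).2⟩
  refine ⟨⟨E, Equiv.Perm.ofSubtype g, fun i hi => Equiv.Perm.ofSubtype_apply_of_not_mem g hi⟩,
    fun i hi => ?_, ?_⟩
  · obtain ⟨j, hj, rfl⟩ := Finset.mem_image.1 hi
    have := Finset.mem_range.1 hj
    simpa using this
  · have hr : (⟨E, Equiv.Perm.ofSubtype g, fun i hi =>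
        Equiv.Perm.ofSubtype_apply_of_not_mem g hi⟩ : PPerm).restrict = g := by
      ext i
      simp [PPerm.restrict]
    have hp : g.partition.parts = s := by
      rw [Equiv.Perm.parts_partition, ← Equiv.Perm.sum_cycleType, hg, Fintype.card_coe, hE,
        ← hsum, Nat.add_sub_cancel_left, hsplit]
    rw [PPerm.type, hr, cycType, hp, Multiset.map_map]
    have : (Finsupp.toMultiset Δ).map (Nat.toPNat' ∘ fun i : ℕ+ => (i : ℕ)) =
        Finsupp.toMultiset Δ := by
      conv_rhs => rw [← Multiset.map_id (Finsupp.toMultiset Δ)]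
      exact Multiset.map_congr rfl fun i _ => by simp
    rw [this, Finsupp.toMultiset_toFinsupp]

/-- `𝒫ₙ` is finite. -/
lemma finite_isIn (n : ℕ) : {x : PPerm | x.IsIn n}.Finite := by
  classical
  let I : Finset ℕ+ := (Finset.range n).image Nat.succPNat
  have hI : ∀ i : ℕ+, (i : ℕ) ≤ n → i ∈ I := by
    intro i hi
    refine Finset.mem_image.2 ⟨i.natPred, ?_, by simp⟩
    rw [Finset.mem_range]
    have := i.natPred_add_one
    omega
  let F : {x : PPerm | x.IsIn n} → Finset I × (I → I) := fun x =>
    (Finset.univ.filter fun i => i.1 ∈ x.1.supp, fun i => if h : i.1 ∈ x.1.supp then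
      ⟨x.1.perm i.1, hI _ (x.2 _ ((x.1.perm_mem_iff _).2 h))⟩ else i)
  refine Set.finite_coe_iff.1 (Finite.of_injective F ?_)
  rintro ⟨x, hx⟩ ⟨y, hy⟩ h
  have h1 := (Prod.ext_iff.1 h).1
  have h2 := (Prod.ext_iff.1 h).2
  have hs : ∀ i, i ∈ x.supp ↔ i ∈ y.supp := by
    intro i
    by_cases hi : i ∈ I
    · have := Finset.ext_iff.1 h1 ⟨i, hi⟩
      simpa [F] using this
    · exact ⟨fun h => absurd (hI i (hx i h)) hi, fun h => absurd (hI i (hy i h)) hi⟩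
  refine Subtype.ext (PPerm.ext (Finset.ext hs) (Equiv.ext fun i => ?_))
  by_cases hi : i ∈ x.supp
  · have h3 := congrFun h2 ⟨i, hI i (hx i hi)⟩
    simpa [F, hi, (hs i).1 hi] using h3
  · rw [x.fix i hi, y.fix i fun h => hi ((hs i).2 h)]

/-- The class sum `A_{Δ;n} = ∑ (E, f)`, over the `(E, f) ∈ 𝒫ₙ` of cycle type `Δ`. -/
def classSum (Δ : Part) (n : ℕ) : MonoidAlgebra ℂ PPerm :=
  ∑ x ∈ ((finite_isIn n).subset
    (fun _ h => h.1 : {x : PPerm | x.IsIn n ∧ x.type = Δ} ⊆ _)).toFinset,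
    MonoidAlgebra.of ℂ PPerm x

lemma coeff_classSum (Δ : Part) (n : ℕ) (x : PPerm) [Decidable (x.IsIn n ∧ x.type = Δ)] :
    (classSum Δ n).coeff x = if x.IsIn n ∧ x.type = Δ then 1 else 0 := by
  classical
  simp [classSum, MonoidAlgebra.coeff_sum, Finsupp.finsetSum_apply, Finsupp.single_apply]

lemma coeff_theta (m : ℕ) (b : MonoidAlgebra ℂ PPerm) (x : PPerm) [Decidable (x.IsIn m)] :
    (theta m b).coeff x = if x.IsIn m then b.coeff x else 0 := by
  classical
  induction b using MonoidAlgebra.induction_linear with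
  | zero => simp
  | add f g hf hg =>
    rw [map_add, MonoidAlgebra.coeff_add, Finsupp.add_apply, hf, hg, MonoidAlgebra.coeff_add,
      Finsupp.add_apply]
    split_ifs <;> simp
  | single y r =>
    rw [theta, MonoidAlgebra.lift_single]
    change (r • (if y.IsIn m then MonoidAlgebra.of ℂ PPerm y else 0 :
      MonoidAlgebra ℂ PPerm)).coeff x = _
    by_cases hxy : y = x
    · subst hxy
      split_ifs <;> simp
    · by_cases hy : y.IsIn m <;> simp [hy, hxy]

lemma conj_injective (v : Equiv.Perm ℕ+) : Function.Injective (PPerm.conj v) := by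
  intro x y h
  have h1 := (PPerm.ext_iff.1 h).1
  have h2 := (PPerm.ext_iff.1 h).2
  refine PPerm.ext (Finset.map_injective _ h1) ?_
  exact mul_left_cancel (mul_right_cancel h2)

lemma coeff_conj (v : Equiv.Perm ℕ+) (b : MonoidAlgebra ℂ PPerm) (x : PPerm) :
    (MonoidAlgebra.mapDomainAlgHom ℂ ℂ (PPerm.conj v) b).coeff (PPerm.conj v x) = b.coeff x := by
  exact Finsupp.mapDomain_apply (conj_injective v) b.coeff x

lemma conj_surjective (v : Equiv.Perm ℕ+) : Function.Surjective (PPerm.conj v) := by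
  classical
  intro y
  refine ⟨PPerm.conj v⁻¹ y, PPerm.ext ?_ ?_⟩
  · change (y.supp.map _).map _ = _
    rw [Finset.map_map]
    convert Finset.map_refl
    ext i
    simp
  · change v * (v⁻¹ * y.perm * v⁻¹⁻¹) * v⁻¹ = _
    group

/-- The element `A_Δ = (A_{Δ;n})ₙ` of `𝒜_∞`. -/
def A (Δ : Part) : AInfty := by
  classical
  refine ⟨classSum Δ, fun m n h => ?_, fun n v hv => ?_, size Δ, fun n x hx => ?_⟩
  · ext x
    rw [coeff_theta, coeff_classSum, coeff_classSum]
    have : x.IsIn m → x.IsIn n := fun hx i hi => (hx i hi).trans h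
    split_ifs <;> tauto
  · ext y
    obtain ⟨x, rfl⟩ := conj_surjective v y
    rw [coeff_conj, coeff_classSum, coeff_classSum, type_conj]
    have hle : ∀ i : ℕ+, ((v i : ℕ+) : ℕ) ≤ n ↔ (i : ℕ) ≤ n := by
      intro i
      constructor
      · intro h
        by_contra h'
        rw [hv i (not_le.1 h')] at h
        exact h' h
      · intro h
        by_contra h'
        have := v.injective (hv _ (not_le.1 h'))
        rw [this] at h'
        exact h' h
    have : (PPerm.conj v x).IsIn n ↔ x.IsIn n := by
      change (∀ i ∈ x.supp.map v.toEmbedding, _) ↔ _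
      simp only [Finset.mem_map, forall_exists_index, and_imp, forall_apply_eq_imp_iff₂,
        Equiv.coe_toEmbedding, hle]
      rfl
    rw [this]
  · rw [Finsupp.mem_support_iff, coeff_classSum] at hx
    rw [← size_type]
    split_ifs at hx with h
    · rw [h.2]
    · exact absurd rfl hx

/-- The coefficients of an element of `𝒜_∞` depend only on the cycle type. -/
lemma coeff_eq_of_type (a : AInfty) {m n : ℕ} {x y : PPerm} (hx : x.IsIn m) (hy : y.IsIn n)
    (h : x.type = y.type) : (a.1 m).coeff x = (a.1 n).coeff y := by
  classical
  have hx' : x.IsIn (max m n) := fun i hi => (hx i hi).trans (le_max_left _ _)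
  have hy' : y.IsIn (max m n) := fun i hi => (hy i hi).trans (le_max_right _ _)
  obtain ⟨v, hv, rfl⟩ := exists_conj hx' hy' h
  have h1 := a.2.1 m (max m n) (le_max_left _ _)
  have h2 := a.2.1 n (max m n) (le_max_right _ _)
  rw [← h1, ← h2, coeff_theta, coeff_theta, if_pos hx, if_pos hy]
  conv_rhs => rw [← a.2.2.1 _ v hv]
  rw [coeff_conj]

lemma sum_A_coe (s : Finset Part) (c : Part → ℂ) (n : ℕ) (x : PPerm) (hx : x.IsIn n) :
    (((∑ Δ ∈ s, c Δ • A Δ : AInfty) : ℕ → MonoidAlgebra ℂ PPerm) n).coeff x =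
      if x.type ∈ s then c x.type else 0 := by
  classical
  have h : ((∑ Δ ∈ s, c Δ • A Δ : AInfty) : ℕ → MonoidAlgebra ℂ PPerm) n =
      ∑ Δ ∈ s, c Δ • classSum Δ n := by
    rw [AddSubmonoidClass.coe_finsetSum, Finset.sum_apply]
    rfl
  rw [h, MonoidAlgebra.coeff_sum, Finsupp.finsetSum_apply]
  simp only [MonoidAlgebra.coeff_smul, Finsupp.smul_apply, coeff_classSum, hx, true_and]
  simp

/-- The elements `A_Δ` form a linear basis of `𝒜_∞`. -/
def basisA : Module.Basis Part ℂ AInfty := by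
  classical
  refine Module.Basis.mk (v := A) ?_ ?_
  · rw [linearIndependent_iff']
    intro s c hc Δ hΔ
    obtain ⟨x, hx, rfl⟩ := exists_type Δ
    have := sum_A_coe s c _ x hx
    rw [hc, if_pos hΔ] at this
    rw [← this]
    rfl
  · intro a _
    obtain ⟨d, hd⟩ := a.2.2.2
    choose std hstd using exists_type
    let s := (finite_size_le d).toFinset
    have : a = ∑ Δ ∈ s, (a.1 (size Δ)).coeff (std Δ) • A Δ := by
      apply Subtype.ext
      funext n
      ext x
      by_cases hx : x.IsIn n
      · rw [sum_A_coe s (fun Δ => (a.1 (size Δ)).coeff (std Δ)) n x hx]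
        split_ifs with h
        · exact coeff_eq_of_type a hx (hstd x.type).1 (hstd x.type).2.symm
        · by_contra h0
          apply h
          have := hd n x (Finsupp.mem_support_iff.2 h0)
          simpa [s, size_type] using this
      · have hz : ∀ b : AInfty, (b.1 n).coeff x = 0 := fun b => by
          rw [← b.2.1 n n le_rfl, coeff_theta, if_neg hx]
        exact (hz a).trans (hz _).symm
    rw [this]
    exact Submodule.sum_mem _ fun Δ _ => Submodule.smul_mem _ _ (Submodule.subset_span ⟨Δ, rfl⟩)

lemma basisA_apply (Δ : Part) : basisA Δ = A Δ := by
  simp [basisA]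

/-- The structure constants `Ĉ_{Δ₁Δ₂}^{Δ₃}` of `𝒜_∞` in the basis `A_Δ`:
`A_{Δ₁} A_{Δ₂} = ∑ Ĉ_{Δ₁Δ₂}^{Δ₃} A_{Δ₃}`, a finite sum. -/
def structConst (Δ₁ Δ₂ : Part) : Part →₀ ℂ := basisA.repr (A Δ₁ * A Δ₂)

/-! ### Irreducible characters of the symmetric groups and the functions `φ_λ` -/

/-- The Young symmetrizer `c_λ = (∑ p) (∑ sgn(q) q)`, where `p` runs over the permutations of the
cells of `λ` preserving every row and `q` over those preserving every column. -/
def youngSymmetrizer (lam : YoungDiagram) : MonoidAlgebra ℂ (Equiv.Perm lam.cells) :=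
  (∑ p : Equiv.Perm lam.cells with ∀ c, (p c).1.1 = c.1.1, MonoidAlgebra.of ℂ _ p) *
    ∑ q : Equiv.Perm lam.cells with ∀ c, (q c).1.2 = c.1.2,
      ((Equiv.Perm.sign q : ℤ) : ℂ) • MonoidAlgebra.of ℂ _ q

/-- The left ideal `ℂ[𝒮_{|λ|}] c_λ` of the group algebra; the symmetric group `𝒮_{|λ|}` is
realized as the group of permutations of the cells of `λ`. -/
def spechtModule (lam : YoungDiagram) : Ideal (MonoidAlgebra ℂ (Equiv.Perm lam.cells)) :=
  Ideal.span {youngSymmetrizer lam}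

/-- The irreducible representation of `𝒮_{|λ|}` corresponding to `λ`: left multiplication on
`ℂ[𝒮_{|λ|}] c_λ`. -/
def spechtRep (lam : YoungDiagram) :
    Representation ℂ (Equiv.Perm lam.cells) (spechtModule lam) :=
  Representation.ofModule' (spechtModule lam)

/-- `dim λ`. -/
def dimIrr (lam : YoungDiagram) : ℕ := Module.finrank ℂ (spechtModule lam)

open Classical in
/-- `χ_λ(Γ)` for a partition `Γ` of `|λ|`: the value of the irreducible character at a permutation
of cycle type `Γ` (characters are class functions, so that any choice gives the same value). -/
def chi (lam : YoungDiagram) (Γ : Part) : ℂ :=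
  if h : ∃ σ : Equiv.Perm lam.cells, cycType σ = Γ then (spechtRep lam).character h.choose else 0

/-- `|C_{Δ;n}|`, the number of permutations in `𝒮ₙ` of cycle type `[Δ, 1^{n-|Δ|}]`. -/
def classCard (Δ : Part) (n : ℕ) : ℕ :=
  Fintype.card {σ : Equiv.Perm (Fin n) // cycType σ = shift n Δ}

/-- The normalized shifted characters `φ_λ(Δ)`. -/
def phi (lam : YoungDiagram) (Δ : Part) : ℂ :=
  if size Δ ≤ lam.card then
    ((lam.card - size Δ + Δ 1).choose (Δ 1) : ℂ) * (1 / (dimIrr lam : ℂ)) *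
      (classCard Δ lam.card : ℂ) * chi lam (shift lam.card Δ)
  else 0

/-! ### Connected shifted Hurwitz numbers of the sphere with three branch points -/

/-- Monodromy data of the connected ramified coverings of degree `n` of the sphere with labelled
sheets and ramification types `[Δᵢ, 1^{n-|Δᵢ|}]` at three given points: permutations
`s₁ s₂ s₃ = 1` of the prescribed cycle types generating a transitive group.  There are none if
`n = 0` (a connected covering surface is non-empty) or if `|Δᵢ| > n` for some `i`. -/
def ConnCover (n : ℕ) (Δ₁ Δ₂ Δ₃ : Part) : Type :=
  {s : Equiv.Perm (Fin n) × Equiv.Perm (Fin n) × Equiv.Perm (Fin n) //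
    0 < n ∧ s.1 * s.2.1 * s.2.2 = 1 ∧
    cycType s.1 = shift n Δ₁ ∧ cycType s.2.1 = shift n Δ₂ ∧ cycType s.2.2 = shift n Δ₃ ∧
    MulAction.IsPretransitive (Subgroup.closure {s.1, s.2.1, s.2.2}) (Fin n)}

/-- The connected shifted Hurwitz number `CU_0^{h,n}(Δ₁, Δ₂, Δ₃)`: the number of connected
coverings, each counted with the inverse of the order of its automorphism group (equivalently,
labelled coverings divided by `n!`), times the binomial factors of the shifting.  The genus
`h ≥ 0` of a connected covering surface is determined by the remaining data through the
Riemann–Hurwitz formula `2n - (2 - 2h) = ∑ (|Δᵢ| - l(Δᵢ))`, so it is not an argument. -/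
def connHurwitz (n : ℕ) (Δ₁ Δ₂ Δ₃ : Part) : ℂ :=
  ((n - size Δ₁ + Δ₁ 1).choose (Δ₁ 1) : ℂ) * ((n - size Δ₂ + Δ₂ 1).choose (Δ₂ 1) : ℂ) *
    ((n - size Δ₃ + Δ₃ 1).choose (Δ₃ 1) : ℂ) *
    ((Nat.card (ConnCover n Δ₁ Δ₂ Δ₃) : ℂ) / (n ! : ℂ))

/-! ### The operators

The coefficients lie in a commutative `ℂ`-algebra `R` with an invertible element `z`: for instance
`R = ℂ` and `z ≠ 0`, or `R = ℂ[z, z⁻¹]`.  The operators act on formal power series in the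
time-variables `p₁, p₂, p₃, …`; the monomial `p_Γ` is `MvPowerSeries.monomial Γ 1`. -/

section Operators

variable {R : Type*} [CommRing R]

lemma pderiv_commute (i j : ℕ+) :
    Commute ((MvPowerSeries.pderiv R i : Derivation R _ _) : Module.End R (MvPowerSeries ℕ+ R))
      ((MvPowerSeries.pderiv R j : Derivation R _ _) : Module.End R (MvPowerSeries ℕ+ R)) := by
  classical
  refine LinearMap.ext fun f => MvPowerSeries.ext fun n => ?_
  change MvPowerSeries.coeff n (MvPowerSeries.pderiv R i (MvPowerSeries.pderiv R j f)) =
    MvPowerSeries.coeff n (MvPowerSeries.pderiv R j (MvPowerSeries.pderiv R i f))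
  simp only [MvPowerSeries.coeff_pderiv]
  by_cases h : i = j
  · rw [h]
  · rw [add_right_comm]
    simp [h, Ne.symm h]
    ring

/-- `∂/∂p_Γ = ∏ᵢ (∂/∂pᵢ)^{mᵢ(Γ)}`. -/
def partialP (Γ : Part) : Module.End R (MvPowerSeries ℕ+ R) :=
  Γ.support.noncommProd
    (fun i => ((MvPowerSeries.pderiv R i : Derivation R _ _) :
      Module.End R (MvPowerSeries ℕ+ R)) ^ Γ i)
    fun i _ j _ _ => (pderiv_commute i j).pow_pow _ _

/-- The normally ordered operator `p_Γ ∂/∂p_{Γ'}`. -/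
def normalOp (Γ' Γ : Part) : Module.End R (MvPowerSeries ℕ+ R) :=
  LinearMap.mulLeft R (MvPowerSeries.monomial Γ 1) * partialP Γ'

variable [Algebra ℂ R]

/-- Index set of the sum defining `W(Δ, z)`: finite families, up to reordering, of triples
`(Γ'ᵢ, Δⁱ, Γᵢ)` such that `Δ = ∑ Δⁱ` and `|Δⁱ| ≥ 1`, that is, a proper re-partition of `Δ`
together with series of partitions `(Γ'ᵢ)` and `(Γᵢ)`. -/
def Family (Δ : Part) : Type :=
  {M : Multiset (Part × Part × Part) // (M.map fun t => t.2.1).sum = Δ ∧ ∀ t ∈ M, 1 ≤ size t.2.1}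

namespace Family

variable {Δ : Part}

/-- `Γ' = ∑ Γ'ᵢ`. -/
def src (M : Family Δ) : Part := (M.1.map fun t => t.1).sum

/-- `Γ = ∑ Γᵢ`. -/
def tgt (M : Family Δ) : Part := (M.1.map fun t => t.2.2).sum

open Classical in
/-- `|Aut(Γ', Δ̃, Γ)|`, the number of permutations of the indices preserving all the triples. -/
def autCard (M : Family Δ) : ℕ := ∏ t ∈ M.1.toFinset, (M.1.count t)!

/-- `(1 / |Aut|) ∏ᵢ ‖Γ'ᵢ‖ δ_{|Γᵢ|,|Γ'ᵢ|} CU_0^{hᵢ,|Γ'ᵢ|}(Γ'ᵢ, Δⁱ, Γᵢ)`. -/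
def coef (M : Family Δ) : ℂ :=
  1 / (M.autCard : ℂ) *
    (M.1.map fun t => (rowProd t.1 : ℂ) * (if size t.2.2 = size t.1 then 1 else 0) *
      connHurwitz (size t.1) t.1 t.2.1 t.2.2).prod

/-- The summand of `W(Δ, z)`, with the power `z^{|Δ| - l(Δ) + l(Γ') - l(Γ)}`. -/
def op (z : Rˣ) (M : Family Δ) : Module.End R (MvPowerSeries ℕ+ R) :=
  (((z ^ ((size Δ : ℤ) - len Δ + len M.src - len M.tgt) : Rˣ) : R) * algebraMap ℂ R M.coef) •
    normalOp M.src M.tgt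

lemma size_le_of_mem {s : Multiset (Part × Part × Part)} (g : Part × Part × Part → Part)
    {t : Part × Part × Part} (ht : t ∈ s) : size (g t) ≤ size (s.map g).sum := by
  obtain ⟨s', rfl⟩ := Multiset.exists_cons_of_mem ht
  rw [Multiset.map_cons, Multiset.sum_cons, size_add]
  exact Nat.le_add_right _ _

lemma card_le (s : Multiset (Part × Part × Part)) (hs : ∀ t ∈ s, 1 ≤ size t.2.1) :
    s.card ≤ size (s.map fun t => t.2.1).sum := by
  induction s using Multiset.induction_on with
  | empty => simp
  | cons t s ih =>
    rw [Multiset.card_cons, Multiset.map_cons, Multiset.sum_cons, size_add]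
    have h1 := hs t (Multiset.mem_cons_self _ _)
    have h2 := ih fun u hu => hs u (Multiset.mem_cons_of_mem hu)
    omega

/-- Only finitely many summands contribute to a given coefficient. -/
lemma finite_contrib (z : Rˣ) (n : Part) :
    {M : Family Δ | ∃ f, MvPowerSeries.coeff n (M.op z f) ≠ 0}.Finite := by
  classical
  let S : Finset (Part × Part × Part) := (finite_size_le (size n)).toFinset ×ˢ
    (finite_size_le (size Δ)).toFinset ×ˢ (finite_size_le (size n)).toFinset
  refine Set.Finite.of_finite_image (f := Subtype.val)
    ((((size Δ) • S.val).powerset.toFinset.finite_toSet).subset ?_) Subtype.val_injective.injOn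
  rintro _ ⟨M, ⟨f, hf⟩, rfl⟩
  have hcoef : M.coef ≠ 0 := by
    intro h
    apply hf
    simp [op, h]
  have htgt : M.tgt ≤ n := by
    by_contra h
    apply hf
    rw [op, LinearMap.smul_apply, map_smul, normalOp, Module.End.mul_apply, LinearMap.mulLeft_apply,
      MvPowerSeries.coeff_monomial_mul, if_neg h, smul_zero]
  have hsize : size M.tgt ≤ size n := by
    rw [← tsub_add_cancel_of_le htgt, size_add]
    exact Nat.le_add_left _ _
  have heq : ∀ t ∈ M.1, size t.2.2 = size t.1 := by
    intro t ht
    by_contra h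
    apply hcoef
    rw [coef, Multiset.prod_eq_zero, mul_zero]
    exact Multiset.mem_map.2 ⟨t, ht, by simp [h]⟩
  have hS : ∀ t ∈ M.1, t ∈ S := by
    intro t ht
    have h1 : size t.2.2 ≤ size M.tgt := size_le_of_mem (fun t => t.2.2) ht
    have h2 : size t.2.1 ≤ size Δ := by
      have := size_le_of_mem (fun t => t.2.1) ht
      rwa [M.2.1] at this
    have h3 := heq t ht
    simp only [S, Finset.mem_product, Set.Finite.mem_toFinset, Set.mem_ofPred_eq]
    omega
  have hcard : M.1.card ≤ size Δ := by
    have := card_le M.1 M.2.2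
    rwa [M.2.1] at this
  simp only [Finset.mem_coe, Multiset.mem_toFinset, Multiset.mem_powerset]
  refine Multiset.le_iff_count.2 fun t => ?_
  by_cases ht : t ∈ M.1
  · rw [Multiset.count_nsmul, Multiset.count_eq_one_of_mem S.nodup (hS t ht), mul_one]
    exact (Multiset.count_le_card _ _).trans hcard
  · rw [Multiset.count_eq_zero_of_notMem ht]
    exact Nat.zero_le _

end Family

/-- The shifted genus expanded cut-and-join operator `W(Δ, z)`, the sum of the operators
`Family.op`.  The sum is infinite, but only finitely many summands contribute to a given
coefficient of the result (`Family.finite_contrib`). -/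
def W (Δ : Part) (z : Rˣ) : Module.End R (MvPowerSeries ℕ+ R) where
  toFun f := fun n => ∑ᶠ M : Family Δ, MvPowerSeries.coeff n (M.op z f)
  map_add' f g := by
    refine MvPowerSeries.ext fun n => ?_
    change ∑ᶠ M : Family Δ, MvPowerSeries.coeff n (M.op z (f + g)) =
      (∑ᶠ M : Family Δ, MvPowerSeries.coeff n (M.op z f)) +
        ∑ᶠ M : Family Δ, MvPowerSeries.coeff n (M.op z g)
    rw [← finsum_add_distrib
      ((Family.finite_contrib z n).subset fun M h => ⟨f, h⟩)
      ((Family.finite_contrib z n).subset fun M h => ⟨g, h⟩)]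
    simp only [map_add]
  map_smul' r f := by
    refine MvPowerSeries.ext fun n => ?_
    change ∑ᶠ M : Family Δ, MvPowerSeries.coeff n (M.op z (r • f)) =
      r * ∑ᶠ M : Family Δ, MvPowerSeries.coeff n (M.op z f)
    rw [mul_finsum' _ _ ((Family.finite_contrib z n).subset fun M h => ⟨f, h⟩)]
    simp only [map_smul, smul_eq_mul]

/-- The genus expanded Schur function
`S_λ{p, z} = ∑ z^{-|Γ|-l(Γ)} (dim λ / |λ|!) φ_λ(Γ) p_Γ`, the sum running over the partitions `Γ`
of `|λ|`; it is given by its coefficients. -/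
def schurZ (lam : YoungDiagram) (z : Rˣ) : MvPowerSeries ℕ+ R := fun Γ =>
  if size Γ = lam.card then
    ((z ^ (-(size Γ : ℤ) - len Γ) : Rˣ) : R) *
      algebraMap ℂ R ((dimIrr lam : ℂ) / (lam.card ! : ℂ) * phi lam Γ)
  else 0

end Operators

end CutJoin

end

/-!
The operator `W(Δ, z)` is, up to powers of `z`, the multiplication by a central element of the
group algebras of the symmetric groups.  Identify the monomial `p_Γ`, `|Γ| = n`, with the cycle
type of permutations of `{1, …, n}`.  Then `W(Δ, z)` sends the monomial of the cycle type of `σ`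
to the sum, over the partial permutations `x` of `{1, …, n}` of cycle type `Δ`, of the monomials
of the cycle types of `x σ`, with the power `z^{|Δ| - l(Δ) + l(Γ') - l(Γ)}`, where `Γ'` and `Γ` are
the cycle types of `σ` and `x σ` (`coeff_W`).

This is an exponential formula.  The defining sum of `W(Δ, z)` describes how a pair `(σ, x)`
decomposes into the orbits that meet the support of `x`, each contributing a connected Hurwitz
number (`connWeight_eq`), and the remaining orbits, which are cycles of `σ`.  Both the normalized
number of pairs of given cycle types (`size_mul_pairWeight`) and the weighted number of families
(`size_mul_expWeight`) satisfy the recursion in `|Δ|` obtained by marking a point of the support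
of `x` and splitting off its orbit, respectively by marking a member of the family; for `|Δ| = 0`
both are `δ_{Γ'Γ} / z_Γ`.

Given `coeff_W`, the product formula is the multiplication rule of the class sums `A_Δ`, since the
compositions of the operators correspond to the products `x y σ` (`W_mul_W`).

For the Schur functions, forgetting the supports turns the sum of all `x` into a multiple of a
class sum of the symmetric group (`sum_within_type`).  It acts on `ℂ[𝒮_{|λ|}] c_λ` by a scalar:
its product with the Young symmetrizer `c_λ` is again invariant under the row group and
anti-invariant under the column group, hence a multiple of `c_λ` (`IsYoung.eq_smul`).  Taking
traces identifies the scalar with `φ_λ(Δ)`, and for `z = 1` the function `S_λ` is the sum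
of `χ_λ(σ) p_σ / |λ|!` over all permutations `σ`, where `p_σ` is the monomial of its cycle type
(`W_schurZ`).
-/

noncomputable section

namespace CutJoin

open scoped Classical

/-! ### Cycle types -/

lemma cycleType_sumCongr {α β : Type*} [Fintype α] [DecidableEq α] [Fintype β] [DecidableEq β]
    (a : Equiv.Perm α) (b : Equiv.Perm β) :
    Equiv.Perm.cycleType (Equiv.sumCongr a b : Equiv.Perm (α ⊕ β)) = a.cycleType + b.cycleType := by
  have h1 : (Equiv.sumCongr a b : Equiv.Perm (α ⊕ β)) =
      a.extendDomain (Equiv.ofInjective _ (Sum.inl_injective (α := α) (β := β))) *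
        b.extendDomain (Equiv.ofInjective _ (Sum.inr_injective (α := α) (β := β))) := by
    ext x
    rcases x with x | x
    · rw [Equiv.Perm.mul_apply, Equiv.Perm.extendDomain_apply_not_subtype _ _ (b := Sum.inl x)
        (by simp)]
      exact (a.extendDomain_apply_image (Equiv.ofInjective _ Sum.inl_injective) x).symm
    · rw [Equiv.Perm.mul_apply]
      have h2 := b.extendDomain_apply_image
        (Equiv.ofInjective _ (Sum.inr_injective (α := α) (β := β))) x
      simp only [Equiv.ofInjective_apply] at h2
      rw [h2, Equiv.Perm.extendDomain_apply_not_subtype _ _ (by simp)]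
      rfl
  rw [h1, Equiv.Perm.Disjoint.cycleType_mul, Equiv.Perm.cycleType_extendDomain,
    Equiv.Perm.cycleType_extendDomain]
  intro x
  rcases x with x | x
  · exact Or.inr (Equiv.Perm.extendDomain_apply_not_subtype _ _ (by simp))
  · exact Or.inl (Equiv.Perm.extendDomain_apply_not_subtype _ _ (by simp))

lemma cycType_sumCongr {α β : Type*} [Fintype α] [DecidableEq α] [Fintype β] [DecidableEq β]
    (a : Equiv.Perm α) (b : Equiv.Perm β) :
    cycType (Equiv.sumCongr a b : Equiv.Perm (α ⊕ β)) = cycType a + cycType b := by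
  have ha := a.sum_cycleType_le
  have hb := b.sum_cycleType_le
  rw [Equiv.Perm.sum_cycleType] at ha hb
  rw [cycType, cycType, cycType, ← map_add, ← Multiset.map_add, Equiv.Perm.parts_partition,
    Equiv.Perm.parts_partition, Equiv.Perm.parts_partition, ← Equiv.Perm.sum_cycleType,
    cycleType_sumCongr, Multiset.sum_add, Equiv.Perm.sum_cycleType, Equiv.Perm.sum_cycleType,
    Fintype.card_sum, show Fintype.card α + Fintype.card β - (a.support.card + b.support.card) =
      (Fintype.card α - a.support.card) + (Fintype.card β - b.support.card) by omega,
    Multiset.replicate_add]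
  congr 2
  abel

lemma cycType_one (α : Type*) [Fintype α] [DecidableEq α] :
    cycType (1 : Equiv.Perm α) = Finsupp.single 1 (Fintype.card α) := by
  rw [cycType, Equiv.Perm.parts_partition]
  simp only [Equiv.Perm.cycleType_one, Equiv.Perm.support_one, Finset.card_empty, tsub_zero,
    zero_add, Multiset.map_replicate]
  ext i
  rw [Multiset.toFinsupp_apply, Multiset.count_replicate, Finsupp.single_apply]
  rfl

lemma cycType_inv {α : Type*} [Fintype α] [DecidableEq α] (s : Equiv.Perm α) :
    cycType s⁻¹ = cycType s := by
  rw [cycType, cycType, Equiv.Perm.parts_partition, Equiv.Perm.parts_partition,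
    Equiv.Perm.cycleType_inv, Equiv.Perm.support_inv]

lemma cycType_conj {α : Type*} [Fintype α] [DecidableEq α] (s t : Equiv.Perm α) :
    cycType (t * s * t⁻¹) = cycType s :=
  ((cycType_eq_iff s (t * s * t⁻¹)).2 ⟨t, fun a => by simp⟩).symm

lemma cycType_mul_comm {α : Type*} [Fintype α] [DecidableEq α] (s t : Equiv.Perm α) :
    cycType (s * t) = cycType (t * s) := by
  rw [← cycType_conj (s * t) t]
  congr 1
  group

/-! ### Partial permutations with prescribed supports -/

namespace PPerm

lemma card_supp (x : PPerm) : x.supp.card = size x.type := (size_type x).symm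

/-- The identity permutation of the finite set `V`. -/
def idOn (V : Finset ℕ+) : PPerm := ⟨V, 1, fun _ _ => rfl⟩

lemma type_idOn (V : Finset ℕ+) : (idOn V).type = Finsupp.single 1 V.card := by
  have : (idOn V).restrict = 1 := by
    ext i
    rfl
  rw [type, this, cycType_one]
  exact congrArg _ (Fintype.card_coe V)

lemma perm_mem (x : PPerm) {i : ℕ+} (h : i ∈ x.supp) : x.perm i ∈ x.supp := by
  rwa [x.perm_mem_iff]

lemma type_mul_of_disjoint (x y : PPerm) (h : Disjoint x.supp y.supp) :
    (x * y).type = x.type + y.type := by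
  rw [type, type, type, ← cycType_sumCongr]
  symm
  refine (cycType_eq_iff _ _).2 ⟨Equiv.Finset.union x.supp y.supp h, fun a => ?_⟩
  rcases a with i | i
  · apply Subtype.ext
    change x.perm i.1 = x.perm (y.perm i.1)
    rw [y.fix i.1 (Finset.disjoint_left.1 h i.2)]
  · apply Subtype.ext
    change y.perm i.1 = x.perm (y.perm i.1)
    rw [x.fix _ (Finset.disjoint_right.1 h (y.perm_mem i.2))]

/-- The restriction of a partial permutation to an invariant set `B`. -/
def restr (x : PPerm) (B : Finset ℕ+) (h : ∀ i, x.perm i ∈ B ↔ i ∈ B) : PPerm where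
  supp := x.supp ∩ B
  perm := Equiv.Perm.ofSubtype (x.perm.subtypePerm (p := (· ∈ B)) h)
  fix i hi := by
    by_cases hB : i ∈ B
    · rw [Equiv.Perm.ofSubtype_apply_of_mem _ hB]
      have : i ∉ x.supp := fun h => hi (Finset.mem_inter.2 ⟨h, hB⟩)
      exact x.fix i this
    · exact Equiv.Perm.ofSubtype_apply_of_not_mem _ hB

lemma restr_perm_of_mem (x : PPerm) {B : Finset ℕ+} (h : ∀ i, x.perm i ∈ B ↔ i ∈ B) {i : ℕ+}
    (hi : i ∈ B) : (x.restr B h).perm i = x.perm i :=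
  Equiv.Perm.ofSubtype_apply_of_mem _ hi

lemma restr_perm_of_notMem (x : PPerm) {B : Finset ℕ+} (h : ∀ i, x.perm i ∈ B ↔ i ∈ B) {i : ℕ+}
    (hi : i ∉ B) : (x.restr B h).perm i = i :=
  Equiv.Perm.ofSubtype_apply_of_not_mem _ hi

/-- The finite set of the partial permutations with support contained in `V`. -/
def within (V : Finset ℕ+) : Finset PPerm :=
  ((finite_isIn (V.sup fun i => (i : ℕ))).subset
    fun x (hx : x.supp ⊆ V) _ hi => Finset.le_sup (f := fun i : ℕ+ => (i : ℕ)) (hx hi) :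
      {x : PPerm | x.supp ⊆ V}.Finite).toFinset

@[simp] lemma mem_within {V : Finset ℕ+} {x : PPerm} : x ∈ within V ↔ x.supp ⊆ V := by
  simp [within]

lemma mul_perm_eq (x y : PPerm) (i : ℕ+) : (x * y).perm i = x.perm (y.perm i) := rfl

lemma supp_conj (v : Equiv.Perm ℕ+) (x : PPerm) :
    (conj v x).supp = x.supp.map v.toEmbedding := rfl

lemma conj_perm_apply (v : Equiv.Perm ℕ+) (x : PPerm) (i : ℕ+) :
    (conj v x).perm (v i) = v (x.perm i) := by
  change v (x.perm (v⁻¹ (v i))) = _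
  simp

end PPerm

/-- The set `{1, …, n}`. -/
def full (n : ℕ) : Finset ℕ+ := (Finset.range n).image Nat.succPNat

@[simp] lemma mem_full {n : ℕ} {i : ℕ+} : i ∈ full n ↔ (i : ℕ) ≤ n := by
  constructor
  · intro h
    obtain ⟨j, hj, rfl⟩ := Finset.mem_image.1 h
    have := Finset.mem_range.1 hj
    simpa using this
  · intro h
    refine Finset.mem_image.2 ⟨i.natPred, ?_, by simp⟩
    have := i.natPred_add_one
    rw [Finset.mem_range]
    omega

@[simp] lemma card_full (n : ℕ) : (full n).card = n := by
  rw [full, Finset.card_image_of_injective _ Nat.succPNat_injective, Finset.card_range]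

lemma isIn_iff {n : ℕ} {x : PPerm} : x.IsIn n ↔ x.supp ⊆ full n := by
  simp [PPerm.IsIn, Finset.subset_iff]

lemma exists_isIn (x : PPerm) : ∃ n, x.IsIn n :=
  ⟨x.supp.sup fun i => (i : ℕ), fun _ hi => Finset.le_sup (f := fun i : ℕ+ => (i : ℕ)) hi⟩

lemma PPerm.IsIn.mono {x : PPerm} {m n : ℕ} (h : x.IsIn m) (hmn : m ≤ n) : x.IsIn n :=
  fun i hi => (h i hi).trans hmn

lemma exists_conj_of_type_eq {x y : PPerm} (h : x.type = y.type) :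
    ∃ v : Equiv.Perm ℕ+, PPerm.conj v x = y := by
  obtain ⟨m, hm⟩ := exists_isIn x
  obtain ⟨n, hn⟩ := exists_isIn y
  obtain ⟨v, -, hv⟩ := exists_conj (hm.mono (le_max_left m n)) (hn.mono (le_max_right m n)) h
  exact ⟨v, hv⟩

lemma exists_perm_map_eq {V V' : Finset ℕ+} (h : V.card = V'.card) :
    ∃ v : Equiv.Perm ℕ+, V.map v.toEmbedding = V' := by
  obtain ⟨v, hv⟩ := exists_conj_of_type_eq (x := PPerm.idOn V) (y := PPerm.idOn V')
    (by rw [PPerm.type_idOn, PPerm.type_idOn, h])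
  exact ⟨v, congrArg PPerm.supp hv⟩

/-- A permutation of `{1, …, |Γ|}` of cycle type `Γ`. -/
lemma exists_type_full (Γ : Part) : ∃ σ : PPerm, σ.supp = full (size Γ) ∧ σ.type = Γ := by
  obtain ⟨x, hx, h⟩ := exists_type Γ
  refine ⟨x, Finset.eq_of_subset_of_card_le (isIn_iff.1 hx) ?_, h⟩
  rw [card_full, ← h, size_type]

/-! ### Decomposition into connected components -/

lemma mapsTo_iff {f : Equiv.Perm ℕ+} {B : Finset ℕ+} (h : ∀ i ∈ B, f i ∈ B) (i : ℕ+) :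
    f i ∈ B ↔ i ∈ B := by
  refine ⟨fun hi => ?_, h i⟩
  have h1 : B.map f.toEmbedding = B := by
    refine Finset.eq_of_subset_of_card_le (fun j hj => ?_) (by simp)
    obtain ⟨k, hk, rfl⟩ := Finset.mem_map.1 hj
    exact h k hk
  rw [← h1] at hi
  simpa using hi

/-- Triples of partitions; the cycle types of `(σ, x, x σ)` for a permutation `σ` and a partial
permutation `x` of the same finite set form such a triple. -/
abbrev Triple : Type := Part × Part × Part

/-- The pairs of a permutation `σ` of `V` and a partial permutation `x` supported in `V`. -/
def pairs (V : Finset ℕ+) : Finset (PPerm × PPerm) :=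
  (PPerm.within V ×ˢ PPerm.within V).filter fun p => p.1.supp = V

lemma mem_pairs {V : Finset ℕ+} {p : PPerm × PPerm} :
    p ∈ pairs V ↔ p.1.supp = V ∧ p.2.supp ⊆ V := by
  simp only [pairs, Finset.mem_filter, Finset.mem_product, PPerm.mem_within]
  constructor
  · rintro ⟨⟨h1, h2⟩, h3⟩
    exact ⟨h3, h2⟩
  · rintro ⟨h3, h2⟩
    exact ⟨⟨h3.le, h2⟩, h3⟩

/-- The cycle types of `σ`, `x` and `x σ`. -/
def pairType (p : PPerm × PPerm) : Triple := (p.1.type, p.2.type, (p.2 * p.1).type)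

/-- `σ` and `x` act transitively on the non-empty set `B`: it has no proper non-empty invariant
subset. -/
def IsConn (B : Finset ℕ+) (p : PPerm × PPerm) : Prop :=
  B.Nonempty ∧ ∀ C ⊆ B, C.Nonempty → (∀ i ∈ C, p.1.perm i ∈ C) → (∀ i ∈ C, p.2.perm i ∈ C) → C = B

/-- `B` is an orbit of the group generated by `σ` and `x`. -/
def IsComp (B : Finset ℕ+) (p : PPerm × PPerm) : Prop :=
  (∀ i ∈ B, p.1.perm i ∈ B) ∧ (∀ i ∈ B, p.2.perm i ∈ B) ∧ IsConn B p

/-- The pairs acting transitively on `B`. -/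
def connPairs (B : Finset ℕ+) : Finset (PPerm × PPerm) := (pairs B).filter (IsConn B)

lemma isComp_unique {B B' : Finset ℕ+} {p : PPerm × PPerm} {r : ℕ+} (h : IsComp B p)
    (h' : IsComp B' p) (hr : r ∈ B) (hr' : r ∈ B') : B = B' := by
  have hne : (B ∩ B').Nonempty := ⟨r, Finset.mem_inter.2 ⟨hr, hr'⟩⟩
  have h1 : ∀ i ∈ B ∩ B', p.1.perm i ∈ B ∩ B' := fun i hi => by
    rw [Finset.mem_inter] at hi ⊢
    exact ⟨h.1 i hi.1, h'.1 i hi.2⟩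
  have h2 : ∀ i ∈ B ∩ B', p.2.perm i ∈ B ∩ B' := fun i hi => by
    rw [Finset.mem_inter] at hi ⊢
    exact ⟨h.2.1 i hi.1, h'.2.1 i hi.2⟩
  rw [← h.2.2.2 _ Finset.inter_subset_left hne h1 h2,
    h'.2.2.2 _ Finset.inter_subset_right hne h1 h2]

/-- Every point lies in an orbit, namely the smallest invariant set containing it. -/
lemma exists_isComp {V : Finset ℕ+} {p : PPerm × PPerm} (hp : p ∈ pairs V) {r : ℕ+} (hr : r ∈ V) :
    ∃ B ⊆ V, r ∈ B ∧ IsComp B p := by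
  rw [mem_pairs] at hp
  let I : Finset (Finset ℕ+) := V.powerset.filter fun B =>
    r ∈ B ∧ (∀ i ∈ B, p.1.perm i ∈ B) ∧ ∀ i ∈ B, p.2.perm i ∈ B
  have hV : V ∈ I := by
    refine Finset.mem_filter.2 ⟨Finset.mem_powerset_self V, hr, fun i hi => ?_, fun i hi => ?_⟩
    · rw [← hp.1] at hi ⊢
      exact p.1.perm_mem hi
    · by_cases h : i ∈ p.2.supp
      · exact hp.2 (p.2.perm_mem h)
      · rwa [p.2.fix i h]
  obtain ⟨B, hB, hmin⟩ := Finset.exists_min_image I Finset.card ⟨V, hV⟩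
  obtain ⟨hBV, hrB, h1, h2⟩ := Finset.mem_filter.1 hB
  rw [Finset.mem_powerset] at hBV
  have key : ∀ C ⊆ B, r ∈ C → (∀ i ∈ C, p.1.perm i ∈ C) → (∀ i ∈ C, p.2.perm i ∈ C) → C = B :=
    fun C hC hrC h3 h4 => Finset.eq_of_subset_of_card_le hC (hmin C (Finset.mem_filter.2
      ⟨Finset.mem_powerset.2 (hC.trans hBV), hrC, h3, h4⟩))
  refine ⟨B, hBV, hrB, h1, h2, ⟨r, hrB⟩, fun C hC hne h3 h4 => ?_⟩
  by_cases hrC : r ∈ C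
  · exact key C hC hrC h3 h4
  -- otherwise the complement of `C` in `B` is an invariant set containing `r`
  have h5 : B \ C = B := by
    refine key _ Finset.sdiff_subset (Finset.mem_sdiff.2 ⟨hrB, hrC⟩) (fun i hi => ?_)
      fun i hi => ?_
    · rw [Finset.mem_sdiff] at hi ⊢
      exact ⟨h1 i hi.1, fun h => hi.2 ((mapsTo_iff h3 i).1 h)⟩
    · rw [Finset.mem_sdiff] at hi ⊢
      exact ⟨h2 i hi.1, fun h => hi.2 ((mapsTo_iff h4 i).1 h)⟩
  obtain ⟨c, hc⟩ := hne
  have := hC hc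
  rw [← h5, Finset.mem_sdiff] at this
  exact absurd hc this.2

lemma pairType_add {B : Finset ℕ+} {p q : PPerm × PPerm} {C : Finset ℕ+} (hp : p ∈ pairs B)
    (hq : q ∈ pairs C) (h : Disjoint B C) : pairType (p * q) = pairType p + pairType q := by
  rw [mem_pairs] at hp hq
  have h1 : p.2 * q.2 * (p.1 * q.1) = (p.2 * p.1) * (q.2 * q.1) := by
    have h2 : q.2 * p.1 = p.1 * q.2 := by
      refine PPerm.ext (Finset.union_comm _ _) (Equiv.ext fun i => ?_)
      simp only [PPerm.perm_mul, Equiv.Perm.mul_apply]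
      by_cases hi : i ∈ B
      · have h3 : i ∉ q.2.supp := fun h3 => Finset.disjoint_left.1 h hi (hq.2 h3)
        have h4 : p.1.perm i ∉ q.2.supp := fun h4 =>
          Finset.disjoint_left.1 h (hp.1 ▸ p.1.perm_mem (hp.1 ▸ hi)) (hq.2 h4)
        rw [q.2.fix _ h3, q.2.fix _ h4]
      · have h3 : q.2.perm i ∉ B := fun h3 => by
          by_cases h4 : i ∈ q.2.supp
          · exact Finset.disjoint_left.1 h h3 (hq.2 (q.2.perm_mem h4))
          · rw [q.2.fix _ h4] at h3
            exact hi h3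
        rw [p.1.fix i (by rwa [hp.1]), p.1.fix (q.2.perm i) (by rwa [hp.1])]
    rw [mul_assoc, ← mul_assoc q.2, h2, mul_assoc, mul_assoc]
  have hu : p.2.supp ∪ p.1.supp = B := by rw [hp.1]; exact Finset.union_eq_right.2 hp.2
  have hu' : q.2.supp ∪ q.1.supp = C := by rw [hq.1]; exact Finset.union_eq_right.2 hq.2
  refine Prod.ext ?_ (Prod.ext ?_ ?_)
  · exact PPerm.type_mul_of_disjoint _ _ (by rwa [hp.1, hq.1])
  · exact PPerm.type_mul_of_disjoint _ _ (h.mono hp.2 hq.2)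
  · change (p.2 * q.2 * (p.1 * q.1)).type = _
    rw [h1]
    exact PPerm.type_mul_of_disjoint _ _ (by rwa [PPerm.supp_mul, PPerm.supp_mul, hu, hu'])

lemma supp_inter {B : Finset ℕ+} {p q : PPerm} {C : Finset ℕ+} (hp : p.supp ⊆ B)
    (hq : q.supp ⊆ C) (h : Disjoint B C) : (p * q).supp ∩ B = p.supp := by
  rw [PPerm.supp_mul, Finset.union_inter_distrib_right, Finset.inter_eq_left.2 hp,
    Finset.disjoint_iff_inter_eq_empty.1 (h.symm.mono_left hq), Finset.union_empty]

lemma mul_perm_left {B : Finset ℕ+} (p : PPerm) {q : PPerm} {C : Finset ℕ+}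
    (hq : q.supp ⊆ C) (h : Disjoint B C) {i : ℕ+} (hi : i ∈ B) : (p * q).perm i = p.perm i := by
  rw [PPerm.mul_perm_eq, q.fix i fun h' => Finset.disjoint_left.1 h hi (hq h')]

lemma mul_perm_right {B : Finset ℕ+} {p q : PPerm} {C : Finset ℕ+} (hp : p.supp ⊆ B)
    (hq : q.supp ⊆ C) (h : Disjoint B C) {i : ℕ+} (hi : i ∈ C) : (p * q).perm i = q.perm i := by
  rw [PPerm.mul_perm_eq, p.fix]
  intro h'
  by_cases h2 : i ∈ q.supp
  · exact Finset.disjoint_left.1 h (hp h') (hq (q.perm_mem h2))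
  · rw [q.fix i h2] at h'
    exact Finset.disjoint_left.1 h (hp h') hi

/-- A product of partial permutations with supports in disjoint sets determines the factors. -/
lemma mul_left_inj_of_disjoint {B C : Finset ℕ+} {p q p' q' : PPerm} (hp : p.supp ⊆ B)
    (hq : q.supp ⊆ C) (hp' : p'.supp ⊆ B) (hq' : q'.supp ⊆ C) (h : Disjoint B C)
    (he : p * q = p' * q') : p = p' := by
  refine PPerm.ext ?_ (Equiv.ext fun i => ?_)
  · rw [← supp_inter hp hq h, he, supp_inter hp' hq' h]
  · by_cases hi : i ∈ B
    · rw [← mul_perm_left p hq h hi, he, mul_perm_left p' hq' h hi]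
    · rw [p.fix i fun h => hi (hp h), p'.fix i fun h => hi (hp' h)]

lemma mul_right_inj_of_disjoint {B C : Finset ℕ+} {p q p' q' : PPerm} (hp : p.supp ⊆ B)
    (hq : q.supp ⊆ C) (hp' : p'.supp ⊆ B) (hq' : q'.supp ⊆ C) (h : Disjoint B C)
    (he : p * q = p' * q') : q = q' := by
  refine PPerm.ext ?_ (Equiv.ext fun i => ?_)
  · have h1 := congrArg PPerm.supp he
    rw [PPerm.supp_mul, PPerm.supp_mul, Finset.union_comm, Finset.union_comm p'.supp] at h1
    have h2 := congrArg (· ∩ C) h1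
    simp only [Finset.union_inter_distrib_right] at h2
    rwa [Finset.inter_eq_left.2 hq, Finset.inter_eq_left.2 hq',
      Finset.disjoint_iff_inter_eq_empty.1 (h.mono_left hp),
      Finset.disjoint_iff_inter_eq_empty.1 (h.mono_left hp'), Finset.union_empty,
      Finset.union_empty] at h2
  · by_cases hi : i ∈ C
    · rw [← mul_perm_right hp hq h hi, he, mul_perm_right hp' hq' h hi]
    · rw [q.fix i fun h => hi (hq h), q'.fix i fun h => hi (hq' h)]

lemma restr_mul_restr (x : PPerm) {B V : Finset ℕ+} (hx : x.supp ⊆ V) (hBV : B ⊆ V)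
    (h1 : ∀ i, x.perm i ∈ B ↔ i ∈ B) (h2 : ∀ i, x.perm i ∈ V \ B ↔ i ∈ V \ B) :
    x.restr B h1 * x.restr (V \ B) h2 = x := by
  refine PPerm.ext ?_ (Equiv.ext fun i => ?_)
  · change x.supp ∩ B ∪ x.supp ∩ (V \ B) = x.supp
    rw [← Finset.inter_union_distrib_left, Finset.union_sdiff_of_subset hBV,
      Finset.inter_eq_left.2 hx]
  · rw [PPerm.mul_perm_eq]
    by_cases hi : i ∈ B
    · rw [x.restr_perm_of_notMem h2 fun h => (Finset.mem_sdiff.1 h).2 hi,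
        x.restr_perm_of_mem h1 hi]
    · rw [x.restr_perm_of_notMem h1]
      · by_cases hV : i ∈ V
        · exact x.restr_perm_of_mem h2 (Finset.mem_sdiff.2 ⟨hV, hi⟩)
        · rw [x.restr_perm_of_notMem h2 fun h => hV (Finset.mem_sdiff.1 h).1,
            x.fix i fun h => hV (hx h)]
      · by_cases hV : i ∈ V \ B
        · rw [x.restr_perm_of_mem h2 hV]
          exact fun h => hi ((h1 i).1 h)
        · rwa [x.restr_perm_of_notMem h2 hV]

lemma isConn_congr {B : Finset ℕ+} {p q : PPerm × PPerm}
    (h1 : ∀ i ∈ B, p.1.perm i = q.1.perm i) (h2 : ∀ i ∈ B, p.2.perm i = q.2.perm i)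
    (h : IsConn B p) : IsConn B q :=
  ⟨h.1, fun C hC hne h3 h4 => h.2 C hC hne (fun i hi => by rw [h1 i (hC hi)]; exact h3 i hi)
    fun i hi => by rw [h2 i (hC hi)]; exact h4 i hi⟩

/-- The pairs on `V` with a given orbit `B` are the products of a transitive pair on `B` and an
arbitrary pair on the complement of `B`. -/
lemma sum_isComp {V B : Finset ℕ+} (hBV : B ⊆ V) (θ : Triple) :
    ∑ p ∈ (pairs V).filter (fun p => pairType p = θ ∧ IsComp B p), (p.2.supp ∩ B).card =
      ∑ q ∈ (connPairs B ×ˢ pairs (V \ B)).filter (fun q => pairType q.1 + pairType q.2 = θ),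
        size (pairType q.1).2.1 := by
  have hd : Disjoint B (V \ B) := Finset.disjoint_sdiff
  have hu : B ∪ V \ B = V := Finset.union_sdiff_of_subset hBV
  symm
  refine Finset.sum_bij (fun q _ => q.1 * q.2) (fun q hq => ?_) (fun q hq q' hq' h => ?_)
    (fun p hp => ?_) fun q hq => ?_
  · simp only [Finset.mem_filter, Finset.mem_product, connPairs] at hq ⊢
    obtain ⟨⟨⟨h1, h2⟩, h3⟩, h4⟩ := hq
    rw [pairType_add h1 h3 hd]
    rw [mem_pairs] at h1 h3 ⊢
    have e1 : ∀ i ∈ B, q.1.1.perm i = (q.1 * q.2).1.perm i := fun i hi =>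
      (mul_perm_left q.1.1 h3.1.le hd hi).symm
    have e2 : ∀ i ∈ B, q.1.2.perm i = (q.1 * q.2).2.perm i := fun i hi =>
      (mul_perm_left q.1.2 h3.2 hd hi).symm
    refine ⟨⟨?_, ?_⟩, h4, fun i hi => ?_, fun i hi => ?_, isConn_congr e1 e2 h2⟩
    · rw [Prod.fst_mul, PPerm.supp_mul, h1.1, h3.1, hu]
    · rw [Prod.snd_mul, PPerm.supp_mul, ← hu]
      exact Finset.union_subset_union h1.2 h3.2
    · rw [← e1 i hi]
      have := h1.1
      rw [← this] at hi ⊢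
      exact q.1.1.perm_mem hi
    · rw [← e2 i hi]
      by_cases h : i ∈ q.1.2.supp
      · exact h1.2 (q.1.2.perm_mem h)
      · rwa [q.1.2.fix i h]
  · simp only [Finset.mem_filter, Finset.mem_product, connPairs, mem_pairs] at hq hq'
    have a1 := hq.1.1.1
    have a2 := hq.1.2
    have b1 := hq'.1.1.1
    have b2 := hq'.1.2
    have e1 := congrArg Prod.fst h
    have e2 := congrArg Prod.snd h
    exact Prod.ext
      (Prod.ext (mul_left_inj_of_disjoint a1.1.le a2.1.le b1.1.le b2.1.le hd e1)
        (mul_left_inj_of_disjoint a1.2 a2.2 b1.2 b2.2 hd e2))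
      (Prod.ext (mul_right_inj_of_disjoint a1.1.le a2.1.le b1.1.le b2.1.le hd e1)
        (mul_right_inj_of_disjoint a1.2 a2.2 b1.2 b2.2 hd e2))
  · simp only [Finset.mem_filter] at hp
    obtain ⟨h1, h2, h3, h4, h5⟩ := hp
    have hp' := mem_pairs.1 h1
    have i1 := mapsTo_iff h3
    have i2 := mapsTo_iff h4
    have hV : ∀ x : PPerm, x.supp ⊆ V → ∀ i, x.perm i ∈ V ↔ i ∈ V := fun x hx => mapsTo_iff
      fun i hi => by
        by_cases h : i ∈ x.supp
        · exact hx (x.perm_mem h)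
        · rwa [x.fix i h]
    have j1 : ∀ i, p.1.perm i ∈ V \ B ↔ i ∈ V \ B := fun i => by
      rw [Finset.mem_sdiff, Finset.mem_sdiff, i1, hV _ hp'.1.le]
    have j2 : ∀ i, p.2.perm i ∈ V \ B ↔ i ∈ V \ B := fun i => by
      rw [Finset.mem_sdiff, Finset.mem_sdiff, i2, hV _ hp'.2]
    have e : (p.1.restr B i1, p.2.restr B i2) * (p.1.restr _ j1, p.2.restr _ j2) = p :=
      Prod.ext (restr_mul_restr _ hp'.1.le hBV i1 j1) (restr_mul_restr _ hp'.2 hBV i2 j2)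
    have m1 : (p.1.restr B i1, p.2.restr B i2) ∈ pairs B := by
      rw [mem_pairs]
      refine ⟨?_, Finset.inter_subset_right⟩
      change p.1.supp ∩ B = B
      rw [hp'.1, Finset.inter_eq_right.2 hBV]
    have m2 : (p.1.restr _ j1, p.2.restr _ j2) ∈ pairs (V \ B) := by
      rw [mem_pairs]
      refine ⟨?_, Finset.inter_subset_right⟩
      change p.1.supp ∩ (V \ B) = V \ B
      rw [hp'.1, Finset.inter_eq_right.2 Finset.sdiff_subset]
    refine ⟨((p.1.restr B i1, p.2.restr B i2), (p.1.restr _ j1, p.2.restr _ j2)), ?_, e⟩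
    simp only [Finset.mem_filter, Finset.mem_product, connPairs]
    refine ⟨⟨⟨m1, isConn_congr (fun i hi => (p.1.restr_perm_of_mem i1 hi).symm)
      (fun i hi => (p.2.restr_perm_of_mem i2 hi).symm) h5⟩, m2⟩, ?_⟩
    rw [← pairType_add m1 m2 hd, e, h2]
  · simp only [Finset.mem_filter, Finset.mem_product, connPairs, mem_pairs] at hq
    change size q.1.2.type = ((q.1.2 * q.2.2).supp ∩ B).card
    rw [supp_inter hq.1.1.1.2 hq.1.2.2 hd, PPerm.card_supp]

/-- The number of pairs `(σ, x)` on `V` with given cycle types. -/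
def pairCount (V : Finset ℕ+) (θ : Triple) : ℕ := ((pairs V).filter fun p => pairType p = θ).card

/-- The number of transitive pairs `(σ, x)` on `B` with given cycle types. -/
def connCount (B : Finset ℕ+) (θ : Triple) : ℕ :=
  ((connPairs B).filter fun p => pairType p = θ).card

lemma finite_splits (θ : Triple) : {q : Triple × Triple | q.1 + q.2 = θ}.Finite := by
  refine ((Finset.HasAntidiagonal.antidiagonal θ.1 ×ˢ
    Finset.HasAntidiagonal.antidiagonal θ.2.1 ×ˢ
    Finset.HasAntidiagonal.antidiagonal θ.2.2).finite_toSet.image fun r =>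
      ((r.1.1, r.2.1.1, r.2.2.1), (r.1.2, r.2.1.2, r.2.2.2))).subset ?_
  rintro ⟨⟨a, b, c⟩, a', b', c'⟩ rfl
  exact ⟨((a, a'), (b, b'), (c, c')), by simp, rfl⟩

/-- The decompositions of a triple of partitions into a sum of two. -/
def splits (θ : Triple) : Finset (Triple × Triple) := (finite_splits θ).toFinset

@[simp] lemma mem_splits {θ : Triple} {q : Triple × Triple} : q ∈ splits θ ↔ q.1 + q.2 = θ := by
  simp [splits]

lemma sum_comp_eq {V B : Finset ℕ+} (θ : Triple) :
    ∑ q ∈ (connPairs B ×ˢ pairs (V \ B)).filter (fun q => pairType q.1 + pairType q.2 = θ),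
        size (pairType q.1).2.1 =
      ∑ t ∈ splits θ, size t.1.2.1 * (connCount B t.1 * pairCount (V \ B) t.2) := by
  rw [← Finset.sum_fiberwise_of_maps_to (t := splits θ)
    (g := fun q => (pairType q.1, pairType q.2)) fun q hq => by
      simpa using (Finset.mem_filter.1 hq).2]
  refine Finset.sum_congr rfl fun t ht => ?_
  rw [connCount, pairCount, ← Finset.card_product, mul_comm, ← smul_eq_mul, ← Finset.sum_const]
  refine Finset.sum_congr ?_ fun q hq => ?_
  · ext q
    simp only [Finset.mem_filter, Finset.mem_product]
    rw [mem_splits] at ht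
    constructor
    · rintro ⟨⟨⟨h1, h2⟩, h3⟩, rfl⟩
      exact ⟨⟨h1, rfl⟩, h2, rfl⟩
    · rintro ⟨⟨h1, h2⟩, h3, h4⟩
      exact ⟨⟨⟨h1, h3⟩, by rw [h2, h4, ht]⟩, Prod.ext h2 h4⟩
  · rw [Finset.mem_product, Finset.mem_filter] at hq
    rw [hq.1.2]

/-- Marking a point of the support of `x` and splitting off its orbit. -/
lemma size_mul_pairCount (V : Finset ℕ+) (θ : Triple) :
    size θ.2.1 * pairCount V θ = ∑ B ∈ V.powerset, ∑ t ∈ splits θ,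
      size t.1.2.1 * (connCount B t.1 * pairCount (V \ B) t.2) := by
  have h1 : ∀ p ∈ (pairs V).filter fun p => pairType p = θ, size θ.2.1 =
      ∑ B ∈ V.powerset, if IsComp B p then (p.2.supp ∩ B).card else 0 := by
    intro p hp
    obtain ⟨hp, h⟩ := Finset.mem_filter.1 hp
    have h2 : ∀ r ∈ p.2.supp, (∑ B ∈ V.powerset, if IsComp B p ∧ r ∈ B then 1 else 0) = 1 := by
      intro r hr
      obtain ⟨B, hBV, hrB, hB⟩ := exists_isComp hp ((mem_pairs.1 hp).2 hr)
      rw [Finset.sum_eq_single B, if_pos ⟨hB, hrB⟩]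
      · intro B' _ hne
        exact if_neg fun h => hne (isComp_unique h.1 hB h.2 hrB)
      · exact fun h => absurd (Finset.mem_powerset.2 hBV) h
    rw [← h]
    change size p.2.type = _
    rw [← PPerm.card_supp, Finset.card_eq_sum_ones, ← Finset.sum_congr rfl h2, Finset.sum_comm]
    refine Finset.sum_congr rfl fun B _ => ?_
    split_ifs with hB
    · simp [hB, Finset.sum_ite_mem]
    · simp [hB]
  rw [pairCount, mul_comm, ← smul_eq_mul, ← Finset.sum_const, Finset.sum_congr rfl h1,
    Finset.sum_comm]
  refine Finset.sum_congr rfl fun B hB => ?_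
  rw [← sum_comp_eq, ← sum_isComp (Finset.mem_powerset.1 hB), ← Finset.sum_filter,
    Finset.filter_filter]

/-! ### Forgetting the support of a partial permutation -/

lemma cycType_apply {α : Type*} [Fintype α] [DecidableEq α] (s : Equiv.Perm α) (i : ℕ+) :
    cycType s i = s.partition.parts.count (i : ℕ) := by
  rw [cycType, Multiset.toFinsupp_apply]
  conv_rhs => rw [← map_coe_toPNat' fun i hi => s.partition.parts_pos hi]
  exact (Multiset.count_map_eq_count' _ _ PNat.coe_injective i).symm

lemma cycType_apply_one {α : Type*} [Fintype α] [DecidableEq α] (s : Equiv.Perm α) :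
    cycType s 1 = (Finset.univ.filter fun a => s a = a).card := by
  rw [cycType_apply, Equiv.Perm.parts_partition, PNat.one_coe, Multiset.count_add,
    Multiset.count_eq_zero_of_notMem, Multiset.count_replicate_self, zero_add,
    ← Finset.card_compl]
  · congr 1
    ext a
    simp
  · exact fun h => absurd (Equiv.Perm.two_le_of_mem_cycleType h) (by norm_num)

lemma size_shift {n : ℕ} {Δ : Part} (h : size Δ ≤ n) : size (shift n Δ) = n := by
  rw [shift, size_add, size_single, PNat.one_coe, one_mul]
  omega

lemma shift_of_size {n : ℕ} {Δ : Part} (h : size Δ = n) : shift n Δ = Δ := by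
  simp [shift, h]

namespace PPerm

/-- A set `D` of fixed points is removed from the support. -/
def eraseSupp (x : PPerm) (D : Finset ℕ+) (h : ∀ i ∈ D, x.perm i = i) : PPerm where
  supp := x.supp \ D
  perm := x.perm
  fix i hi := by
    by_cases hD : i ∈ D
    · exact h i hD
    · exact x.fix i fun hx => hi (Finset.mem_sdiff.2 ⟨hx, hD⟩)

lemma supp_eraseSupp_subset (x : PPerm) (D : Finset ℕ+) (h : ∀ i ∈ D, x.perm i = i) :
    (x.eraseSupp D h).supp ⊆ x.supp := Finset.sdiff_subset

lemma eraseSupp_mul_idOn (x : PPerm) (D : Finset ℕ+) (h : ∀ i ∈ D, x.perm i = i) :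
    x.eraseSupp D h * idOn x.supp = x :=
  PPerm.ext (Finset.union_eq_right.2 Finset.sdiff_subset) rfl

end PPerm

section OfPerm

variable {V : Type*} {S : Finset ℕ+} (e : V ≃ {i // i ∈ S})

/-- A permutation of a finite set, transported to the subset `S` of the positive integers. -/
def ofPerm (s : Equiv.Perm V) : PPerm where
  supp := S
  perm := s.extendDomain e
  fix _ hi := s.extendDomain_apply_not_subtype e hi

lemma ofPerm_perm_apply (s : Equiv.Perm V) (v : V) : (ofPerm e s).perm (e v) = e (s v) :=
  s.extendDomain_apply_image e v

lemma ofPerm_mul (s t : Equiv.Perm V) : ofPerm e s * ofPerm e t = ofPerm e (s * t) :=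
  PPerm.ext (Finset.union_self S) (Equiv.Perm.extendDomain_mul e s t)

lemma type_ofPerm [Fintype V] [DecidableEq V] (s : Equiv.Perm V) : (ofPerm e s).type = cycType s :=
  ((cycType_eq_iff _ _).2 ⟨e, fun a => Subtype.ext (ofPerm_perm_apply e s a).symm⟩).symm

lemma ofPerm_injective : Function.Injective (ofPerm e) := fun _ _ h =>
  Equiv.Perm.extendDomainHom_injective e (congrArg PPerm.perm h)

lemma exists_ofPerm {x : PPerm} (hx : x.supp = S) : ∃ s : Equiv.Perm V, ofPerm e s = x := by
  subst hx
  refine ⟨e.trans (x.restrict.trans e.symm), PPerm.ext rfl (Equiv.ext fun i => ?_)⟩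
  by_cases hi : i ∈ x.supp
  · obtain ⟨v, hv⟩ := e.surjective ⟨i, hi⟩
    have : i = e v := by rw [hv]
    rw [this, ofPerm_perm_apply]
    simp [PPerm.restrict]
  · rw [x.fix i hi]
    exact Equiv.Perm.extendDomain_apply_not_subtype _ e hi

lemma mul_ofPerm {x : PPerm} (s : Equiv.Perm V) :
    x * ofPerm e s = x * PPerm.idOn S * ofPerm e s :=
  PPerm.ext (by simp only [PPerm.supp_mul, Finset.union_assoc]; simp [ofPerm, PPerm.idOn])
    (by simp [PPerm.perm_mul, PPerm.idOn])

/-- Enlarging the support to `S` adds fixed points, that is, rows of length `1`. -/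
lemma type_mul_idOn {x : PPerm} {S : Finset ℕ+} (hx : x.supp ⊆ S) :
    (x * PPerm.idOn S).type = x.type + Finsupp.single 1 (S.card - x.supp.card) := by
  have h : x * PPerm.idOn S = x * PPerm.idOn (S \ x.supp) :=
    PPerm.ext (by simp [PPerm.supp_mul, PPerm.idOn]) rfl
  rw [h, PPerm.type_mul_of_disjoint x _ Finset.disjoint_sdiff, PPerm.type_idOn,
    Finset.card_sdiff_of_subset hx]

/-- Each permutation of cycle type `[Δ, 1^{n-|Δ|}]` of a set with `n` elements underlies
`binom(n - |Δ| + m₁(Δ), m₁(Δ))` partial permutations of cycle type `Δ`: the complement of the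
support consists of `n - |Δ|` fixed points. -/
lemma sum_within_type [Fintype V] [DecidableEq V] {M : Type*} [AddCommMonoid M] {Δ : Part} (hΔ : size Δ ≤ S.card)
    (F : PPerm → M) :
    ∑ x ∈ (PPerm.within S).filter (fun x => x.type = Δ), F (x * PPerm.idOn S) =
      (S.card - size Δ + Δ 1).choose (Δ 1) •
        ∑ s : Equiv.Perm V with cycType s = shift S.card Δ, F (ofPerm e s) := by
  have hfix : ∀ s : Equiv.Perm V, cycType s = shift S.card Δ →
      (S.filter fun i => (ofPerm e s).perm i = i).card = S.card - size Δ + Δ 1 := by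
    intro s hs
    have h1 := cycType_apply_one s
    rw [hs, shift, Finsupp.add_apply, Finsupp.single_eq_same, add_comm] at h1
    rw [h1]
    symm
    refine Finset.card_bij (fun v _ => (e v : ℕ+)) (fun v hv => ?_) (fun v _ w _ h => ?_)
      fun i hi => ?_
    · rw [Finset.mem_filter] at hv ⊢
      refine ⟨(e v).2, ?_⟩
      rw [ofPerm_perm_apply, hv.2]
    · exact e.injective (Subtype.ext h)
    · obtain ⟨hiS, hi⟩ := Finset.mem_filter.1 hi
      obtain ⟨v, hv⟩ := e.surjective ⟨i, hiS⟩
      have h2 : i = e v := by rw [hv]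
      refine ⟨v, ?_, h2.symm⟩
      rw [h2, ofPerm_perm_apply] at hi
      simpa using e.injective (Subtype.ext hi)
  have hsum : ∀ s ∈ Finset.univ.filter (fun s : Equiv.Perm V => cycType s = shift S.card Δ),
      (S.card - size Δ + Δ 1).choose (Δ 1) • F (ofPerm e s) =
        ∑ D ∈ (S.filter fun i => (ofPerm e s).perm i = i).powersetCard (S.card - size Δ),
          F (ofPerm e s) := by
    intro s hs
    rw [Finset.sum_const, Finset.card_powersetCard, hfix s (Finset.mem_filter.1 hs).2,
      Nat.choose_symm_add]
  rw [Finset.smul_sum, Finset.sum_congr rfl hsum, Finset.sum_sigma']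
  symm
  have hDS : ∀ q : (_ : Equiv.Perm V) × Finset ℕ+,
      q.2 ∈ (S.filter fun i => (ofPerm e q.1).perm i = i).powersetCard (S.card - size Δ) →
      q.2 ⊆ S := fun q hq =>
    (Finset.mem_powersetCard.1 hq).1.trans (Finset.filter_subset _ _)
  have hfixD : ∀ q : (_ : Equiv.Perm V) × Finset ℕ+,
      q.2 ∈ (S.filter fun i => (ofPerm e q.1).perm i = i).powersetCard (S.card - size Δ) →
      ∀ i ∈ q.2, (ofPerm e q.1).perm i = i := fun q hq i hi =>
    (Finset.mem_filter.1 ((Finset.mem_powersetCard.1 hq).1 hi)).2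
  refine Finset.sum_bij
    (fun q hq => (ofPerm e q.1).eraseSupp q.2 (hfixD q (Finset.mem_sigma.1 hq).2))
    (fun q hq => ?_) (fun q hq q' hq' h => ?_) (fun x hx => ?_) fun q hq => ?_
  · rw [Finset.mem_filter, PPerm.mem_within]
    refine ⟨Finset.sdiff_subset, ?_⟩
    have hq2 := (Finset.mem_sigma.1 hq).2
    have h1 := type_mul_idOn
      (PPerm.supp_eraseSupp_subset (ofPerm e q.1) q.2 (hfixD q hq2))
    have h3 : S.card - (S \ q.2).card = S.card - size Δ := by
      rw [Finset.card_sdiff_of_subset (hDS q hq2), (Finset.mem_powersetCard.1 hq2).2]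
      omega
    change _ = _ + Finsupp.single 1 (S.card - (S \ q.2).card) at h1
    rw [PPerm.eraseSupp_mul_idOn, type_ofPerm,
      (Finset.mem_filter.1 (Finset.mem_sigma.1 hq).1).2, h3, shift] at h1
    exact (add_right_cancel h1).symm
  · rw [Finset.mem_sigma] at hq hq'
    have h' := congrArg PPerm.perm h
    have h0 : (ofPerm e q.1).perm = (ofPerm e q'.1).perm := h'
    have h1 : q.1 = q'.1 := ofPerm_injective e (PPerm.ext rfl h0)
    have h2 : S \ q.2 = S \ q'.2 := congrArg PPerm.supp h
    have h3 : q.2 = q'.2 := by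
      rw [← Finset.sdiff_sdiff_eq_self (hDS q hq.2), h2, Finset.sdiff_sdiff_eq_self (hDS q' hq'.2)]
    exact Sigma.ext h1 (heq_of_eq h3)
  · obtain ⟨hxS, hx⟩ := Finset.mem_filter.1 hx
    rw [PPerm.mem_within] at hxS
    obtain ⟨s, hs⟩ := exists_ofPerm e (x := x * PPerm.idOn S) (Finset.union_eq_right.2 hxS)
    have hs' : (ofPerm e s).perm = (x * PPerm.idOn S).perm := congrArg PPerm.perm hs
    have hsx : (ofPerm e s).perm = x.perm := hs'
    refine ⟨⟨s, S \ x.supp⟩, ?_, PPerm.ext (Finset.sdiff_sdiff_eq_self hxS) hsx⟩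
    rw [Finset.mem_sigma, Finset.mem_filter, Finset.mem_powersetCard]
    refine ⟨⟨Finset.mem_univ _, ?_⟩, fun i hi => ?_, ?_⟩
    · change cycType s = _
      rw [← type_ofPerm e, hs, type_mul_idOn hxS, hx, PPerm.card_supp, hx, shift]
    · rw [Finset.mem_sdiff] at hi
      rw [Finset.mem_filter]
      exact ⟨hi.1, by rw [hsx]; exact x.fix i hi.2⟩
    · change (S \ x.supp).card = _
      rw [Finset.card_sdiff_of_subset hxS, PPerm.card_supp, hx]
  · exact congrArg F (PPerm.eraseSupp_mul_idOn (ofPerm e q.1) q.2 _).symm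

end OfPerm

lemma within_type_eq_empty {S : Finset ℕ+} {Δ : Part} (h : S.card < size Δ) :
    (PPerm.within S).filter (fun x => x.type = Δ) = ∅ := by
  refine Finset.filter_eq_empty_iff.2 fun x hx hΔ => ?_
  have := Finset.card_le_card (PPerm.mem_within.1 hx)
  rw [PPerm.card_supp, hΔ] at this
  omega

/-- An identification of `{0, …, n - 1}` with `{1, …, n}`. -/
def finEquiv (n : ℕ) : Fin n ≃ {i // i ∈ full n} :=
  Fintype.equivOfCardEq (by simp)

lemma equiv_full {V : Type*} [Fintype V] {n : ℕ} (h : Fintype.card V = n) :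
    Nonempty (V ≃ {i // i ∈ full n}) :=
  ⟨Fintype.equivOfCardEq (by simp [h])⟩

/-! ### Centralizer orders -/

/-- `z_Γ = ∏ i^{mᵢ(Γ)} mᵢ(Γ)!`, the order of the centralizer of a permutation of cycle type
`Γ`. -/
def zee (Γ : Part) : ℕ := rowProd Γ * Γ.prod fun _ m => m !

lemma rowProd_add (Γ Γ' : Part) : rowProd (Γ + Γ') = rowProd Γ * rowProd Γ' :=
  Finsupp.prod_add_index' (by simp) (by intros; exact pow_add _ _ _)

lemma rowProd_toFinsupp (s : Multiset ℕ+) :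
    rowProd (Multiset.toFinsupp s) = (s.map fun i : ℕ+ => (i : ℕ)).prod := by
  induction s using Multiset.induction_on with
  | empty => simp [rowProd]
  | cons a s ih =>
    rw [← Multiset.singleton_add, map_add, rowProd_add, ih]
    simp [rowProd]

lemma zee_cycType {α : Type*} [Fintype α] [DecidableEq α] (g : Equiv.Perm α) :
    zee (cycType g) = (Fintype.card α - g.cycleType.sum)! * g.cycleType.prod *
      ∏ n ∈ g.cycleType.toFinset, (g.cycleType.count n)! := by
  have h1 : rowProd (cycType g) = g.cycleType.prod := by
    rw [cycType, rowProd_toFinsupp, map_coe_toPNat' fun i hi => g.partition.parts_pos hi,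
      Equiv.Perm.parts_partition]
    simp
  have h2 : (cycType g).prod (fun _ m => m !) =
      ∏ n ∈ g.partition.parts.toFinset, (g.partition.parts.count n)! := by
    refine Finset.prod_bij (fun i _ => (i : ℕ)) (fun i hi => ?_) (fun i _ j _ h => PNat.coe_injective h)
      (fun n hn => ?_) fun i _ => by rw [cycType_apply]
    · rw [Finsupp.mem_support_iff, cycType_apply] at hi
      rwa [Multiset.mem_toFinset, ← Multiset.count_ne_zero]
    · rw [Multiset.mem_toFinset] at hn
      let i : ℕ+ := ⟨n, g.partition.parts_pos hn⟩
      refine ⟨i, ?_, rfl⟩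
      rw [Finsupp.mem_support_iff, cycType_apply]
      exact Multiset.count_ne_zero.2 hn
  have h3 : 1 ∉ g.cycleType := fun h =>
    absurd (Equiv.Perm.two_le_of_mem_cycleType h) (by norm_num)
  have h4 : ∏ n ∈ g.partition.parts.toFinset, (g.partition.parts.count n)! =
      ∏ n ∈ insert 1 g.cycleType.toFinset, (g.partition.parts.count n)! := by
    refine Finset.prod_subset (fun n hn => ?_) fun n _ hn => ?_
    · rw [Multiset.mem_toFinset, Equiv.Perm.parts_partition, Multiset.mem_add,
        Multiset.mem_replicate] at hn
      rw [Finset.mem_insert, Multiset.mem_toFinset]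
      tauto
    · rw [Multiset.mem_toFinset] at hn
      rw [Multiset.count_eq_zero_of_notMem hn, Nat.factorial_zero]
  rw [zee, h1, h2, h4, Finset.prod_insert (by simpa using h3), Equiv.Perm.parts_partition,
    Multiset.count_add, Multiset.count_eq_zero_of_notMem h3, Multiset.count_replicate_self,
    zero_add, Equiv.Perm.sum_cycleType]
  rw [← mul_assoc, mul_comm g.cycleType.prod]
  congr 1
  refine Finset.prod_congr rfl fun n hn => ?_
  rw [Multiset.count_add, Multiset.count_replicate, if_neg, add_zero]
  rintro rfl
  exact h3 (Multiset.mem_toFinset.1 hn)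

lemma card_cycType_mul_zee {α : Type*} [Fintype α] [DecidableEq α] {Γ : Part}
    (h : size Γ = Fintype.card α) :
    (Finset.univ.filter fun s : Equiv.Perm α => cycType s = Γ).card * zee Γ =
      (Fintype.card α)! := by
  obtain ⟨x, hx, hΓ⟩ := exists_type_full Γ
  rw [h] at hx
  obtain ⟨e⟩ := equiv_full (V := α) rfl
  obtain ⟨g, rfl⟩ := exists_ofPerm e hx
  rw [type_ofPerm] at hΓ
  subst hΓ
  rw [zee_cycType, ← Equiv.Perm.card_isConj_mul_eq g, Nat.card_eq_fintype_card,
    Fintype.card_subtype]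
  congr 2
  ext s
  simp only [Finset.mem_filter, Finset.mem_univ, true_and]
  have h5 : IsConj g s ↔ cycType s = cycType g := by
    rw [eq_comm, cycType_eq_iff, isConj_iff]
    refine exists_congr fun c => ?_
    rw [mul_inv_eq_iff_eq_mul, Equiv.ext_iff]
    rfl
  exact h5.symm

lemma zee_ne_zero (Γ : Part) : zee Γ ≠ 0 := by
  refine mul_ne_zero ?_ ?_
  · exact Finset.prod_ne_zero_iff.2 fun i _ => pow_ne_zero _ i.ne_zero
  · exact Finset.prod_ne_zero_iff.2 fun i _ => Nat.factorial_ne_zero _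

/-! ### Counting pairs of permutations -/

lemma PPerm.supp_subset_map {x : PPerm} {V : Finset ℕ+} (v : Equiv.Perm ℕ+) (h : x.supp ⊆ V) :
    (PPerm.conj v x).supp ⊆ V.map v.toEmbedding :=
  Finset.map_subset_map.2 h

lemma conj_mem_pairs {V : Finset ℕ+} {p : PPerm × PPerm} (v : Equiv.Perm ℕ+) (hp : p ∈ pairs V) :
    (PPerm.conj v p.1, PPerm.conj v p.2) ∈ pairs (V.map v.toEmbedding) := by
  rw [mem_pairs] at hp ⊢
  refine ⟨?_, PPerm.supp_subset_map v hp.2⟩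
  rw [PPerm.supp_conj, hp.1]

lemma pairType_conj (v : Equiv.Perm ℕ+) (p : PPerm × PPerm) :
    pairType (PPerm.conj v p.1, PPerm.conj v p.2) = pairType p := by
  simp only [pairType, ← map_mul, type_conj]

lemma isConn_conj {B : Finset ℕ+} {p : PPerm × PPerm} (v : Equiv.Perm ℕ+) (h : IsConn B p) :
    IsConn (B.map v.toEmbedding) (PPerm.conj v p.1, PPerm.conj v p.2) := by
  refine ⟨h.1.map, fun C hC hne h1 h2 => ?_⟩
  obtain ⟨D, hD, rfl⟩ := Finset.subset_map_iff.1 hC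
  have key : ∀ x : PPerm, (∀ i ∈ D.map v.toEmbedding, (PPerm.conj v x).perm i ∈
      D.map v.toEmbedding) → ∀ i ∈ D, x.perm i ∈ D := by
    intro x hx i hi
    have := hx (v i) (Finset.mem_map_of_mem v.toEmbedding hi)
    rw [PPerm.conj_perm_apply] at this
    simpa using this
  rw [h.2 D hD (Finset.map_nonempty.1 hne) (key _ h1) (key _ h2)]

lemma pairCount_le {V V' : Finset ℕ+} (h : V.card = V'.card) (θ : Triple) :
    pairCount V θ ≤ pairCount V' θ := by
  obtain ⟨v, rfl⟩ := exists_perm_map_eq h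
  refine Finset.card_le_card_of_injOn (fun p => (PPerm.conj v p.1, PPerm.conj v p.2))
    (fun p hp => ?_) fun p _ q _ h => ?_
  · rw [Finset.mem_coe, Finset.mem_filter] at hp ⊢
    exact ⟨conj_mem_pairs v hp.1, by rw [pairType_conj, hp.2]⟩
  · exact Prod.ext (conj_injective v (congrArg Prod.fst h)) (conj_injective v (congrArg Prod.snd h))

lemma pairCount_congr {V V' : Finset ℕ+} (h : V.card = V'.card) (θ : Triple) :
    pairCount V θ = pairCount V' θ := le_antisymm (pairCount_le h θ) (pairCount_le h.symm θ)

lemma connCount_le {V V' : Finset ℕ+} (h : V.card = V'.card) (θ : Triple) :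
    connCount V θ ≤ connCount V' θ := by
  obtain ⟨v, rfl⟩ := exists_perm_map_eq h
  refine Finset.card_le_card_of_injOn (fun p => (PPerm.conj v p.1, PPerm.conj v p.2))
    (fun p hp => ?_) fun p _ q _ h => ?_
  · rw [Finset.mem_coe, Finset.mem_filter, connPairs, Finset.mem_filter] at hp ⊢
    exact ⟨⟨conj_mem_pairs v hp.1.1, isConn_conj v hp.1.2⟩, by rw [pairType_conj, hp.2]⟩
  · exact Prod.ext (conj_injective v (congrArg Prod.fst h)) (conj_injective v (congrArg Prod.snd h))

lemma connCount_congr {V V' : Finset ℕ+} (h : V.card = V'.card) (θ : Triple) :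
    connCount V θ = connCount V' θ := le_antisymm (connCount_le h θ) (connCount_le h.symm θ)

lemma connCount_eq_zero {B : Finset ℕ+} {t : Triple} (h : B.card ≠ size t.1) :
    connCount B t = 0 := by
  rw [connCount, Finset.card_eq_zero, Finset.filter_eq_empty_iff]
  rintro p hp rfl
  have h1 := (mem_pairs.1 (Finset.mem_filter.1 hp).1).1
  apply h
  rw [← h1, PPerm.card_supp]
  rfl

/-- The number of the partial permutations `x` of cycle type `Δ`, supported in the set permuted
by `σ`, such that `x σ` has cycle type `Γ`. -/
def transCount (Δ : Part) (σ : PPerm) (Γ : Part) : ℕ :=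
  ((PPerm.within σ.supp).filter fun x => x.type = Δ ∧ (x * σ).type = Γ).card

lemma transCount_le {σ σ' : PPerm} (h : σ.type = σ'.type) (Δ Γ : Part) :
    transCount Δ σ Γ ≤ transCount Δ σ' Γ := by
  obtain ⟨v, rfl⟩ := exists_conj_of_type_eq h
  refine Finset.card_le_card_of_injOn (PPerm.conj v) (fun x hx => ?_) (conj_injective v).injOn
  rw [Finset.mem_coe, Finset.mem_filter, PPerm.mem_within] at hx ⊢
  rw [← map_mul, type_conj, type_conj]
  exact ⟨PPerm.supp_subset_map v hx.1, hx.2⟩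

lemma transCount_congr {σ σ' : PPerm} (h : σ.type = σ'.type) (Δ Γ : Part) :
    transCount Δ σ Γ = transCount Δ σ' Γ :=
  le_antisymm (transCount_le h Δ Γ) (transCount_le h.symm Δ Γ)

/-- A permutation of `{1, …, |Γ|}` of cycle type `Γ`. -/
def std (Γ : Part) : PPerm := (exists_type_full Γ).choose

lemma std_supp (Γ : Part) : (std Γ).supp = full (size Γ) := (exists_type_full Γ).choose_spec.1

lemma std_type (Γ : Part) : (std Γ).type = Γ := (exists_type_full Γ).choose_spec.2

/-- All permutations `σ` of the same cycle type occur in equally many pairs. -/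
lemma pairCount_mul_zee (Γ' Δ Γ : Part) :
    pairCount (full (size Γ')) (Γ', Δ, Γ) * zee Γ' =
      (size Γ')! * transCount Δ (std Γ') Γ := by
  have h1 := card_cycType_mul_zee (α := Fin (size Γ')) (Γ := Γ') (by simp)
  rw [Fintype.card_fin] at h1
  rw [← h1, mul_assoc, mul_comm (zee Γ'), ← mul_assoc]
  congr 1
  rw [pairCount, Finset.card_eq_sum_card_fiberwise
    (f := Prod.fst) (t := (Finset.univ.filter fun s : Equiv.Perm (Fin (size Γ')) =>
      cycType s = Γ').image (ofPerm (finEquiv _)))]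
  · rw [Finset.sum_image fun s _ t _ h => ofPerm_injective _ h, ← smul_eq_mul, ← Finset.sum_const]
    refine Finset.sum_congr rfl fun s hs => ?_
    rw [← transCount_congr (σ := ofPerm (finEquiv _) s)]
    · refine Finset.card_bij (fun p _ => p.2) (fun p hp => ?_) (fun p hp q hq h => ?_)
        fun x hx => ?_
      · simp only [Finset.mem_filter, mem_pairs, pairType, Prod.mk.injEq] at hp
        obtain ⟨⟨h1, h2, h3, h4⟩, h5⟩ := hp
        rw [Finset.mem_filter, PPerm.mem_within, ← h5]
        exact ⟨h1.2.trans h1.1.ge, h3, h4⟩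
      · exact Prod.ext ((Finset.mem_filter.1 hp).2.trans (Finset.mem_filter.1 hq).2.symm) h
      · rw [Finset.mem_filter, PPerm.mem_within] at hx
        refine ⟨(ofPerm (finEquiv _) s, x), ?_, rfl⟩
        simp only [Finset.mem_filter, mem_pairs, pairType, Prod.mk.injEq]
        exact ⟨⟨⟨rfl, hx.1⟩, by rw [type_ofPerm, (Finset.mem_filter.1 hs).2], hx.2⟩, trivial⟩
    · rw [type_ofPerm, std_type, (Finset.mem_filter.1 hs).2]
  · intro p hp
    simp only [Finset.coe_filter, Set.mem_ofPred_eq, mem_pairs, pairType, Prod.mk.injEq] at hp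
    obtain ⟨s, hs⟩ := exists_ofPerm (finEquiv _) hp.1.1
    rw [Finset.mem_coe, Finset.mem_image]
    refine ⟨s, ?_, hs⟩
    rw [Finset.mem_filter, ← type_ofPerm (finEquiv _), hs, hp.2.1]
    exact ⟨Finset.mem_univ _, rfl⟩

lemma size_eq_zero {Δ : Part} (h : size Δ = 0) : Δ = 0 := by
  ext i
  have := mul_le_size Δ i
  rw [h, Nat.le_zero, mul_eq_zero] at this
  exact this.resolve_left i.ne_zero

lemma type_eq_zero_iff {x : PPerm} : x.type = 0 ↔ x = 1 := by
  constructor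
  · intro h
    have h1 : x.supp = ∅ := by
      rw [← Finset.card_eq_zero, PPerm.card_supp, h]
      rfl
    exact PPerm.ext h1 (Equiv.ext fun i => x.fix i (by simp [h1]))
  · rintro rfl
    refine size_eq_zero ?_
    rw [size_type]
    rfl

lemma transCount_zero (σ : PPerm) (Γ : Part) :
    transCount 0 σ Γ = if σ.type = Γ then 1 else 0 := by
  have : ((PPerm.within σ.supp).filter fun x => x.type = 0 ∧ (x * σ).type = Γ) =
      if σ.type = Γ then {1} else ∅ := by
    ext x
    rw [Finset.mem_filter, PPerm.mem_within, type_eq_zero_iff]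
    split_ifs with h
    · rw [Finset.mem_singleton]
      refine ⟨fun h => h.2.1, ?_⟩
      rintro rfl
      exact ⟨Finset.empty_subset _, rfl, by rwa [one_mul]⟩
    · simp only [Finset.notMem_empty, iff_false, not_and]
      rintro - rfl
      rwa [one_mul]
  rw [transCount, this]
  split_ifs <;> rfl

/-- The number of the pairs of given cycle types divided by `n!` (`pairWeight_eq`), in terms of the
number of the pairs with a fixed permutation `σ`, of which there are `n! / z_{Γ'}`. -/
def pairWeight (θ : Triple) : ℂ := (transCount θ.2.1 (std θ.1) θ.2.2 : ℂ) / zee θ.1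

/-- The number of the transitive pairs of given cycle types divided by `n!`. -/
def connWeight (t : Triple) : ℂ := (connCount (full (size t.1)) t : ℂ) / ((size t.1)! : ℂ)

lemma pairWeight_eq (θ : Triple) :
    pairWeight θ = (pairCount (full (size θ.1)) θ : ℂ) / ((size θ.1)! : ℂ) := by
  have h := pairCount_mul_zee θ.1 θ.2.1 θ.2.2
  have h1 : (zee θ.1 : ℂ) ≠ 0 := Nat.cast_ne_zero.2 (zee_ne_zero _)
  have h2 : ((size θ.1)! : ℂ) ≠ 0 := Nat.cast_ne_zero.2 (Nat.factorial_ne_zero _)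
  rw [pairWeight, div_eq_div_iff h1 h2, mul_comm]
  exact_mod_cast h.symm

/-- The recursion that characterizes the exponential formula. -/
lemma size_mul_pairWeight (θ : Triple) :
    (size θ.2.1 : ℂ) * pairWeight θ =
      ∑ q ∈ splits θ, (size q.1.2.1 : ℂ) * (connWeight q.1 * pairWeight q.2) := by
  have h := size_mul_pairCount (full (size θ.1)) θ
  rw [Finset.sum_comm] at h
  have h2 : ∀ n : ℕ, (n ! : ℂ) ≠ 0 := fun n => Nat.cast_ne_zero.2 (Nat.factorial_ne_zero _)
  rw [pairWeight_eq, ← mul_div_assoc, div_eq_iff (h2 _), Finset.sum_mul]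
  have h' := congrArg (Nat.cast : ℕ → ℂ) h
  rw [Nat.cast_mul, Nat.cast_sum] at h'
  rw [h']
  refine Finset.sum_congr rfl fun q hq => ?_
  rw [mem_splits] at hq
  have hn : size θ.1 = size q.1.1 + size q.2.1 := by
    rw [← hq]
    exact size_add _ _
  rw [← Finset.mul_sum, Nat.cast_mul, mul_assoc]
  congr 1
  have h3 : ∑ B ∈ (full (size θ.1)).powerset,
      connCount B q.1 * pairCount (full (size θ.1) \ B) q.2 =
      ∑ B ∈ (full (size θ.1)).powersetCard (size q.1.1),
        connCount (full (size q.1.1)) q.1 * pairCount (full (size q.2.1)) q.2 := by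
    rw [← Finset.sum_subset (s₁ := (full (size θ.1)).powersetCard (size q.1.1)) fun B hB =>
      Finset.mem_powerset.2 (Finset.mem_powersetCard.1 hB).1]
    · refine Finset.sum_congr rfl fun B hB => ?_
      rw [Finset.mem_powersetCard] at hB
      rw [connCount_congr (by rw [card_full, hB.2]), pairCount_congr]
      rw [Finset.card_sdiff_of_subset hB.1, hB.2, card_full, card_full]
      omega
    · intro B hB hB'
      rw [connCount_eq_zero, zero_mul]
      intro h
      exact hB' (Finset.mem_powersetCard.2 ⟨Finset.mem_powerset.1 hB, h⟩)
  rw [h3, Finset.sum_const, Finset.card_powersetCard, card_full, pairWeight_eq, connWeight,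
    smul_eq_mul]
  have h4 := Nat.add_choose_mul_factorial_mul_factorial (size q.1.1) (size q.2.1)
  rw [← Nat.choose_symm_add, ← hn] at h4
  rw [← h4]
  have := h2 (size q.1.1)
  have := h2 (size q.2.1)
  push_cast
  field_simp

/-! ### The exponential formula -/

/-- The number of permutations of the indices of a family of triples that preserve it. -/
def autM (M : Multiset Triple) : ℕ := ∏ t ∈ M.toFinset, (M.count t)!

lemma autM_eq_of_subset {M : Multiset Triple} {S : Finset Triple} (h : M.toFinset ⊆ S) :
    autM M = ∏ t ∈ S, (M.count t)! := by
  refine Finset.prod_subset h fun t _ ht => ?_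
  rw [Multiset.mem_toFinset] at ht
  rw [Multiset.count_eq_zero_of_notMem ht, Nat.factorial_zero]

lemma autM_cons (t : Triple) (M : Multiset Triple) :
    autM (t ::ₘ M) = (t ::ₘ M).count t * autM M := by
  have h1 : t ∈ insert t M.toFinset := Finset.mem_insert_self _ _
  rw [autM_eq_of_subset (S := insert t M.toFinset) (by rw [Multiset.toFinset_cons]),
    autM_eq_of_subset (M := M) (S := insert t M.toFinset) (Finset.subset_insert _ _),
    ← Finset.mul_prod_erase _ _ h1, ← Finset.mul_prod_erase _ _ h1, Multiset.count_cons_self,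
    Nat.factorial_succ, mul_assoc]
  congr 2
  refine Finset.prod_congr rfl fun u hu => ?_
  rw [Multiset.count_cons_of_ne (Finset.ne_of_mem_erase hu)]

lemma autM_ne_zero (M : Multiset Triple) : autM M ≠ 0 :=
  Finset.prod_ne_zero_iff.2 fun _ _ => Nat.factorial_ne_zero _

/-- `(1 / |Aut|) ∏ h(tᵢ)` for a family `(tᵢ)` of triples. -/
def famWeight (h : Triple → ℂ) (M : Multiset Triple) : ℂ := (autM M : ℂ)⁻¹ * (M.map h).prod

/-- A member `t` can be marked in `count t` ways, which cancels against `|Aut|`. -/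
lemma count_mul_famWeight (h : Triple → ℂ) (t : Triple) (M : Multiset Triple) :
    ((t ::ₘ M).count t : ℂ) * famWeight h (t ::ₘ M) = h t * famWeight h M := by
  have h1 : ((t ::ₘ M).count t : ℂ) ≠ 0 := by
    rw [Multiset.count_cons_self]
    exact Nat.cast_ne_zero.2 (Nat.succ_ne_zero _)
  have h2 : (autM M : ℂ) ≠ 0 := Nat.cast_ne_zero.2 (autM_ne_zero M)
  rw [famWeight, famWeight, autM_cons, Multiset.map_cons, Multiset.prod_cons, Nat.cast_mul]
  field_simp

/-- The families of triples, with non-empty middle partitions, that add up to `θ` together with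
an unramified part `(α, 0, α)`. -/
def IsFam (θ : Triple) (q : Multiset Triple × Part) : Prop :=
  q.1.sum + (q.2, 0, q.2) = θ ∧ ∀ t ∈ q.1, 1 ≤ size t.2.1

lemma card_le_size_sum {M : Multiset Triple} (h : ∀ t ∈ M, 1 ≤ size t.2.1) :
    M.card ≤ size M.sum.2.1 := by
  induction M using Multiset.induction_on with
  | empty => simp
  | cons t M ih =>
    rw [Multiset.card_cons, Multiset.sum_cons, Prod.snd_add, Prod.fst_add, size_add]
    have h1 := h t (Multiset.mem_cons_self _ _)
    have h2 := ih fun u hu => h u (Multiset.mem_cons_of_mem hu)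
    omega

lemma finite_isFam (θ : Triple) : {q | IsFam θ q}.Finite := by
  let S : Finset Triple := (splits θ).image Prod.fst
  let P : Finset Part := (Finset.HasAntidiagonal.antidiagonal θ.1).image Prod.snd
  refine ((((size θ.2.1) • S.val).powerset.toFinset ×ˢ P).finite_toSet).subset ?_
  rintro ⟨M, α⟩ ⟨h1, h2⟩
  dsimp only at h1 h2
  have hcard : M.card ≤ size θ.2.1 := by
    refine (card_le_size_sum h2).trans ?_
    rw [← h1]
    simp
  rw [Finset.mem_coe, Finset.mem_product]
  constructor
  · simp only [Multiset.mem_toFinset, Multiset.mem_powerset]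
    refine Multiset.le_iff_count.2 fun t => ?_
    by_cases ht : t ∈ M
    · have htS : t ∈ S := by
        obtain ⟨M', rfl⟩ := Multiset.exists_cons_of_mem ht
        refine Finset.mem_image.2 ⟨(t, M'.sum + (α, 0, α)), ?_, rfl⟩
        rw [mem_splits, ← h1, Multiset.sum_cons, add_assoc]
      rw [Multiset.count_nsmul, Multiset.count_eq_one_of_mem S.nodup htS, mul_one]
      exact (Multiset.count_le_card _ _).trans hcard
    · rw [Multiset.count_eq_zero_of_notMem ht]
      exact Nat.zero_le _
  · refine Finset.mem_image.2 ⟨(M.sum.1, α), ?_, rfl⟩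
    rw [Finset.HasAntidiagonal.mem_antidiagonal, ← h1]
    rfl

/-- The finite set of the families of `IsFam`. -/
def fams (θ : Triple) : Finset (Multiset Triple × Part) := (finite_isFam θ).toFinset

lemma mem_fams {θ : Triple} {q : Multiset Triple × Part} : q ∈ fams θ ↔ IsFam θ q := by
  simp [fams]

/-- The coefficient at `θ` of the exponential of the generating function of `h`, times the
generating function of `1 / z_α`. -/
def expWeight (h : Triple → ℂ) (θ : Triple) : ℂ :=
  ∑ q ∈ fams θ, famWeight h q.1 * (zee q.2 : ℂ)⁻¹

lemma size_sum_eq (M : Multiset Triple) :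
    size M.sum.2.1 = ∑ t ∈ M.toFinset, M.count t * size t.2.1 := by
  have h : size M.sum.2.1 = (M.map fun t => size t.2.1).sum := by
    induction M using Multiset.induction_on with
    | empty => simp [size]
    | cons t M ih =>
      rw [Multiset.sum_cons, Prod.snd_add, Prod.fst_add, size_add, ih, Multiset.map_cons,
        Multiset.sum_cons]
  rw [h, Finset.sum_multiset_map_count]
  rfl

/-- Marking a member of the family. -/
lemma size_mul_expWeight (h : Triple → ℂ) (θ : Triple) :
    (size θ.2.1 : ℂ) * expWeight h θ =
      ∑ q ∈ splits θ, (size q.1.2.1 : ℂ) * (h q.1 * expWeight h q.2) := by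
  have h1 : ∀ q ∈ fams θ, (size θ.2.1 : ℂ) * (famWeight h q.1 * (zee q.2 : ℂ)⁻¹) =
      ∑ t ∈ q.1.toFinset, (size t.2.1 : ℂ) *
        (h t * (famWeight h (q.1.erase t) * (zee q.2 : ℂ)⁻¹)) := by
    intro q hq
    have h2 : size θ.2.1 = size q.1.sum.2.1 := by
      rw [← (mem_fams.1 hq).1]
      simp
    rw [h2, size_sum_eq, Nat.cast_sum, Finset.sum_mul]
    refine Finset.sum_congr rfl fun t ht => ?_
    have h3 := count_mul_famWeight h t (q.1.erase t)
    rw [Multiset.cons_erase (Multiset.mem_toFinset.1 ht)] at h3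
    rw [Nat.cast_mul]
    linear_combination (size t.2.1 : ℂ) * (zee q.2 : ℂ)⁻¹ * h3
  have h4 : ∑ q ∈ splits θ, (size q.1.2.1 : ℂ) * (h q.1 * expWeight h q.2) =
      ∑ q ∈ (splits θ).filter (fun q => 1 ≤ size q.1.2.1),
        (size q.1.2.1 : ℂ) * (h q.1 * expWeight h q.2) := by
    symm
    refine Finset.sum_filter_of_ne fun q _ hq => ?_
    by_contra h5
    apply hq
    rw [show size q.1.2.1 = 0 by omega, Nat.cast_zero, zero_mul]
  rw [h4, expWeight, Finset.mul_sum, Finset.sum_congr rfl h1]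
  simp only [expWeight, Finset.mul_sum]
  rw [Finset.sum_sigma', Finset.sum_sigma']
  refine Finset.sum_bij'
    (fun x _ => ⟨(x.2, (x.1.1.erase x.2).sum + (x.1.2, 0, x.1.2)), (x.1.1.erase x.2, x.1.2)⟩)
    (fun y _ => ⟨(y.1.1 ::ₘ y.2.1, y.2.2), y.1.1⟩) ?_ ?_ ?_ ?_ ?_
  · rintro ⟨⟨M, α⟩, t⟩ hx
    simp only [Finset.mem_sigma, Multiset.mem_toFinset, mem_fams, Finset.mem_filter,
      mem_splits] at hx ⊢
    obtain ⟨⟨hx1, hx2⟩, ht⟩ := hx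
    dsimp only at hx1 hx2
    refine ⟨⟨?_, hx2 t ht⟩, rfl, fun u hu => hx2 u (Multiset.mem_of_mem_erase hu)⟩
    rw [← add_assoc, ← Multiset.sum_cons, Multiset.cons_erase ht, hx1]
  · rintro ⟨⟨t, s⟩, M, α⟩ hy
    simp only [Finset.mem_sigma, Multiset.mem_toFinset, mem_fams, Finset.mem_filter,
      mem_splits] at hy ⊢
    obtain ⟨⟨hy1, hy2⟩, hy3, hy4⟩ := hy
    dsimp only at hy3 hy4
    refine ⟨⟨?_, fun u hu => ?_⟩, Multiset.mem_cons_self _ _⟩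
    · rw [Multiset.sum_cons, add_assoc, hy3, hy1]
    · rcases Multiset.mem_cons.1 hu with rfl | hu
      · exact hy2
      · exact hy4 u hu
  · rintro ⟨⟨M, α⟩, t⟩ hx
    simp only [Finset.mem_sigma, Multiset.mem_toFinset] at hx
    simp only [Multiset.cons_erase hx.2]
  · rintro ⟨⟨t, s⟩, M, α⟩ hy
    simp only [Finset.mem_sigma, mem_fams] at hy
    have := hy.2.1
    dsimp only at this
    simp only [Multiset.erase_cons_head, this]
  · rintro ⟨⟨M, α⟩, t⟩ _
    rfl

lemma expWeight_of_size_eq_zero (h : Triple → ℂ) {θ : Triple} (hθ : size θ.2.1 = 0) :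
    expWeight h θ = if θ.1 = θ.2.2 then (zee θ.1 : ℂ)⁻¹ else 0 := by
  have h0 : θ.2.1 = 0 := size_eq_zero hθ
  have h1 : fams θ = if θ.1 = θ.2.2 then {(0, θ.1)} else ∅ := by
    ext ⟨M, α⟩
    rw [mem_fams, IsFam]
    have hM : M.sum + (α, 0, α) = θ → (∀ t ∈ M, 1 ≤ size t.2.1) → M = 0 := by
      intro h1 h2
      have := card_le_size_sum h2
      rw [← h1] at hθ
      simp only [Prod.snd_add, Prod.fst_add, add_zero] at hθ
      rw [hθ, Nat.le_zero] at this
      exact Multiset.card_eq_zero.1 this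
    split_ifs with h
    · rw [Finset.mem_singleton]
      constructor
      · rintro ⟨h1, h2⟩
        have h3 := hM h1 h2
        dsimp only at h1
        refine Prod.ext h3 ?_
        rw [← h1, h3]
        simp
      · intro he
        obtain ⟨rfl, rfl⟩ := Prod.mk.inj he
        refine ⟨?_, fun t ht => absurd ht (Multiset.notMem_zero _)⟩
        exact Prod.ext (by simp) (Prod.ext (by simp [h0]) (by simp [h]))
    · refine iff_of_false (fun h1 => h ?_) (Finset.notMem_empty _)
      have h3 := hM h1.1 h1.2
      have h4 := h1.1
      dsimp only at h4
      rw [← h4, h3]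
      simp
  rw [expWeight, h1]
  split_ifs
  · simp [famWeight, autM]
  · simp

lemma pairWeight_of_size_eq_zero {θ : Triple} (hθ : size θ.2.1 = 0) :
    pairWeight θ = if θ.1 = θ.2.2 then (zee θ.1 : ℂ)⁻¹ else 0 := by
  rw [pairWeight, size_eq_zero hθ, transCount_zero, std_type]
  split_ifs <;> simp

/-- The exponential formula: by induction on `|Δ|`, since both sides satisfy the same recursion. -/
theorem pairWeight_eq_expWeight (θ : Triple) : pairWeight θ = expWeight connWeight θ := by
  induction hn : size θ.2.1 using Nat.strong_induction_on generalizing θ with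
  | _ n ih =>
    subst hn
    by_cases h0 : size θ.2.1 = 0
    · rw [pairWeight_of_size_eq_zero h0, expWeight_of_size_eq_zero _ h0]
    · refine mul_left_cancel₀ (Nat.cast_ne_zero.2 h0 : (size θ.2.1 : ℂ) ≠ 0) ?_
      rw [size_mul_pairWeight, size_mul_expWeight]
      refine Finset.sum_congr rfl fun q hq => ?_
      rw [mem_splits] at hq
      by_cases h1 : size q.1.2.1 = 0
      · rw [h1, Nat.cast_zero, zero_mul, zero_mul]
      · have h2 : size θ.2.1 = size q.1.2.1 + size q.2.2.1 := by
          rw [← hq]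
          exact size_add _ _
        rw [ih _ (by omega) q.2 rfl]

/-! ### Transitive pairs and connected coverings -/

lemma sum_pairs {V : Type*} [Fintype V] [DecidableEq V] {S : Finset ℕ+} (e : V ≃ {i // i ∈ S})
    (f : PPerm × PPerm → ℕ) :
    ∑ p ∈ pairs S, f p = ∑ s : Equiv.Perm V, ∑ x ∈ PPerm.within S, f (ofPerm e s, x) := by
  rw [← Finset.sum_product']
  symm
  refine Finset.sum_bij (fun q _ => (ofPerm e q.1, q.2)) (fun q hq => ?_) (fun q _ q' _ h => ?_)
    (fun p hp => ?_) fun _ _ => rfl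
  · exact mem_pairs.2 ⟨rfl, PPerm.mem_within.1 (Finset.mem_product.1 hq).2⟩
  · exact Prod.ext (ofPerm_injective e (congrArg Prod.fst h)) (congrArg (fun r => r.2) h)
  · rw [mem_pairs] at hp
    obtain ⟨s, hs⟩ := exists_ofPerm e hp.1
    exact ⟨(s, p.2), Finset.mem_product.2 ⟨Finset.mem_univ _, PPerm.mem_within.2 hp.2⟩,
      Prod.ext hs rfl⟩

lemma isConn_mul_idOn {B : Finset ℕ+} {σ x : PPerm} :
    IsConn B (σ, x * PPerm.idOn B) ↔ IsConn B (σ, x) :=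
  ⟨isConn_congr (fun _ _ => rfl) fun _ _ => rfl, isConn_congr (fun _ _ => rfl) fun _ _ => rfl⟩

/-- The absence of proper invariant subsets is the transitivity of the generated group. -/
lemma isConn_ofPerm {V : Type*} [Fintype V] {S : Finset ℕ+} (e : V ≃ {i // i ∈ S})
    (s u : Equiv.Perm V) : IsConn S (ofPerm e s, ofPerm e u) ↔
      Nonempty V ∧ MulAction.IsPretransitive (Subgroup.closure {s, u, (s * u)⁻¹}) V := by
  have hne : S.Nonempty ↔ Nonempty V := by
    rw [← Finset.nonempty_coe_sort]
    exact e.nonempty_congr.symm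
  refine and_congr hne ⟨fun h => ⟨fun a b => ?_⟩, fun h C hC hCne h1 h2 => ?_⟩
  · -- the orbit of `a` is a non-empty invariant set
    let C : Finset ℕ+ := (Finset.univ.filter fun b => ∃ g : Subgroup.closure {s, u, (s * u)⁻¹},
      g • a = b).image fun v => (e v : ℕ+)
    have hinv : ∀ w ∈ ({s, u, (s * u)⁻¹} : Set (Equiv.Perm V)), ∀ i ∈ C,
        (ofPerm e w).perm i ∈ C := by
      intro w hw i hi
      obtain ⟨v, hv, rfl⟩ := Finset.mem_image.1 hi
      obtain ⟨g, rfl⟩ := (Finset.mem_filter.1 hv).2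
      rw [ofPerm_perm_apply]
      exact Finset.mem_image.2 ⟨_, Finset.mem_filter.2 ⟨Finset.mem_univ _,
        ⟨w, Subgroup.subset_closure hw⟩ * g, rfl⟩, rfl⟩
    have hC : C = S := by
      refine h C (fun i hi => ?_) ?_ (hinv s (by simp)) (hinv u (by simp))
      · obtain ⟨v, -, rfl⟩ := Finset.mem_image.1 hi
        exact (e v).2
      · exact ⟨e a, Finset.mem_image.2 ⟨a, Finset.mem_filter.2 ⟨Finset.mem_univ _, 1, one_smul _ _⟩,
          rfl⟩⟩
    have hb : (e b : ℕ+) ∈ C := by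
      rw [hC]
      exact (e b).2
    obtain ⟨v, hv, hvb⟩ := Finset.mem_image.1 hb
    rw [← e.injective (Subtype.ext hvb)]
    exact (Finset.mem_filter.1 hv).2
  · have key : ∀ g ∈ Subgroup.closure {s, u, (s * u)⁻¹}, ∀ v : V,
        (e (g v) : ℕ+) ∈ C ↔ (e v : ℕ+) ∈ C := by
      have hs : ∀ v : V, (e (s v) : ℕ+) ∈ C ↔ (e v : ℕ+) ∈ C := fun v => by
        rw [← mapsTo_iff h1 (e v), ofPerm_perm_apply]
      have hu : ∀ v : V, (e (u v) : ℕ+) ∈ C ↔ (e v : ℕ+) ∈ C := fun v => by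
        rw [← mapsTo_iff h2 (e v), ofPerm_perm_apply]
      intro g hg
      induction hg using Subgroup.closure_induction with
      | mem x hx =>
        rcases hx with rfl | rfl | rfl
        · exact hs
        · exact hu
        · intro v
          rw [← hu, ← hs, ← Equiv.Perm.mul_apply, ← Equiv.Perm.mul_apply, mul_inv_cancel]
          rfl
      | one => exact fun v => Iff.rfl
      | mul x y _ _ hx hy =>
        intro v
        rw [Equiv.Perm.mul_apply, hx, hy]
      | inv x _ hx =>
        intro v
        rw [← hx, ← Equiv.Perm.mul_apply, mul_inv_cancel]
        rfl
    refine Finset.Subset.antisymm hC fun j hj => ?_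
    obtain ⟨c, hc⟩ := hCne
    obtain ⟨a, ha⟩ := e.surjective ⟨c, hC hc⟩
    obtain ⟨b, hb⟩ := e.surjective ⟨j, hj⟩
    obtain ⟨g, hg⟩ := h.exists_smul_eq a b
    have h3 : (e b : ℕ+) ∈ C := by
      rw [← hg]
      exact (key g.1 g.2 a).2 (by rw [ha]; exact hc)
    rwa [hb] at h3

lemma card_connCover {k : ℕ} {Γ' Δ Γ : Part} (h1 : size Γ' = k) (h3 : size Γ = k) :
    Nat.card (ConnCover k Γ' Δ Γ) =
      (Finset.univ.filter fun q : Equiv.Perm (Fin k) × Equiv.Perm (Fin k) =>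
        cycType q.1 = Γ' ∧ cycType q.2 = shift k Δ ∧ cycType (q.2 * q.1) = Γ ∧
          IsConn (full k) (ofPerm (finEquiv k) q.1, ofPerm (finEquiv k) q.2)).card := by
  rw [← Fintype.card_subtype, ← Nat.card_eq_fintype_card]
  refine Nat.card_congr
    { toFun := fun s => ⟨(s.1.1, s.1.2.1), ?_⟩
      invFun := fun q => ⟨(q.1.1, q.1.2, (q.1.1 * q.1.2)⁻¹), ?_⟩
      left_inv := fun s => Subtype.ext (Prod.ext rfl (Prod.ext rfl
        (inv_eq_of_mul_eq_one_right s.2.2.1)))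
      right_inv := fun q => rfl }
  · obtain ⟨⟨a, b, c⟩, h0, habc, ha, hb, hc, ht⟩ := s
    dsimp only at habc ha hb hc ht ⊢
    have hc' : (a * b)⁻¹ = c := inv_eq_of_mul_eq_one_right habc
    rw [shift_of_size h1] at ha
    rw [shift_of_size h3] at hc
    refine ⟨ha, hb, ?_, ?_⟩
    · rw [cycType_mul_comm, ← cycType_inv, hc', hc]
    · rw [isConn_ofPerm, hc']
      exact ⟨⟨⟨0, h0⟩⟩, ht⟩
  · obtain ⟨⟨a, b⟩, ha, hb, hc, ht⟩ := q
    dsimp only at ha hb hc ht ⊢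
    rw [isConn_ofPerm] at ht
    refine ⟨Fin.pos_iff_nonempty.2 ht.1, mul_inv_cancel _, ?_, hb, ?_, ht.2⟩
    · rw [shift_of_size h1, ha]
    · rw [shift_of_size h3, cycType_inv, cycType_mul_comm, hc]

lemma choose_self_of_size {k : ℕ} {Γ : Part} (h : size Γ = k) :
    ((k - size Γ + Γ 1).choose (Γ 1) : ℂ) = 1 := by
  simp [h]

/-- The numbers `h` of the exponential formula are the connected Hurwitz numbers. -/
lemma connWeight_eq (t : Triple) : connWeight t =
    (if size t.2.2 = size t.1 then 1 else 0) * connHurwitz (size t.1) t.1 t.2.1 t.2.2 := by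
  obtain ⟨Γ', Δ, Γ⟩ := t
  dsimp only
  have hfilter : ∀ p ∈ connPairs (full (size Γ')), pairType p = (Γ', Δ, Γ) →
      size Γ = size Γ' ∧ size Δ ≤ size Γ' := by
    intro p hp hpt
    obtain ⟨hp1, hp2⟩ := mem_pairs.1 (Finset.mem_filter.1 hp).1
    simp only [pairType, Prod.mk.injEq] at hpt
    constructor
    · rw [← hpt.2.2, ← PPerm.card_supp, PPerm.supp_mul, hp1, Finset.union_eq_right.2 hp2, card_full]
    · have := Finset.card_le_card hp2
      rwa [PPerm.card_supp, hpt.2.1, card_full] at this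
  have hzero : ¬ (size Γ = size Γ' ∧ size Δ ≤ size Γ') → connWeight (Γ', Δ, Γ) = 0 := by
    intro h
    rw [connWeight, connCount, Finset.filter_eq_empty_iff.2 fun p hp hpt => h (hfilter p hp hpt)]
    simp
  by_cases hΓ : size Γ = size Γ'
  swap
  · rw [if_neg hΓ, zero_mul, hzero fun h => hΓ h.1]
  rw [if_pos hΓ, one_mul]
  by_cases hΔ : size Δ ≤ size Γ'
  swap
  · rw [hzero fun h => hΔ h.2]
    have : IsEmpty (ConnCover (size Γ') Γ' Δ Γ) := by
      refine ⟨fun s => hΔ ?_⟩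
      have h := congrArg size s.2.2.2.2.1
      rw [size_cycType, Fintype.card_fin, shift, size_add] at h
      omega
    rw [connHurwitz, Nat.card_of_isEmpty]
    simp
  have hcount : connCount (full (size Γ')) (Γ', Δ, Γ) =
      (size Γ' - size Δ + Δ 1).choose (Δ 1) * Nat.card (ConnCover (size Γ') Γ' Δ Γ) := by
    have h1 : connCount (full (size Γ')) (Γ', Δ, Γ) = ∑ p ∈ pairs (full (size Γ')),
        if IsConn (full (size Γ')) p ∧ pairType p = (Γ', Δ, Γ) then 1 else 0 := by
      rw [connCount, connPairs, Finset.filter_filter, Finset.card_filter]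
    rw [h1, sum_pairs (finEquiv (size Γ')), card_connCover rfl hΓ, Finset.card_filter,
      ← Finset.univ_product_univ, Finset.sum_product, Finset.mul_sum]
    refine Finset.sum_congr rfl fun s _ => ?_
    have h2 := sum_within_type (finEquiv (size Γ')) (Δ := Δ) (by rwa [card_full]) fun y =>
      if cycType s = Γ' ∧ (y * ofPerm (finEquiv _) s).type = Γ ∧
        IsConn (full (size Γ')) (ofPerm (finEquiv _) s, y) then 1 else 0
    rw [card_full, smul_eq_mul, Finset.sum_filter, Finset.sum_filter] at h2
    refine Eq.trans ?_ (h2.trans ?_)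
    · refine Finset.sum_congr rfl fun x _ => ?_
      rw [isConn_mul_idOn, ← mul_ofPerm, ← ite_and]
      refine if_congr ?_ rfl rfl
      simp only [pairType, type_ofPerm, Prod.mk.injEq]
      tauto
    · congr 1
      refine Finset.sum_congr rfl fun u _ => ?_
      rw [← ite_and, ofPerm_mul, type_ofPerm]
      refine if_congr ?_ rfl rfl
      tauto
  rw [connWeight, hcount, connHurwitz, choose_self_of_size rfl, choose_self_of_size hΓ]
  push_cast
  ring

/-! ### The coefficients of the operators -/

lemma len_add (Δ Γ : Part) : len (Δ + Γ) = len Δ + len Γ :=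
  Finsupp.sum_add_index' (by simp) (by intros; rfl)

/-- The partitions of `n`. -/
def partsOf (n : ℕ) : Finset Part := (finite_size_le n).toFinset.filter fun Γ => size Γ = n

@[simp] lemma mem_partsOf {n : ℕ} {Γ : Part} : Γ ∈ partsOf n ↔ size Γ = n := by
  simp only [partsOf, Finset.mem_filter, Set.Finite.mem_toFinset, Set.mem_ofPred_eq,
    and_iff_right_iff_imp]
  exact fun h => h.le

/-- The numerical factor produced by `∂/∂p_α` on `p_{β + α}`. -/
def derivFactor (β α : Part) : ℕ := ∏ i ∈ α.support, (β i + α i).descFactorial (α i)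

lemma zee_add (β α : Part) : zee (β + α) = zee β * (rowProd α * derivFactor β α) := by
  have h : (β + α).prod (fun _ m => m !) = β.prod (fun _ m => m !) * derivFactor β α := by
    have hsub : α.support ⊆ (β + α).support := fun i hi => by
      rw [Finsupp.mem_support_iff] at hi ⊢
      rw [Finsupp.add_apply]
      omega
    have hsub' : β.support ⊆ (β + α).support := fun i hi => by
      rw [Finsupp.mem_support_iff] at hi ⊢
      rw [Finsupp.add_apply]
      omega
    have h1 : derivFactor β α = ∏ i ∈ (β + α).support, (β i + α i).descFactorial (α i) := by
      refine Finset.prod_subset hsub fun i _ hi => ?_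
      rw [Finsupp.notMem_support_iff.1 hi, Nat.descFactorial_zero]
    have h2 : β.prod (fun _ m => m !) = ∏ i ∈ (β + α).support, (β i)! := by
      refine Finset.prod_subset hsub' fun i _ hi => ?_
      rw [Finsupp.notMem_support_iff.1 hi]
      exact Nat.factorial_zero
    rw [h1, h2, ← Finset.prod_mul_distrib]
    refine Finset.prod_congr rfl fun i _ => ?_
    have := Nat.factorial_mul_descFactorial (Nat.le_add_left (α i) (β i))
    rw [Nat.add_sub_cancel] at this
    rw [Finsupp.add_apply, this]
  rw [zee, zee, rowProd_add, h]
  ring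

section Coefficients

variable {R : Type*} [CommRing R]

lemma coeff_pderiv_pow (i : ℕ+) (m : ℕ) (β : Part) (f : MvPowerSeries ℕ+ R) :
    MvPowerSeries.coeff β ((((MvPowerSeries.pderiv R i : Derivation R _ _) :
      Module.End R (MvPowerSeries ℕ+ R)) ^ m) f) =
      ((β i + m).descFactorial m : R) * MvPowerSeries.coeff (β + Finsupp.single i m) f := by
  induction m generalizing β with
  | zero => simp
  | succ m ih =>
    rw [pow_succ', Module.End.mul_apply]
    change MvPowerSeries.coeff β (MvPowerSeries.pderiv R i _) = _
    rw [MvPowerSeries.coeff_pderiv, ih, Finsupp.add_apply, Finsupp.single_eq_same, add_assoc β,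
      ← Finsupp.single_add, add_comm 1 m, Nat.descFactorial_succ,
      show β i + 1 + m = β i + m + 1 by ring, ← add_assoc (β i), show β i + m + 1 - m = β i + 1 by omega]
    push_cast
    ring

lemma coeff_noncommProd_pderiv (s : Finset ℕ+) (α β : Part) (f : MvPowerSeries ℕ+ R)
    (hc : (s : Set ℕ+).Pairwise (Function.onFun Commute fun i =>
      ((MvPowerSeries.pderiv R i : Derivation R _ _) :
        Module.End R (MvPowerSeries ℕ+ R)) ^ α i)) :
    MvPowerSeries.coeff β (s.noncommProd
      (fun i => ((MvPowerSeries.pderiv R i : Derivation R _ _) :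
        Module.End R (MvPowerSeries ℕ+ R)) ^ α i) hc f) =
      ((∏ i ∈ s, (β i + α i).descFactorial (α i) : ℕ) : R) *
        MvPowerSeries.coeff (β + ∑ i ∈ s, Finsupp.single i (α i)) f := by
  induction s using Finset.induction_on generalizing β with
  | empty => simp [Finset.noncommProd_empty]
  | insert a s ha ih =>
    rw [Finset.noncommProd_insert_of_notMem _ _ _ _ ha, Module.End.mul_apply, coeff_pderiv_pow, ih,
      Finset.prod_insert ha, Finset.sum_insert ha, ← add_assoc, Nat.cast_mul, mul_assoc]
    congr 3
    refine Finset.prod_congr rfl fun i hi => ?_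
    rw [Finsupp.add_apply, Finsupp.single_eq_of_ne (by rintro rfl; exact ha hi), add_zero]

lemma coeff_partialP (α β : Part) (f : MvPowerSeries ℕ+ R) :
    MvPowerSeries.coeff β (partialP α f) =
      (derivFactor β α : R) * MvPowerSeries.coeff (β + α) f := by
  have h : ∑ i ∈ α.support, Finsupp.single i (α i) = α := Finsupp.sum_single α
  refine (coeff_noncommProd_pderiv α.support α β f _).trans ?_
  rw [h]
  rfl

variable [Algebra ℂ R]

lemma Family.sum_eq {Δ : Part} (M : Family Δ) : M.1.sum = (M.src, Δ, M.tgt) := by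
  have h1 := map_multiset_sum (AddMonoidHom.fst Part (Part × Part)) M.1
  have h2 := map_multiset_sum
    ((AddMonoidHom.fst Part Part).comp (AddMonoidHom.snd Part (Part × Part))) M.1
  have h3 := map_multiset_sum
    ((AddMonoidHom.snd Part Part).comp (AddMonoidHom.snd Part (Part × Part))) M.1
  exact Prod.ext h1 (Prod.ext (h2.trans M.2.1) h3)

lemma rowProd_sum (M : Multiset Triple) :
    rowProd (M.map fun t => t.1).sum = (M.map fun t => rowProd t.1).prod := by
  induction M using Multiset.induction_on with
  | empty => simp [rowProd]
  | cons t M ih =>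
    rw [Multiset.map_cons, Multiset.sum_cons, rowProd_add, ih, Multiset.map_cons,
      Multiset.prod_cons]

lemma Family.coef_eq {Δ : Part} (M : Family Δ) :
    M.coef = (rowProd M.src : ℂ) * famWeight connWeight M.1 := by
  have h1 : M.autCard = autM M.1 := rfl
  have h2 : (rowProd M.src : ℂ) = (M.1.map fun t => (rowProd t.1 : ℂ)).prod := by
    rw [src, rowProd_sum, ← Nat.coe_castRingHom, map_multiset_prod, Multiset.map_map]
    rfl
  have h3 : (M.1.map fun t => (rowProd t.1 : ℂ) * (if size t.2.2 = size t.1 then 1 else 0) *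
      connHurwitz (size t.1) t.1 t.2.1 t.2.2).prod =
      (M.1.map fun t => (rowProd t.1 : ℂ)).prod * (M.1.map connWeight).prod := by
    rw [← Multiset.prod_map_mul]
    congr 1
    refine Multiset.map_congr rfl fun t _ => ?_
    rw [connWeight_eq, mul_assoc]
  rw [coef, h1, h2, h3, famWeight]
  ring

lemma Family.coeff_op {Δ : Part} (M : Family Δ) (z : Rˣ) (Γ : Part) (f : MvPowerSeries ℕ+ R) :
    MvPowerSeries.coeff Γ (M.op z f) = if M.tgt ≤ Γ then
      ((z ^ ((size Δ : ℤ) - len Δ + len M.src - len M.tgt) : Rˣ) : R) * algebraMap ℂ R M.coef *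
        ((derivFactor (Γ - M.tgt) M.src : R) *
          MvPowerSeries.coeff (Γ - M.tgt + M.src) f) else 0 := by
  rw [op, LinearMap.smul_apply, map_smul, normalOp, Module.End.mul_apply,
    LinearMap.mulLeft_apply, MvPowerSeries.coeff_monomial_mul, coeff_partialP, smul_eq_mul]
  split_ifs
  · rw [one_mul]
  · rw [mul_zero]

/-- The term of a family in `W(Δ, z)` is its term in the exponential formula: the factor
`‖Γ'‖` together with the one produced by the derivatives is `z_{Γ'} / z_α`. -/
lemma Family.coeff_op_eq {Δ : Part} (M : Family Δ) (z : Rˣ) {Γ' Γ α : Part}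
    (h : M.1.sum + (α, 0, α) = (Γ', Δ, Γ)) (f : MvPowerSeries ℕ+ R) :
    MvPowerSeries.coeff Γ (M.op z f) =
      ((z ^ ((size Δ : ℤ) - len Δ + len Γ' - len Γ) : Rˣ) : R) *
        algebraMap ℂ R ((zee Γ' : ℂ) * (famWeight connWeight M.1 * (zee α : ℂ)⁻¹)) *
          MvPowerSeries.coeff Γ' f := by
  rw [M.sum_eq] at h
  have h1 : α + M.src = Γ' := (add_comm _ _).trans (congrArg Prod.fst h)
  have h3 : M.tgt + α = Γ := congrArg (fun t : Triple => t.2.2) h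
  subst h1 h3
  rw [M.coeff_op, if_pos le_self_add, add_tsub_cancel_left, zee_add, M.coef_eq, len_add, len_add]
  have hz : (zee α : ℂ) ≠ 0 := Nat.cast_ne_zero.2 (zee_ne_zero α)
  have h4 : ((zee α * (rowProd M.src * derivFactor α M.src) : ℕ) : ℂ) *
      (famWeight connWeight M.1 * (zee α : ℂ)⁻¹) =
      (rowProd M.src : ℂ) * famWeight connWeight M.1 * (derivFactor α M.src : ℂ) := by
    push_cast
    field_simp
  rw [h4, map_mul (algebraMap ℂ R) _ (derivFactor α M.src : ℂ), map_natCast]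
  have h5 : (size Δ : ℤ) - len Δ + (len α + len M.src : ℕ) - (len M.tgt + len α : ℕ) =
      (size Δ : ℤ) - len Δ + len M.src - len M.tgt := by
    push_cast
    ring
  rw [h5]
  ring

lemma Family.size_src_eq {Δ : Part} {M : Family Δ} (h : M.coef ≠ 0) : size M.tgt = size M.src := by
  have heq : ∀ t ∈ M.1, size t.2.2 = size t.1 := by
    intro t ht
    by_contra h'
    apply h
    rw [coef, Multiset.prod_eq_zero, mul_zero]
    exact Multiset.mem_map.2 ⟨t, ht, by simp [h']⟩
  have key : ∀ N : Multiset Triple, (∀ t ∈ N, size t.2.2 = size t.1) →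
      size (N.map fun t => t.2.2).sum = size (N.map fun t => t.1).sum := by
    intro N
    induction N using Multiset.induction_on with
    | empty => simp
    | cons t N ih =>
      intro hN
      rw [Multiset.map_cons, Multiset.map_cons, Multiset.sum_cons, Multiset.sum_cons, size_add,
        size_add, hN t (Multiset.mem_cons_self _ _),
        ih fun u hu => hN u (Multiset.mem_cons_of_mem hu)]
  exact key M.1 heq

/-- The matrix of `W(Δ, z)` in the monomials `p_Γ`: up to a power of `z`, the operator sends the
monomial of the cycle type of a permutation `σ` to the sum of the monomials of the cycle types
of `x σ` over the partial permutations `x` of cycle type `Δ`. -/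
theorem coeff_W (Δ : Part) (z : Rˣ) (Γ : Part) (f : MvPowerSeries ℕ+ R) :
    MvPowerSeries.coeff Γ (W Δ z f) = ∑ Γ' ∈ partsOf (size Γ),
      ((z ^ ((size Δ : ℤ) - len Δ + len Γ' - len Γ) : Rˣ) : R) *
        (transCount Δ (std Γ') Γ : R) * MvPowerSeries.coeff Γ' f := by
  have h1 : ∀ Γ' ∈ partsOf (size Γ),
      ((z ^ ((size Δ : ℤ) - len Δ + len Γ' - len Γ) : Rˣ) : R) *
        (transCount Δ (std Γ') Γ : R) * MvPowerSeries.coeff Γ' f =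
      ∑ q ∈ fams (Γ', Δ, Γ), ((z ^ ((size Δ : ℤ) - len Δ + len Γ' - len Γ) : Rˣ) : R) *
        algebraMap ℂ R ((zee Γ' : ℂ) * (famWeight connWeight q.1 * (zee q.2 : ℂ)⁻¹)) *
          MvPowerSeries.coeff Γ' f := by
    intro Γ' _
    rw [← Finset.sum_mul, ← Finset.mul_sum, ← map_sum, ← Finset.mul_sum]
    have h2 := pairWeight_eq_expWeight (Γ', Δ, Γ)
    rw [expWeight] at h2
    rw [← h2, pairWeight, mul_div_cancel₀ _ (Nat.cast_ne_zero.2 (zee_ne_zero _)), map_natCast]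
  rw [Finset.sum_congr rfl h1, Finset.sum_sigma']
  change ∑ᶠ M : Family Δ, MvPowerSeries.coeff Γ (M.op z f) = _
  have hfin := Family.finite_contrib (Δ := Δ) z Γ
  rw [finsum_eq_sum_of_support_subset (s := hfin.toFinset) _ fun M hM => by
    rw [Set.Finite.coe_toFinset]
    exact ⟨f, hM⟩]
  have hle : ∀ M : Family Δ, MvPowerSeries.coeff Γ (M.op z f) ≠ 0 → M.tgt ≤ Γ := by
    intro M hM
    by_contra h
    rw [M.coeff_op, if_neg h] at hM
    exact hM rfl
  have hsum : ∀ M : Family Δ, M.tgt ≤ Γ →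
      M.1.sum + (Γ - M.tgt, 0, Γ - M.tgt) = (Γ - M.tgt + M.src, Δ, Γ) := by
    intro M hM
    rw [M.sum_eq]
    exact Prod.ext (add_comm _ _) (Prod.ext (add_zero _) (add_tsub_cancel_of_le hM))
  refine Finset.sum_bij_ne_zero
    (fun M _ _ => ⟨Γ - M.tgt + M.src, (M.1, Γ - M.tgt)⟩) (fun M _ hM => ?_)
    (fun M _ _ N _ _ h => ?_) (fun y hy hy0 => ?_) fun M _ hM => ?_
  · rw [Finset.mem_sigma, mem_partsOf, mem_fams]
    refine ⟨?_, hsum M (hle M hM), M.2.2⟩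
    have hcoef : M.coef ≠ 0 := by
      intro h
      rw [M.coeff_op, h] at hM
      simp at hM
    rw [size_add, ← Family.size_src_eq hcoef, ← size_add, tsub_add_cancel_of_le (hle M hM)]
  · simp only [Sigma.mk.injEq, heq_eq_eq, Prod.mk.injEq] at h
    exact Subtype.ext h.2.1
  · obtain ⟨Γ', N, α⟩ := y
    rw [Finset.mem_sigma, mem_fams] at hy
    obtain ⟨-, hy1, hy2⟩ := hy
    dsimp only at hy1 hy2
    have hN : (N.map fun t => t.2.1).sum = Δ := by
      have h2 := map_multiset_sum
        ((AddMonoidHom.fst Part Part).comp (AddMonoidHom.snd Part (Part × Part))) N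
      have h3 := congrArg (fun t : Triple => t.2.1) hy1
      exact h2.symm.trans ((add_zero _).symm.trans h3)
    let M : Family Δ := ⟨N, hN, hy2⟩
    have hM : MvPowerSeries.coeff Γ (M.op z f) ≠ 0 := by
      rw [M.coeff_op_eq z hy1]
      exact hy0
    refine ⟨M, hfin.mem_toFinset.2 ⟨f, hM⟩, hM, ?_⟩
    have h4 : M.1.sum + (α, 0, α) = (Γ', Δ, Γ) := hy1
    rw [M.sum_eq] at h4
    have h5 : M.src + α = Γ' := congrArg Prod.fst h4
    have h6 : M.tgt + α = Γ := congrArg (fun t : Triple => t.2.2) h4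
    subst h5 h6
    rw [add_tsub_cancel_left, add_comm α]
  · exact M.coeff_op_eq z (hsum M (hle M hM)) f

end Coefficients

/-! ### Products of the operators -/

lemma classSum_eq (Δ : Part) (n : ℕ) : classSum Δ n =
    ∑ x ∈ (PPerm.within (full n)).filter (fun x => x.type = Δ), MonoidAlgebra.of ℂ PPerm x := by
  rw [classSum]
  refine Finset.sum_congr ?_ fun _ _ => rfl
  ext x
  simp [isIn_iff]

/-- The structure constants count the factorizations of a partial permutation. -/
lemma coeff_classSum_mul (Δ₁ Δ₂ : Part) {n : ℕ} {w : PPerm} (hw : w.supp ⊆ full n) :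
    (classSum Δ₁ n * classSum Δ₂ n).coeff w = structConst Δ₁ Δ₂ w.type := by
  have h1 : A Δ₁ * A Δ₂ = ∑ Δ ∈ (structConst Δ₁ Δ₂).support, structConst Δ₁ Δ₂ Δ • A Δ := by
    conv_lhs => rw [← basisA.linearCombination_repr (A Δ₁ * A Δ₂)]
    rw [Finsupp.linearCombination_apply, Finsupp.sum]
    simp only [basisA_apply]
    rfl
  have h2 := sum_A_coe (structConst Δ₁ Δ₂).support (structConst Δ₁ Δ₂) n w (isIn_iff.2 hw)
  rw [← h1] at h2
  refine h2.trans ?_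
  split_ifs with h
  · rfl
  · exact (Finsupp.notMem_support_iff.1 h).symm

lemma transCount_eq_sum (Δ : Part) (σ : PPerm) (Γ : Part) : transCount Δ σ Γ =
    ∑ x ∈ (PPerm.within σ.supp).filter (fun x => x.type = Δ),
      if (x * σ).type = Γ then 1 else 0 := by
  rw [transCount, ← Finset.filter_filter, Finset.card_filter]

lemma coeff_mul_eq_sum (Δ₁ Δ₂ : Part) (n : ℕ) (w : PPerm) :
    (classSum Δ₁ n * classSum Δ₂ n).coeff w =
      ∑ y ∈ (PPerm.within (full n)).filter (fun y => y.type = Δ₂),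
        ∑ x ∈ (PPerm.within (full n)).filter (fun x => x.type = Δ₁),
          if x * y = w then 1 else 0 := by
  rw [classSum_eq, classSum_eq, Finset.sum_mul_sum, Finset.sum_comm]
  simp only [← map_mul, MonoidAlgebra.coeff_sum, Finsupp.finsetSum_apply]
  refine Finset.sum_congr rfl fun y _ => Finset.sum_congr rfl fun x _ => ?_
  simp [Finsupp.single_apply]

/-- Composing the transition matrices amounts to multiplying in the algebra of partial
permutations. -/
lemma sum_transCount_mul (Δ₁ Δ₂ Γ : Part) {σ : PPerm} {n : ℕ} (hsupp : σ.supp = full n) :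
    ∑ Γ'' ∈ partsOf n, (transCount Δ₁ (std Γ'') Γ : ℂ) * transCount Δ₂ σ Γ'' =
      (structConst Δ₁ Δ₂).sum fun Δ₃ c => c * transCount Δ₃ σ Γ := by
  obtain ⟨D, hD⟩ : ∃ D : Finset PPerm, D = (PPerm.within (full n)).filter fun w =>
    (w * σ).type = Γ := ⟨_, rfl⟩
  have hL : ∑ w ∈ D, (classSum Δ₁ n * classSum Δ₂ n).coeff w =
      (structConst Δ₁ Δ₂).sum fun Δ₃ c => c * transCount Δ₃ σ Γ := by
    have h1 : ∀ w ∈ D, (classSum Δ₁ n * classSum Δ₂ n).coeff w =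
        ∑ Δ₃ ∈ (structConst Δ₁ Δ₂).support,
          structConst Δ₁ Δ₂ Δ₃ * if w.type = Δ₃ then 1 else 0 := by
      intro w hw
      rw [coeff_classSum_mul Δ₁ Δ₂ (PPerm.mem_within.1
        (Finset.mem_filter.1 (hD ▸ hw)).1)]
      simp
    rw [Finset.sum_congr rfl h1, Finset.sum_comm, Finsupp.sum]
    refine Finset.sum_congr rfl fun Δ₃ _ => ?_
    rw [← Finset.mul_sum, transCount, hsupp, Finset.sum_boole, hD, Finset.filter_filter]
    congr 3
    exact Finset.filter_congr fun w _ => and_comm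
  rw [← hL]
  rw [Finset.sum_congr rfl fun w _ => coeff_mul_eq_sum Δ₁ Δ₂ n w, Finset.sum_comm]
  have hy : ∀ y ∈ (PPerm.within (full n)).filter (fun y => y.type = Δ₂),
      ∑ w ∈ D, ∑ x ∈ (PPerm.within (full n)).filter (fun x => x.type = Δ₁),
          (if x * y = w then 1 else 0 : ℂ) =
        ∑ Γ'' ∈ partsOf n, (transCount Δ₁ (std Γ'') Γ : ℂ) *
          if (y * σ).type = Γ'' then 1 else 0 := by
    intro y hy
    have hys : (y * σ).supp = full n := by
      rw [PPerm.supp_mul, hsupp]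
      exact Finset.union_eq_right.2 (PPerm.mem_within.1 (Finset.mem_filter.1 hy).1)
    have hyn : (y * σ).type ∈ partsOf n := by
      rw [mem_partsOf, size_type, hys, card_full]
    simp only [mul_ite, mul_one, mul_zero, Finset.sum_ite_eq, if_pos hyn]
    rw [← transCount_congr (σ := y * σ) (std_type _).symm, transCount_eq_sum, hys, Finset.sum_comm,
      Nat.cast_sum]
    refine Finset.sum_congr rfl fun x hx => ?_
    rw [Finset.sum_ite_eq]
    have hxy : x * y ∈ D ↔ (x * (y * σ)).type = Γ := by
      rw [hD, Finset.mem_filter, PPerm.mem_within, mul_assoc, and_iff_right]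
      exact Finset.union_subset (PPerm.mem_within.1 (Finset.mem_filter.1 hx).1)
        (PPerm.mem_within.1 (Finset.mem_filter.1 hy).1)
    rw [if_congr hxy rfl rfl]
    split_ifs <;> simp
  rw [Finset.sum_congr rfl hy, Finset.sum_comm]
  refine Finset.sum_congr rfl fun Γ'' _ => ?_
  rw [← Finset.mul_sum, transCount_eq_sum Δ₂, hsupp, Nat.cast_sum]
  refine congrArg _ (Finset.sum_congr rfl fun y _ => ?_)
  rw [Nat.cast_ite, Nat.cast_one, Nat.cast_zero]

theorem W_mul_W {R : Type*} [CommRing R] [Algebra ℂ R] (z : Rˣ) (Δ₁ Δ₂ : Part) :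
    W Δ₁ z * W Δ₂ z = (structConst Δ₁ Δ₂).sum fun Δ₃ c =>
      (((z ^ (((size Δ₁ : ℤ) - len Δ₁) + ((size Δ₂ : ℤ) - len Δ₂) -
          ((size Δ₃ : ℤ) - len Δ₃)) : Rˣ) : R) * algebraMap ℂ R c) • W Δ₃ z := by
  refine LinearMap.ext fun f => MvPowerSeries.ext fun Γ => ?_
  rw [Finsupp.sum, LinearMap.sum_apply, map_sum, Module.End.mul_apply, coeff_W]
  simp only [LinearMap.smul_apply, map_smul, coeff_W, smul_eq_mul, Finset.mul_sum]
  rw [Finset.sum_comm]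
  have hsz : ∀ Γ'' ∈ partsOf (size Γ), partsOf (size Γ'') = partsOf (size Γ) := fun Γ'' h => by
    rw [mem_partsOf.1 h]
  rw [Finset.sum_comm' (t' := partsOf (size Γ)) (s' := fun _ => partsOf (size Γ))
    fun Γ'' Γ' => by
      constructor
      · rintro ⟨h1, h2⟩
        rw [hsz _ h1] at h2
        exact ⟨h1, h2⟩
      · rintro ⟨h1, h2⟩
        rw [hsz _ h1]
        exact ⟨h1, h2⟩]
  refine Finset.sum_congr rfl fun Γ' hΓ' => ?_
  have h := congrArg (algebraMap ℂ R) (sum_transCount_mul Δ₁ Δ₂ Γ (std_supp Γ'))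
  rw [mem_partsOf.1 hΓ', map_sum, Finsupp.sum, map_sum] at h
  simp only [map_mul, map_natCast] at h
  have hz : ∀ a b : ℤ, ((z ^ a : Rˣ) : R) * ((z ^ b : Rˣ) : R) = ((z ^ (a + b) : Rˣ) : R) :=
    fun a b => by rw [zpow_add, Units.val_mul]
  have hl : ∀ x ∈ partsOf (size Γ),
      ((z ^ ((size Δ₁ : ℤ) - len Δ₁ + len x - len Γ) : Rˣ) : R) * (transCount Δ₁ (std x) Γ : R) *
        (((z ^ ((size Δ₂ : ℤ) - len Δ₂ + len Γ' - len x) : Rˣ) : R) *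
          (transCount Δ₂ (std Γ') x : R) * MvPowerSeries.coeff Γ' f) =
      ((z ^ ((size Δ₁ : ℤ) - len Δ₁ + (size Δ₂ - len Δ₂) + len Γ' - len Γ) : Rˣ) : R) *
        MvPowerSeries.coeff Γ' f *
          ((transCount Δ₁ (std x) Γ : R) * (transCount Δ₂ (std Γ') x : R)) := by
    intro x _
    rw [show (size Δ₁ : ℤ) - len Δ₁ + (size Δ₂ - len Δ₂) + len Γ' - len Γ =
      ((size Δ₁ : ℤ) - len Δ₁ + len x - len Γ) + ((size Δ₂ : ℤ) - len Δ₂ + len Γ' - len x) by ring,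
      ← hz]
    ring
  rw [Finset.sum_congr rfl hl, ← Finset.mul_sum, h, Finset.mul_sum]
  refine Finset.sum_congr rfl fun x _ => ?_
  rw [show (size Δ₁ : ℤ) - len Δ₁ + (size Δ₂ - len Δ₂) + len Γ' - len Γ =
    ((size Δ₁ : ℤ) - len Δ₁ + ((size Δ₂ : ℤ) - len Δ₂) - ((size x : ℤ) - len x)) +
      ((size x : ℤ) - len x + len Γ' - len Γ) by ring, ← hz]
  ring

/-! ### Young symmetrizers -/

/-- The permutation of the cells preserves every row. -/
def IsRow {lam : YoungDiagram} (p : Equiv.Perm lam.cells) : Prop := ∀ c, (p c).1.1 = c.1.1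

/-- The permutation of the cells preserves every column. -/
def IsCol {lam : YoungDiagram} (q : Equiv.Perm lam.cells) : Prop := ∀ c, (q c).1.2 = c.1.2

/-- A rearrangement of a Young diagram with the same row and column sums is the diagram itself:
the function `(i, j) ↦ λᵢ + λ'ⱼ - i - j - 1` is positive exactly on the diagram, so that the
diagram is the only set with these row and column sums that maximizes its sum. -/
lemma mem_of_injective {lam : YoungDiagram} (g : Equiv.Perm lam.cells)
    (h : Function.Injective fun c : lam.cells => (c.1.1, (g c).1.2)) (c₀ : lam.cells) :
    (c₀.1.1, (g c₀).1.2) ∈ lam.cells := by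
  let w : ℕ × ℕ → ℤ := fun x => ((lam.rowLen x.1 : ℤ) - x.1) + ((lam.colLen x.2 : ℤ) - x.2) - 1
  have hpos : ∀ x ∈ lam.cells, 0 ≤ w x := by
    rintro ⟨i, j⟩ hx
    have h1 := YoungDiagram.mem_iff_lt_rowLen.1 ((YoungDiagram.mem_cells _).1 hx)
    have h2 := YoungDiagram.mem_iff_lt_colLen.1 ((YoungDiagram.mem_cells _).1 hx)
    simp only [w]
    omega
  have hneg : ∀ x, x ∉ lam.cells → w x < 0 := by
    rintro ⟨i, j⟩ hx
    have h1 := mt YoungDiagram.mem_iff_lt_rowLen.2 (mt (YoungDiagram.mem_cells _).2 hx)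
    have h2 := mt YoungDiagram.mem_iff_lt_colLen.2 (mt (YoungDiagram.mem_cells _).2 hx)
    simp only [w]
    omega
  have hsum : ∑ c : lam.cells, w (c.1.1, (g c).1.2) = ∑ c : lam.cells, w c.1 := by
    simp only [w, Finset.sum_sub_distrib, Finset.sum_add_distrib]
    rw [Equiv.sum_comp g fun c => (lam.colLen c.1.2 : ℤ), Equiv.sum_comp g fun c => (c.1.2 : ℤ)]
  let X : Finset (ℕ × ℕ) := Finset.univ.image fun c : lam.cells => (c.1.1, (g c).1.2)
  have hX : ∑ x ∈ X, w x = ∑ x ∈ lam.cells, w x := by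
    rw [Finset.sum_image fun a _ b _ hab => h hab, hsum, Finset.univ_eq_attach,
      Finset.sum_attach lam.cells w]
  by_contra h0
  have h1 : ∑ x ∈ X, w x < ∑ x ∈ X ∩ lam.cells, w x := by
    rw [← Finset.sum_inter_add_sum_sdiff X lam.cells w]
    have : ∑ x ∈ X \ lam.cells, w x < 0 :=
      Finset.sum_neg (fun x hx => hneg x (Finset.mem_sdiff.1 hx).2)
        ⟨_, Finset.mem_sdiff.2 ⟨Finset.mem_image_of_mem _ (Finset.mem_univ c₀), h0⟩⟩
    omega
  have h2 : ∑ x ∈ X ∩ lam.cells, w x ≤ ∑ x ∈ lam.cells, w x :=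
    Finset.sum_le_sum_of_subset_of_nonneg Finset.inter_subset_right fun x hx _ => hpos x hx
  omega

/-- If no two cells of a row are sent by `g⁻¹` to the same column, then `g` is the product of a
permutation preserving the rows and one preserving the columns. -/
lemma exists_row_mul_col {lam : YoungDiagram} (g : Equiv.Perm lam.cells)
    (h : ∀ c d : lam.cells, c ≠ d → c.1.1 = d.1.1 → (g⁻¹ c).1.2 ≠ (g⁻¹ d).1.2) :
    ∃ p q, IsRow p ∧ IsCol q ∧ g = p * q := by
  have hinj : Function.Injective fun c : lam.cells => (c.1.1, (g⁻¹ c).1.2) := by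
    intro c d hcd
    by_contra hne
    obtain ⟨h1, h2⟩ := Prod.mk.inj hcd
    exact h c d hne h1 h2
  let F : lam.cells → lam.cells := fun c => ⟨(c.1.1, (g⁻¹ c).1.2), mem_of_injective g⁻¹ hinj c⟩
  have hF : Function.Bijective F := by
    rw [← Finite.injective_iff_bijective]
    exact fun c d hcd => hinj (congrArg Subtype.val hcd)
  let f : Equiv.Perm lam.cells := Equiv.ofBijective F hF
  have hf : ∀ c, (f c).1 = (c.1.1, (g⁻¹ c).1.2) := fun c => rfl
  refine ⟨f⁻¹, f * g, fun c => ?_, fun c => ?_, by group⟩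
  · have := hf (f⁻¹ c)
    rw [Equiv.Perm.coe_inv, Equiv.apply_symm_apply] at this
    rw [Equiv.Perm.coe_inv]
    rw [this]
  · rw [Equiv.Perm.mul_apply, hf, Equiv.Perm.coe_inv, Equiv.symm_apply_apply]

/-- The elements `x` of the group algebra with `p x q = sgn(q) x` for `p` preserving the rows and
`q` preserving the columns. -/
def IsYoung (lam : YoungDiagram) (x : MonoidAlgebra ℂ (Equiv.Perm lam.cells)) : Prop :=
  (∀ p, IsRow p → MonoidAlgebra.of ℂ _ p * x = x) ∧
    ∀ q, IsCol q → x * MonoidAlgebra.of ℂ _ q = ((Equiv.Perm.sign q : ℤ) : ℂ) • x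

lemma isYoung_youngSymmetrizer (lam : YoungDiagram) : IsYoung lam (youngSymmetrizer lam) := by
  constructor
  · intro p hp
    rw [youngSymmetrizer, ← mul_assoc]
    refine congrArg₂ _ ?_ rfl
    rw [Finset.mul_sum]
    refine Finset.sum_bij (fun s _ => p * s) (fun s hs => ?_) (fun s _ t _ h => mul_left_cancel h)
      (fun s hs => ?_) fun s _ => (map_mul (MonoidAlgebra.of ℂ _) p s).symm
    · rw [Finset.mem_filter] at hs ⊢
      refine ⟨Finset.mem_univ _, fun c => ?_⟩
      rw [Equiv.Perm.mul_apply, hp, hs.2]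
    · rw [Finset.mem_filter] at hs
      refine ⟨p⁻¹ * s, Finset.mem_filter.2 ⟨Finset.mem_univ _, fun c => ?_⟩, by group⟩
      rw [← hp, Equiv.Perm.mul_apply, Equiv.Perm.coe_inv, Equiv.apply_symm_apply, hs.2]
  · intro q hq
    rw [youngSymmetrizer, mul_assoc, ← mul_smul_comm]
    refine congrArg₂ _ rfl ?_
    rw [Finset.sum_mul, Finset.smul_sum]
    refine Finset.sum_bij (fun s _ => s * q) (fun s hs => ?_) (fun s _ t _ h => mul_right_cancel h)
      (fun s hs => ?_) fun s _ => ?_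
    · rw [Finset.mem_filter] at hs ⊢
      refine ⟨Finset.mem_univ _, fun c => ?_⟩
      rw [Equiv.Perm.mul_apply, hs.2, hq]
    · rw [Finset.mem_filter] at hs
      refine ⟨s * q⁻¹, Finset.mem_filter.2 ⟨Finset.mem_univ _, fun c => ?_⟩, by group⟩
      rw [Equiv.Perm.mul_apply, hs.2, ← hq, Equiv.Perm.coe_inv, Equiv.apply_symm_apply]
    · rw [smul_mul_assoc, ← map_mul, smul_smul, Equiv.Perm.sign_mul]
      congr 1
      rcases Int.units_eq_one_or (Equiv.Perm.sign q) with h | h <;> simp [h]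

/-- An element of the group algebra with the symmetries of the Young symmetrizer is determined
by its coefficient at the identity. -/
lemma IsYoung.eq_zero {lam : YoungDiagram} {x : MonoidAlgebra ℂ (Equiv.Perm lam.cells)}
    (hx : IsYoung lam x) (h1 : x.coeff 1 = 0) : x = 0 := by
  have hrow : ∀ p, IsRow p → ∀ g, x.coeff (p * g) = x.coeff g := fun p hp g => by
    have h := MonoidAlgebra.coeff_single_mul_mul x 1 p g
    rw [← MonoidAlgebra.of_apply, hx.1 p hp, one_mul] at h
    exact h
  have hcol : ∀ q, IsCol q → ∀ g, x.coeff (g * q) = ((Equiv.Perm.sign q : ℤ) : ℂ) * x.coeff g :=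
    fun q hq g => by
      have h := MonoidAlgebra.coeff_mul_single_mul x 1 q g
      rw [← MonoidAlgebra.of_apply, hx.2 q hq, mul_one, MonoidAlgebra.coeff_smul,
        Finsupp.smul_apply, smul_eq_mul] at h
      rw [← h, ← mul_assoc, ← Int.cast_mul, Int.units_coe_mul_self, Int.cast_one, one_mul]
  ext g
  rw [MonoidAlgebra.coeff_zero, Finsupp.zero_apply]
  by_cases h : ∀ c d : lam.cells, c ≠ d → c.1.1 = d.1.1 → (g⁻¹ c).1.2 ≠ (g⁻¹ d).1.2
  · obtain ⟨p, q, hp, hq, rfl⟩ := exists_row_mul_col g h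
    have h2 := hcol q hq 1
    rw [one_mul] at h2
    rw [hrow p hp, h2, h1, mul_zero]
  · push Not at h
    obtain ⟨c, d, hne, hr, hc⟩ := h
    -- the transposition of `c` and `d` preserves the rows, and `g` conjugates it to a
    -- transposition preserving the columns
    have hswap : Equiv.swap c d * g = g * Equiv.swap (g⁻¹ c) (g⁻¹ d) := by
      exact Equiv.swap_mul_eq_mul_swap g c d
    have hrs : IsRow (Equiv.swap c d) := by
      intro e
      rw [Equiv.swap_apply_def]
      split_ifs with h1 h2
      · rw [h1, hr]
      · rw [h2, hr]
      · rfl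
    have hcs : IsCol (Equiv.swap (g⁻¹ c) (g⁻¹ d)) := by
      intro e
      rw [Equiv.swap_apply_def]
      split_ifs with h1 h2
      · rw [h1, hc]
      · rw [h2, hc]
      · rfl
    have h2 := hrow _ hrs g
    rw [hswap, hcol _ hcs, Equiv.Perm.sign_swap fun h => hne (g⁻¹.injective h)] at h2
    simp only [Units.val_neg, Units.val_one, Int.cast_neg, Int.cast_one, neg_mul, one_mul] at h2
    exact self_eq_neg.1 h2.symm

lemma coeff_one_youngSymmetrizer (lam : YoungDiagram) : (youngSymmetrizer lam).coeff 1 = 1 := by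
  rw [youngSymmetrizer, Finset.sum_mul_sum]
  simp only [mul_smul_comm, MonoidAlgebra.coeff_sum, Finsupp.finsetSum_apply,
    MonoidAlgebra.coeff_smul, Finsupp.smul_apply, smul_eq_mul, MonoidAlgebra.of_apply,
    MonoidAlgebra.single_mul_single, mul_one, MonoidAlgebra.coeff_single, Finsupp.single_apply]
  rw [Finset.sum_eq_single 1, Finset.sum_eq_single 1]
  · simp
  · intro q _ hq
    rw [one_mul, if_neg hq, mul_zero]
  · exact fun h => absurd (Finset.mem_filter.2 ⟨Finset.mem_univ _, fun _ => rfl⟩) h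
  · intro p hp hp1
    refine Finset.sum_eq_zero fun q hq => ?_
    rw [Finset.mem_filter] at hp hq
    rw [if_neg, mul_zero]
    intro hpq
    apply hp1
    -- `p = q⁻¹` preserves both the rows and the columns
    refine Equiv.ext fun c => Subtype.ext (Prod.ext (hp.2 c) ?_)
    rw [← hq.2, ← Equiv.Perm.mul_apply, mul_eq_one_comm.1 hpq]
  · exact fun h => absurd (Finset.mem_filter.2 ⟨Finset.mem_univ _, fun _ => rfl⟩) h

/-- von Neumann's lemma. -/
lemma IsYoung.eq_smul {lam : YoungDiagram} {x : MonoidAlgebra ℂ (Equiv.Perm lam.cells)}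
    (hx : IsYoung lam x) : x = x.coeff 1 • youngSymmetrizer lam := by
  have hc := isYoung_youngSymmetrizer lam
  rw [← sub_eq_zero]
  refine IsYoung.eq_zero ⟨fun p hp => ?_, fun q hq => ?_⟩ ?_
  · rw [mul_sub, mul_smul_comm, hx.1 p hp, hc.1 p hp]
  · rw [sub_mul, smul_mul_assoc, hx.2 q hq, hc.2 q hq, smul_sub, smul_comm]
  · rw [MonoidAlgebra.coeff_sub, Finsupp.sub_apply, MonoidAlgebra.coeff_smul,
      Finsupp.smul_apply, smul_eq_mul, coeff_one_youngSymmetrizer, mul_one, sub_self]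

/-! ### Central characters -/

/-- The class sum of the permutations of cycle type `Γ` in the group algebra. -/
def permClassSum (lam : YoungDiagram) (Γ : Part) : MonoidAlgebra ℂ (Equiv.Perm lam.cells) :=
  ∑ s : Equiv.Perm lam.cells with cycType s = Γ, MonoidAlgebra.of ℂ _ s

lemma permClassSum_comm (lam : YoungDiagram) (Γ : Part)
    (x : MonoidAlgebra ℂ (Equiv.Perm lam.cells)) :
    permClassSum lam Γ * x = x * permClassSum lam Γ := by
  have hof : ∀ g, permClassSum lam Γ * MonoidAlgebra.of ℂ _ g =
      MonoidAlgebra.of ℂ _ g * permClassSum lam Γ := by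
    intro g
    rw [permClassSum, Finset.sum_mul, Finset.mul_sum]
    refine Finset.sum_bij (fun s _ => g⁻¹ * s * g) (fun s hs => ?_)
      (fun s _ t _ h => mul_left_cancel (mul_right_cancel h)) (fun s hs => ?_) fun s _ => ?_
    · rw [Finset.mem_filter] at hs ⊢
      have := cycType_conj s g⁻¹
      rw [inv_inv] at this
      exact ⟨Finset.mem_univ _, this.trans hs.2⟩
    · rw [Finset.mem_filter] at hs
      exact ⟨g * s * g⁻¹, Finset.mem_filter.2 ⟨Finset.mem_univ _, (cycType_conj s g).trans hs.2⟩,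
        by group⟩
    · rw [← map_mul, ← map_mul]
      congr 1
      group
  induction x using MonoidAlgebra.induction_linear with
  | zero => rw [mul_zero, zero_mul]
  | add f g hf hg => rw [mul_add, add_mul, hf, hg]
  | single g r =>
    have h1 : MonoidAlgebra.single g r = r • MonoidAlgebra.of ℂ _ g := by simp
    rw [h1, mul_smul_comm, smul_mul_assoc, hof]

/-- Class sums act on `ℂ[𝒮_{|λ|}] c_λ` as scalars: their products with the Young symmetrizer
have the same symmetries as the Young symmetrizer. -/
lemma exists_central_char (lam : YoungDiagram) (Γ : Part) :
    ∃ r : ℂ, ∀ x ∈ spechtModule lam, permClassSum lam Γ * x = r • x := by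
  have hc := isYoung_youngSymmetrizer lam
  have hK : IsYoung lam (permClassSum lam Γ * youngSymmetrizer lam) := by
    refine ⟨fun p hp => ?_, fun q hq => ?_⟩
    · rw [← mul_assoc, ← permClassSum_comm, mul_assoc, hc.1 p hp]
    · rw [mul_assoc, hc.2 q hq, mul_smul_comm]
  refine ⟨(permClassSum lam Γ * youngSymmetrizer lam).coeff 1, fun x hx => ?_⟩
  obtain ⟨a, rfl⟩ := Ideal.mem_span_singleton'.1 hx
  rw [← mul_assoc, permClassSum_comm, mul_assoc, ← mul_smul_comm, ← hK.eq_smul]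

/-- The scalar by which the class sum acts on `ℂ[𝒮_{|λ|}] c_λ`. -/
def centralChar (lam : YoungDiagram) (Γ : Part) : ℂ := (exists_central_char lam Γ).choose

lemma permClassSum_mul (lam : YoungDiagram) (Γ : Part) {x : MonoidAlgebra ℂ (Equiv.Perm lam.cells)}
    (hx : x ∈ spechtModule lam) : permClassSum lam Γ * x = centralChar lam Γ • x :=
  (exists_central_char lam Γ).choose_spec x hx

lemma sum_spechtRep (lam : YoungDiagram) (Γ : Part) :
    ∑ s : Equiv.Perm lam.cells with cycType s = Γ, spechtRep lam s =
      centralChar lam Γ • (1 : Module.End ℂ (spechtModule lam)) := by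
  refine LinearMap.ext fun v => Subtype.ext ?_
  have h := permClassSum_mul lam Γ v.2
  rw [permClassSum, Finset.sum_mul] at h
  rw [LinearMap.sum_apply, AddSubmonoidClass.coe_finsetSum]
  exact h

lemma sum_character_mul (lam : YoungDiagram) (Γ : Part) (t : Equiv.Perm lam.cells) :
    ∑ s : Equiv.Perm lam.cells with cycType s = Γ, (spechtRep lam).character (s * t) =
      centralChar lam Γ * (spechtRep lam).character t := by
  simp only [Representation.character, map_mul]
  rw [← map_sum, ← Finset.sum_mul, sum_spechtRep, smul_mul_assoc, one_mul, map_smul, smul_eq_mul]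

lemma chi_eq (lam : YoungDiagram) (s : Equiv.Perm lam.cells) :
    chi lam (cycType s) = (spechtRep lam).character s := by
  have h : ∃ σ : Equiv.Perm lam.cells, cycType σ = cycType s := ⟨s, rfl⟩
  rw [chi, dif_pos h]
  obtain ⟨e, he⟩ := (cycType_eq_iff _ _).1 h.choose_spec
  have : s = e * h.choose * e⁻¹ := by
    rw [eq_mul_inv_iff_mul_eq]
    exact Equiv.ext fun a => (he a).symm
  conv_rhs => rw [this]
  rw [Representation.char_conj]

lemma card_cells (lam : YoungDiagram) : Fintype.card lam.cells = lam.card := Fintype.card_coe _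

lemma classCard_eq {lam : YoungDiagram} {Δ : Part} (h : size Δ ≤ lam.card) :
    classCard Δ lam.card = (Finset.univ.filter fun s : Equiv.Perm lam.cells =>
      cycType s = shift lam.card Δ).card := by
  have h1 := card_cycType_mul_zee (α := Fin lam.card) (Γ := shift lam.card Δ)
    (by rw [size_shift h, Fintype.card_fin])
  have h2 := card_cycType_mul_zee (α := lam.cells) (Γ := shift lam.card Δ)
    (by rw [size_shift h, card_cells])
  rw [Fintype.card_fin] at h1
  rw [card_cells, ← h1] at h2
  rw [classCard, Fintype.card_subtype]
  exact (mul_right_cancel₀ (zee_ne_zero _) h2).symm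

lemma classCard_mul_chi {lam : YoungDiagram} {Δ : Part} (h : size Δ ≤ lam.card) :
    (classCard Δ lam.card : ℂ) * chi lam (shift lam.card Δ) =
      ∑ s : Equiv.Perm lam.cells with cycType s = shift lam.card Δ,
        (spechtRep lam).character s := by
  rw [classCard_eq h, ← nsmul_eq_mul, ← Finset.sum_const]
  refine Finset.sum_congr rfl fun s hs => ?_
  rw [← (Finset.mem_filter.1 hs).2, chi_eq]

lemma dimIrr_mul_phi {lam : YoungDiagram} {Δ : Part} (h : size Δ ≤ lam.card) :
    (dimIrr lam : ℂ) * phi lam Δ = ((lam.card - size Δ + Δ 1).choose (Δ 1) : ℂ) *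
      ∑ s : Equiv.Perm lam.cells with cycType s = shift lam.card Δ,
        (spechtRep lam).character s := by
  rw [← classCard_mul_chi h, phi, if_pos h]
  by_cases h0 : dimIrr lam = 0
  · -- the characters vanish on a module of dimension zero
    have : Subsingleton (spechtModule lam) := Module.finrank_zero_iff.1 h0
    have hchi : (classCard Δ lam.card : ℂ) * chi lam (shift lam.card Δ) = 0 := by
      rw [classCard_mul_chi h]
      refine Finset.sum_eq_zero fun s _ => ?_
      rw [Representation.character, Subsingleton.elim (spechtRep lam s) 0, map_zero]
    rw [hchi, h0]
    simp
  · have h1 : (dimIrr lam : ℂ) ≠ 0 := Nat.cast_ne_zero.2 h0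
    field_simp

/-- `φ_λ(Δ)` is the scalar by which the sum of the partial permutations of cycle type `Δ` acts.
The factor `dim λ` avoids a division; it also occurs in the coefficients of `S_λ`. -/
lemma dimIrr_mul_phi_eq {lam : YoungDiagram} {Δ : Part} (h : size Δ ≤ lam.card) :
    (dimIrr lam : ℂ) * phi lam Δ = (dimIrr lam : ℂ) *
      (((lam.card - size Δ + Δ 1).choose (Δ 1) : ℂ) * centralChar lam (shift lam.card Δ)) := by
  have h1 := sum_character_mul lam (shift lam.card Δ) 1
  simp only [mul_one, Representation.char_one] at h1
  rw [dimIrr_mul_phi h, h1, dimIrr]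
  ring

/-! ### Schur functions are eigenvectors -/

/-- The coefficients of the Schur functions without the powers of `z`. -/
def schurCoeff (lam : YoungDiagram) (Γ : Part) : ℂ :=
  (dimIrr lam : ℂ) / (lam.card ! : ℂ) * phi lam Γ

lemma schurCoeff_eq {lam : YoungDiagram} {Γ : Part} (h : size Γ = lam.card) :
    (lam.card ! : ℂ) * schurCoeff lam Γ =
      ∑ s : Equiv.Perm lam.cells with cycType s = Γ, (spechtRep lam).character s := by
  have h1 := dimIrr_mul_phi (lam := lam) h.le
  rw [shift_of_size h, choose_self_of_size h, one_mul] at h1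
  have h2 : (lam.card ! : ℂ) ≠ 0 := Nat.cast_ne_zero.2 (Nat.factorial_ne_zero _)
  rw [← h1, schurCoeff]
  field_simp

lemma transCount_ofPerm {V : Type*} [Fintype V] [DecidableEq V] {S : Finset ℕ+}
    (e : V ≃ {i // i ∈ S}) {Δ : Part} (h : size Δ ≤ S.card) (t : Equiv.Perm V) (Γ : Part) :
    transCount Δ (ofPerm e t) Γ = (S.card - size Δ + Δ 1).choose (Δ 1) *
      ∑ s : Equiv.Perm V with cycType s = shift S.card Δ,
        if cycType (s * t) = Γ then 1 else 0 := by
  rw [transCount_eq_sum]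
  have h1 := sum_within_type e h fun y => if (y * ofPerm e t).type = Γ then 1 else 0
  rw [smul_eq_mul] at h1
  refine Eq.trans ?_ (h1.trans ?_)
  · refine Finset.sum_congr rfl fun x _ => ?_
    rw [mul_ofPerm]
  · refine congrArg _ (Finset.sum_congr rfl fun s _ => ?_)
    rw [ofPerm_mul, type_ofPerm]

/-- The coefficients of `S_λ` form an eigenvector of the transition matrix of `W(Δ, z)`. -/
lemma sum_transCount_schurCoeff (Δ : Part) (lam : YoungDiagram) {Γ : Part}
    (hΓ : size Γ = lam.card) :
    ∑ Γ' ∈ partsOf lam.card, (transCount Δ (std Γ') Γ : ℂ) * schurCoeff lam Γ' =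
      phi lam Δ * schurCoeff lam Γ := by
  obtain ⟨e⟩ := equiv_full (card_cells lam)
  have hfac : (lam.card ! : ℂ) ≠ 0 := Nat.cast_ne_zero.2 (Nat.factorial_ne_zero _)
  have hL : (lam.card ! : ℂ) *
      ∑ Γ' ∈ partsOf lam.card, (transCount Δ (std Γ') Γ : ℂ) * schurCoeff lam Γ' =
      ∑ t : Equiv.Perm lam.cells,
        (transCount Δ (ofPerm e t) Γ : ℂ) * (spechtRep lam).character t := by
    rw [Finset.mul_sum, ← Finset.sum_fiberwise_of_maps_to (t := partsOf lam.card)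
      (g := fun t : Equiv.Perm lam.cells => cycType t) fun t _ => by
        rw [mem_partsOf, size_cycType, card_cells]]
    refine Finset.sum_congr rfl fun Γ' hΓ' => ?_
    rw [mul_left_comm, schurCoeff_eq (mem_partsOf.1 hΓ'), Finset.mul_sum]
    refine Finset.sum_congr rfl fun t ht => ?_
    rw [transCount_congr (σ' := ofPerm e t)]
    rw [std_type, type_ofPerm, (Finset.mem_filter.1 ht).2]
  refine mul_left_cancel₀ hfac ?_
  rw [hL]
  by_cases hΔ : size Δ ≤ lam.card
  · have hΔ' : size Δ ≤ (full lam.card).card := by rwa [card_full]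
    have h1 : ∑ t : Equiv.Perm lam.cells,
        (transCount Δ (ofPerm e t) Γ : ℂ) * (spechtRep lam).character t =
        ((lam.card - size Δ + Δ 1).choose (Δ 1) : ℂ) *
          ∑ s : Equiv.Perm lam.cells with cycType s = shift lam.card Δ,
            ∑ t : Equiv.Perm lam.cells with cycType t = Γ,
              (spechtRep lam).character (s * t) := by
      simp only [transCount_ofPerm e hΔ', card_full, Nat.cast_mul, Nat.cast_sum, mul_assoc]
      rw [← Finset.mul_sum]
      congr 1
      simp only [Finset.sum_mul]
      rw [Finset.sum_comm]
      -- the class of `s` is closed under inverses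
      refine Finset.sum_nbij' (fun s => s⁻¹) (fun s => s⁻¹) (fun s hs => ?_) (fun s hs => ?_)
        (fun s _ => inv_inv s) (fun s _ => inv_inv s) fun s _ => ?_
      · rw [Finset.mem_filter] at hs ⊢
        exact ⟨Finset.mem_univ _, (cycType_inv s).trans hs.2⟩
      · rw [Finset.mem_filter] at hs ⊢
        exact ⟨Finset.mem_univ _, (cycType_inv s).trans hs.2⟩
      · rw [Finset.sum_filter, ← Equiv.sum_comp (Equiv.mulLeft s⁻¹)]
        refine Finset.sum_congr rfl fun t _ => ?_
        simp only [Equiv.coe_mulLeft, mul_inv_cancel_left]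
        split_ifs <;> simp
    have h2 := dimIrr_mul_phi_eq (lam := lam) hΔ
    rw [h1, Finset.sum_comm, Finset.sum_congr rfl fun t _ => sum_character_mul lam _ t,
      ← Finset.mul_sum, ← schurCoeff_eq hΓ, schurCoeff]
    linear_combination (-1 : ℂ) * phi lam Γ * h2 * ((lam.card ! : ℂ) * (lam.card ! : ℂ)⁻¹)
  · rw [phi, if_neg hΔ, zero_mul, mul_zero]
    refine Finset.sum_eq_zero fun t _ => ?_
    have hS : (ofPerm e t).supp.card < size Δ := by
      change (full lam.card).card < _
      rw [card_full]
      omega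
    rw [transCount_eq_sum, within_type_eq_empty hS]
    simp

theorem W_schurZ {R : Type*} [CommRing R] [Algebra ℂ R] (z : Rˣ) (Δ : Part)
    (lam : YoungDiagram) :
    W Δ z (schurZ lam z) = (((z ^ ((size Δ : ℤ) - len Δ) : Rˣ) : R) *
      algebraMap ℂ R (phi lam Δ)) • schurZ lam z := by
  have hS : ∀ Γ, MvPowerSeries.coeff Γ (schurZ lam z : MvPowerSeries ℕ+ R) =
      if size Γ = lam.card then ((z ^ (-(size Γ : ℤ) - len Γ) : Rˣ) : R) *
        algebraMap ℂ R (schurCoeff lam Γ) else 0 := fun Γ => rfl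
  refine MvPowerSeries.ext fun Γ => ?_
  rw [coeff_W, map_smul, smul_eq_mul, hS]
  by_cases hΓ : size Γ = lam.card
  · rw [if_pos hΓ, hΓ]
    have h := congrArg (algebraMap ℂ R) (sum_transCount_schurCoeff Δ lam hΓ)
    rw [map_sum, map_mul] at h
    have hl : ∀ Γ' ∈ partsOf lam.card,
        ((z ^ ((size Δ : ℤ) - len Δ + len Γ' - len Γ) : Rˣ) : R) *
          (transCount Δ (std Γ') Γ : R) * MvPowerSeries.coeff Γ' (schurZ lam z) =
        ((z ^ ((size Δ : ℤ) - len Δ) : Rˣ) : R) *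
          ((z ^ (-(lam.card : ℤ) - len Γ) : Rˣ) : R) *
            algebraMap ℂ R ((transCount Δ (std Γ') Γ : ℂ) * schurCoeff lam Γ') := by
      intro Γ' hΓ'
      rw [mem_partsOf] at hΓ'
      have hz : ((z ^ ((size Δ : ℤ) - len Δ + len Γ' - len Γ) : Rˣ) : R) *
          ((z ^ (-(lam.card : ℤ) - len Γ') : Rˣ) : R) =
          ((z ^ ((size Δ : ℤ) - len Δ) : Rˣ) : R) *
            ((z ^ (-(lam.card : ℤ) - len Γ) : Rˣ) : R) := by
        rw [← Units.val_mul, ← Units.val_mul, ← zpow_add, ← zpow_add]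
        congr 2
        ring
      rw [hS, if_pos hΓ', hΓ', map_mul, map_natCast, ← hz]
      ring
    rw [Finset.sum_congr rfl hl, ← Finset.mul_sum, h]
    ring
  · rw [if_neg hΓ, mul_zero]
    refine Finset.sum_eq_zero fun Γ' hΓ' => ?_
    rw [hS, if_neg fun h => hΓ ((mem_partsOf.1 hΓ').symm.trans h), mul_zero]

end CutJoin

end

theorem theorem4p4 {R : Type*} [CommRing R] [Algebra ℂ R] (z : Rˣ) :
    (∀ Δ₁ Δ₂ : CutJoin.Part,
      CutJoin.W Δ₁ z * CutJoin.W Δ₂ z =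
        (CutJoin.structConst Δ₁ Δ₂).sum fun Δ₃ c =>
          (((z ^ (((CutJoin.size Δ₁ : ℤ) - CutJoin.len Δ₁) +
              ((CutJoin.size Δ₂ : ℤ) - CutJoin.len Δ₂) -
              ((CutJoin.size Δ₃ : ℤ) - CutJoin.len Δ₃)) : Rˣ) : R) * algebraMap ℂ R c) •
            CutJoin.W Δ₃ z) ∧
    (∀ (Δ : CutJoin.Part) (lam : YoungDiagram),
      CutJoin.W Δ z (CutJoin.schurZ lam z) =
        (((z ^ ((CutJoin.size Δ : ℤ) - CutJoin.len Δ) : Rˣ) : R) *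
          algebraMap ℂ R (CutJoin.phi lam Δ)) • CutJoin.schurZ lam z) :=
  ⟨CutJoin.W_mul_W z, CutJoin.W_schurZ z⟩
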